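/- **Conventions.** A multilinear polynomial $p(x)=\sum_{S\subseteq[n]}\hat p(S)\prod_{i\in S}x_i$ over $\{-1,1\}^n$ is *degree-$d$* if $\hat p(S)=0$ whenever $|S|>d$. Put $\mathrm{Var}[p]=\sum_{S\neq\emptyset}\hat p(S)^2$ and $\mathrm{Inf}_i(p)=\sum_{S\ni i}\hat p(S)^2$. The polynomial $p$ is *$\tau$-regular* if $\mathrm{Inf}_i(p)\le\tau\,\mathrm{Var}[p]$ for all $i\in[n]$. For a constant $C>0$, a degree-$d$ polynomial $p$ is *$\epsilon$-skewed* if $|\hat p(\emptyset)|\ge (C\log(d/\epsilon))^{d/2}\sqrt{\mathrm{Var}[p]}$. Let $\mathrm{sign}(z)=1$ for $z\ge 0$ and $\mathrm{sign}(z)=-1$ for $z<0$. Probabilities over $x$ are with respect to the uniform distribution on $\{-1,1\}^n$. A decision tree queries a variable at each internal node and no variable twice on a path; a random path takes each branch with probability $1/2$; a leaf is identified with the restriction $\rho$ that fixes the variables on its path, and $p_\rho$ is $p$ with these values substituted. For $A\in\mathbb N$ let $$D_{d,k}(\tau,\epsilon,\delta)=\Big(\frac1\tau\cdot\log\frac1\epsilon\Big)^{(2d)^{Ak}}\cdot\log\frac1\delta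 .$$ **Statement.** There are an absolute constant $C>0$ (used in the definition of $\epsilon$-skewed), absolute constants $A,c\in\mathbb N$, and a deterministic algorithm $\mathtt{ConstructTree}$ in the unit-cost real-number model such that the following hold for all $d,k\ge1$, $n\ge0$ and $0<\tau,\epsilon,\delta<1/4$. 1. If a degree-$d$ multilinear polynomial $p$ over $\{-1,1\}^n$ is $\epsilon$-skewed, then $\Pr_x[\mathrm{sign}(p(x))\neq\mathrm{sign}(\hat p(\emptyset))]\le\epsilon$. 2. For all real degree-$d$ multilinear polynomials $p_1,\dots,p_k$ over $\{-1,1\}^n$ there is a decision tree of depth at most $D_{d,k}(\tau,\epsilon,\delta)$ such that, with probability at least $1-\delta$, at the leaf $\rho$ reached by a random path each of $(p_1)_\rho,\dots,(p_k)_\rho$ is $\tau$-regular or $\epsilon$-skewed. 3. If $p_1,\dots,p_k$ are degree-$d$ multilinear polynomials over $\{-1,1\}^n$ whose coefficients are integers of absolute value less than $2^b$, then $\mathtt{ConstructTree}$, given $n,k,d,\tau,\epsilon,\delta$ and the coefficients, halts within $$c\cdot\big((n+1)^d\,(b+1)\,2^{D_{d,k}(\tau,\epsilon,\delta)}\big)^c$$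 steps (so in time $\mathrm{poly}(n,b,2^{D_{d,k}(\tau,\epsilon,\delta)})$ for each fixed $d$) and outputs a decision tree $T$ of depth at most $D_{d,k}(\tau,\epsilon,\delta)$ in which each leaf $\rho$ carries the polynomials $(p_1)_\rho,\dots,(p_k)_\rho$ and labels $\mathrm{label}_1(\rho),\dots,\mathrm{label}_k(\rho)\in\{+1,-1,\text{fail},\text{regular}\}$ such that, for every leaf $\rho$ and $i\in[k]$: - if $\mathrm{label}_i(\rho)\in\{+1,-1\}$, then $(p_i)_\rho$ is $\epsilon$-skewed and $\Pr_x[\mathrm{sign}((p_i)_\rho(x))\neq\mathrm{label}_i(\rho)]\le\epsilon$; - if $\mathrm{label}_i(\rho)=\text{regular}$, then $(p_i)_\rho$ is $\tau$-regular; and, with probability at least $1-\delta$, a random path reaches a leaf $\rho$ with $\mathrm{label}_i(\rho)\neq\text{fail}$ for all $i\in[k]$. -/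

import Mathlib

namespace PTFReg

/-! ### Multilinear polynomials over the hypercube -/

/-- A real multilinear polynomial `∑ S, p S * ∏ i ∈ S, x i` in `n` variables, given by its
coefficients. -/
abbrev MPoly (n : ℕ) : Type := Finset (Fin n) → ℝ

/-- The polynomial has degree at most `d`. -/
def HasDegree {n : ℕ} (d : ℕ) (p : MPoly n) : Prop :=
  ∀ S : Finset (Fin n), d < S.card → p S = 0

/-- The value of the polynomial at a point of the cube `{-1,1}^n` (signs are elements of `ℤˣ`). -/
def eval {n : ℕ} (p : MPoly n) (x : Fin n → ℤˣ) : ℝ :=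
  ∑ S : Finset (Fin n), p S * ∏ i ∈ S, (((x i : ℤˣ) : ℤ) : ℝ)

/-- The variance of `p(x)` for uniform `x`: the sum of the squared non-constant coefficients. -/
def variance {n : ℕ} (p : MPoly n) : ℝ :=
  ∑ S : Finset (Fin n) with S ≠ ∅, p S ^ 2

/-- The influence of variable `i`. -/
def influence {n : ℕ} (p : MPoly n) (i : Fin n) : ℝ :=
  ∑ S : Finset (Fin n) with i ∈ S, p S ^ 2

/-- `τ`-regularity. -/
def IsRegular {n : ℕ} (τ : ℝ) (p : MPoly n) : Prop :=
  ∀ i : Fin n, influence p i ≤ τ * variance p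

/-- `ε`-skewness of a degree-`d` polynomial, with respect to the constant `C`: the mean
dominates the standard deviation. -/
def IsSkewed {n : ℕ} (C : ℝ) (d : ℕ) (ε : ℝ) (p : MPoly n) : Prop :=
  (C * Real.log ((d : ℝ) / ε)) ^ ((d : ℝ) / 2) * Real.sqrt (variance p) ≤ |p ∅|

/-- `(τ, ε)`-good: regular or skewed. -/
def IsGood {n : ℕ} (C : ℝ) (d : ℕ) (τ ε : ℝ) (p : MPoly n) : Prop :=
  IsRegular τ p ∨ IsSkewed C d ε p

/-- The sign of a real number, with `sign 0 = 1`. -/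
noncomputable def sgn (r : ℝ) : ℤˣ := if 0 ≤ r then 1 else -1

open Classical in
/-- Probability of an event under the uniform distribution on `{-1,1}^n`. -/
noncomputable def cubeProb {n : ℕ} (E : (Fin n → ℤˣ) → Prop) : ℝ :=
  ((Finset.univ.filter E).card : ℝ) / 2 ^ n

/-! ### Restrictions and decision trees -/

/-- A partial assignment of signs to the variables; `none` means that the variable is free. -/
abbrev Restriction (n : ℕ) : Type := Fin n → Option ℤˣ

/-- The polynomial obtained by substituting the values fixed by `ρ`: the monomial `S` becomes
the monomial of its free variables, multiplied by the values of its fixed variables. -/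
def restrict {n : ℕ} (p : MPoly n) (ρ : Restriction n) : MPoly n := fun U =>
  ∑ S : Finset (Fin n) with S.filter (fun i => ρ i = none) = U,
    p S * ∏ i ∈ S, ((((ρ i).getD 1 : ℤˣ) : ℤ) : ℝ)

/-- A decision tree over `n` variables whose leaves carry data of type `α`. In
`node v lo hi` the subtree `lo` is taken if `x v = -1` and `hi` if `x v = 1`. -/
inductive DTree (n : ℕ) (α : Type) : Type
  | leaf (a : α) : DTree n α
  | node (v : Fin n) (lo hi : DTree n α) : DTree n α

namespace DTree

/-- The number of queries on a longest path. -/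
def depth {n : ℕ} {α : Type} : DTree n α → ℕ
  | leaf _ => 0
  | node _ lo hi => max lo.depth hi.depth + 1

/-- No variable of `Q` is queried, and no variable is queried twice on a path. -/
def ReadOnceAvoiding {n : ℕ} {α : Type} : DTree n α → Finset (Fin n) → Prop
  | leaf _, _ => True
  | node v lo hi, Q =>
      v ∉ Q ∧ lo.ReadOnceAvoiding (insert v Q) ∧ hi.ReadOnceAvoiding (insert v Q)

/-- No variable is queried twice on a path. -/
def ReadOnce {n : ℕ} {α : Type} (T : DTree n α) : Prop := T.ReadOnceAvoiding ∅

/-- `P` holds at all leaves; `ρ` is the restriction accumulated above the tree. -/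
def ForallLeavesFrom {n : ℕ} {α : Type} (P : Restriction n → α → Prop) :
    DTree n α → Restriction n → Prop
  | leaf a, ρ => P ρ a
  | node v lo hi, ρ =>
      lo.ForallLeavesFrom P (Function.update ρ v (some (-1))) ∧
      hi.ForallLeavesFrom P (Function.update ρ v (some 1))

/-- `P ρ a` holds for every leaf, with data `a`, reached by the path that fixes `ρ`. -/
def ForallLeaves {n : ℕ} {α : Type} (T : DTree n α) (P : Restriction n → α → Prop) : Prop :=
  T.ForallLeavesFrom P (fun _ => none)

open Classical in
/-- Probability that a random path ends in a leaf with `P`; `ρ` is the restriction accumulated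
above the tree. -/
noncomputable def leafProbFrom {n : ℕ} {α : Type} (P : Restriction n → α → Prop) :
    DTree n α → Restriction n → ℝ
  | leaf a, ρ => if P ρ a then 1 else 0
  | node v lo hi, ρ =>
      (lo.leafProbFrom P (Function.update ρ v (some (-1))) +
       hi.leafProbFrom P (Function.update ρ v (some 1))) / 2

/-- Probability that a random path from the root, which takes each of the two branches with
probability `1/2` at every node, ends in a leaf with `P ρ a`. -/
noncomputable def leafProb {n : ℕ} {α : Type} (T : DTree n α)
    (P : Restriction n → α → Prop) : ℝ :=
  T.leafProbFrom P (fun _ => none)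

end DTree

/-- The depth bound `(1/τ · log (1/ε)) ^ ((2d) ^ (A k)) · log (1/δ)`. -/
noncomputable def depthBound (A d k : ℕ) (τ ε δ : ℝ) : ℝ :=
  (1 / τ * Real.log (1 / ε)) ^ ((2 * d) ^ (A * k)) * Real.log (1 / δ)

/-! ### The unit-cost real-number machine

Registers and an addressable memory for natural numbers, registers and an addressable memory
for real numbers; exact arithmetic and comparisons at unit cost. The only real constants are
integers, and there is no rounding and no transcendental function. -/

/-- A configuration of the memory. -/
structure State where
  ireg : ℕ → ℕ
  rreg : ℕ → ℝ
  imem : ℕ → ℕ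
  rmem : ℕ → ℝ

/-- Elementary instructions; the first argument names the target register, except in the two
store instructions, where it names the register that holds the address. -/
inductive Instr : Type
  | iconst (r c : ℕ)
  | iadd (r a b : ℕ)
  | isub (r a b : ℕ)
  | imul (r a b : ℕ)
  | iload (r a : ℕ)
  | istore (a b : ℕ)
  | rconst (r : ℕ) (c : ℤ)
  | rofNat (r a : ℕ)
  | radd (r a b : ℕ)
  | rsub (r a b : ℕ)
  | rmul (r a b : ℕ)
  | rdiv (r a b : ℕ)
  | rload (r a : ℕ)
  | rstore (a b : ℕ)

/-- The effect of an instruction (subtraction of naturals is truncated, and `x / 0 = 0`). -/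
noncomputable def Instr.run : Instr → State → State
  | iconst r c, s => { s with ireg := Function.update s.ireg r c }
  | iadd r a b, s => { s with ireg := Function.update s.ireg r (s.ireg a + s.ireg b) }
  | isub r a b, s => { s with ireg := Function.update s.ireg r (s.ireg a - s.ireg b) }
  | imul r a b, s => { s with ireg := Function.update s.ireg r (s.ireg a * s.ireg b) }
  | iload r a, s => { s with ireg := Function.update s.ireg r (s.imem (s.ireg a)) }
  | istore a b, s => { s with imem := Function.update s.imem (s.ireg a) (s.ireg b) }
  | rconst r c, s => { s with rreg := Function.update s.rreg r (c : ℝ) }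
  | rofNat r a, s => { s with rreg := Function.update s.rreg r (s.ireg a : ℝ) }
  | radd r a b, s => { s with rreg := Function.update s.rreg r (s.rreg a + s.rreg b) }
  | rsub r a b, s => { s with rreg := Function.update s.rreg r (s.rreg a - s.rreg b) }
  | rmul r a b, s => { s with rreg := Function.update s.rreg r (s.rreg a * s.rreg b) }
  | rdiv r a b, s => { s with rreg := Function.update s.rreg r (s.rreg a / s.rreg b) }
  | rload r a, s => { s with rreg := Function.update s.rreg r (s.rmem (s.ireg a)) }
  | rstore a b, s => { s with rmem := Function.update s.rmem (s.ireg a) (s.rreg b) }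

/-- Tests: comparisons of two registers. -/
inductive Test : Type
  | ile (a b : ℕ)
  | ilt (a b : ℕ)
  | rle (a b : ℕ)
  | rlt (a b : ℕ)

/-- The test succeeds. -/
def Test.Holds : Test → State → Prop
  | ile a b, s => s.ireg a ≤ s.ireg b
  | ilt a b, s => s.ireg a < s.ireg b
  | rle a b, s => s.rreg a ≤ s.rreg b
  | rlt a b, s => s.rreg a < s.rreg b

/-- Programs. -/
inductive Prog : Type
  | skip
  | instr (i : Instr)
  | seq (P Q : Prog)
  | ite (c : Test) (P Q : Prog)
  | while (c : Test) (P : Prog)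

/-- `Exec P s s' t`: started in `s`, the program `P` halts in `s'` after `t` steps, where every
instruction and every evaluation of a test is one step. -/
inductive Exec : Prog → State → State → ℕ → Prop
  | skip (s : State) : Exec .skip s s 0
  | instr (i : Instr) (s : State) : Exec (.instr i) s (i.run s) 1
  | seq {P Q : Prog} {s₁ s₂ s₃ : State} {t₁ t₂ : ℕ} :
      Exec P s₁ s₂ t₁ → Exec Q s₂ s₃ t₂ → Exec (.seq P Q) s₁ s₃ (t₁ + t₂)
  | iteTrue {c : Test} {P Q : Prog} {s s' : State} {t : ℕ} :
      c.Holds s → Exec P s s' t → Exec (.ite c P Q) s s' (t + 1)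
  | iteFalse {c : Test} {P Q : Prog} {s s' : State} {t : ℕ} :
      ¬ c.Holds s → Exec Q s s' t → Exec (.ite c P Q) s s' (t + 1)
  | whileTrue {c : Test} {P : Prog} {s₁ s₂ s₃ : State} {t₁ t₂ : ℕ} :
      c.Holds s₁ → Exec P s₁ s₂ t₁ → Exec (.while c P) s₂ s₃ t₂ →
      Exec (.while c P) s₁ s₃ (t₁ + t₂ + 1)
  | whileFalse {c : Test} {P : Prog} {s : State} :
      ¬ c.Holds s → Exec (.while c P) s s 1

/-! ### Input and output format -/

/-- The set of variables named by the `d`-tuple with code `e`: the base-`(n+1)` digits of `e`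
in the positions `0, …, d-1` are the entries of the tuple, and the entry `v + 1` names
variable `v`, while the entry `0` names no variable. -/
def tupleSet (n d e : ℕ) : Finset (Fin n) :=
  Finset.univ.filter (fun v => ∃ j : Fin d, e / (n + 1) ^ (j : ℕ) % (n + 1) = (v : ℕ) + 1)

/-- The coefficient table of a degree-`d` polynomial: for each `d`-tuple of (possibly absent)
variables, the coefficient of the product of the variables in it. -/
def table {n : ℕ} (d : ℕ) (p : MPoly n) : List ℝ :=
  (List.range ((n + 1) ^ d)).map (fun e => p (tupleSet n d e))

/-- The coefficient tables of a `k`-tuple of polynomials, one after the other. -/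
def tables {n k : ℕ} (d : ℕ) (p : Fin k → MPoly n) : List ℝ :=
  (List.ofFn (fun i => table d (p i))).flatten

/-- The initial state: `n`, `k`, `d` and `τ`, `ε`, `δ` in registers, the coefficient tables in
the real memory from address `0` on, and `0` everywhere else. -/
noncomputable def inputState {n k : ℕ} (d : ℕ) (p : Fin k → MPoly n) (τ ε δ : ℝ) : State where
  ireg := fun j => if j = 0 then n else if j = 1 then k else if j = 2 then d else 0
  rreg := fun j => if j = 0 then τ else if j = 1 then ε else if j = 2 then δ else 0
  imem := fun _ => 0
  rmem := fun j => (tables d p).getD j 0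

/-- Labels at the leaves. -/
inductive Label : Type
  | const (s : ℤˣ)
  | fail
  | regular

/-- The number that stands for a label. -/
def Label.code : Label → ℕ
  | regular => 0
  | const s => if s = 1 then 1 else 2
  | fail => 3

/-- What a leaf carries: a `k`-tuple of polynomials and a `k`-tuple of labels. -/
structure LeafData (n k : ℕ) where
  poly : Fin k → MPoly n
  label : Fin k → Label

/-- Preorder listing of the tree: `v + 1` for a node that queries `v`; for a leaf `0` and then
its `k` labels. -/
def natCode {n k : ℕ} : DTree n (LeafData n k) → List ℕ
  | .leaf a => 0 :: List.ofFn (fun i => (a.label i).code)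
  | .node v lo hi => ((v : ℕ) + 1) :: (natCode lo ++ natCode hi)

/-- The coefficient tables at the leaves, from left to right. -/
def realCode {n k : ℕ} (d : ℕ) : DTree n (LeafData n k) → List ℝ
  | .leaf a => tables d a.poly
  | .node _ lo hi => realCode d lo ++ realCode d hi

/-- The list `L` is stored in `mem` from address `a` on. -/
def Stores {β : Type} (mem : ℕ → β) (a : ℕ) (L : List β) : Prop :=
  ∀ (j : ℕ) (h : j < L.length), mem (a + j) = L[j]

/-- The tree is written in the memory, at the addresses given by the first two registers. -/
def Outputs {n k : ℕ} (d : ℕ) (s : State) (T : DTree n (LeafData n k)) : Prop :=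
  Stores s.imem (s.ireg 0) (natCode T) ∧ Stores s.rmem (s.ireg 1) (realCode d T)

end PTFReg

namespace PTFReg

variable {n : ℕ}

/-! Skewness implies a nearly constant sign by Bonami's inequality E[p^(2m)] ≤ ((2m-1)^d E[p^2])^m
(`hypercontractive`): a wrong sign forces the centred polynomial to be at least as large as the mean
in absolute value, and Markov's inequality for a moment of order about 2 log(d/ε) makes this
unlikely (`sgn_of_isSkewed`).

The tree comes from a random process that queries greedily. A step (j, b) queries a variable of
influence more than Var/b of the j-th polynomial, if there is one; `Ex` is the expectation over the
process. Total influence drops on average by the influence of the queried variable and is at most d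
Var, so the variance carried by irregular leaves decays geometrically (`Ex_greedy_decay`). The
squared norm E[p^2] is a martingale, and so is E[p^4], which stays below 9^d times the square of the
initial norm. A leaf that is neither regular nor skewed has squared norm at most (b+1) Var, so these
leaves soon carry at most half of the norm; by a second-moment argument the others have probability
at least 1/(4·9^d) (`Ex_greedy`).

For k polynomials, one has to know that a polynomial already treated survives the queries made for
the next ones. A skewed one survives because its distance to its old mean is a martingale
(`Ex_preserve_skew`). A very regular one survives because every single query moves it little: the
fourth moments of the derivatives, summed over the variables, form a supermartingale that dominates
the square of every influence (`Ex_sqNorm_sub_le`, `Ex_preserve_fine`). Parameter b^16 thus degrades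
only to b during b^3 queries, except with probability 1/b. The polynomials are treated one after the
other with parameters B^(16^(k-1)), ..., B^16, B, each phase using the cube of its parameter as
number of steps. One round succeeds with probability at least (8·9^d)^(-k) from whatever tuple it
starts (`Ex_phases`), so independent repetition makes the failure probability at most δ
(`fail_build_sched`, `prob_bound`). With B = (1024 L k d)^(d+1), where L is an integer above 1/τ and
log(1/ε), the number of steps is below the depth bound (`total_le_depthBound`).

For the algorithm, all tests are polynomial inequalities in the coefficients, with integer
parameters found by comparing 1/ε and 1/δ with powers of 2, so that no logarithm is computed. The
program tabulates the schedule and the effect of adding a variable to a monomial, and then writes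
the tree in preorder with an explicit stack (`run_mainLoop`). Its correctness is proved in a small
program logic in which every loop makes at most X iterations, X = (n+1)^d 2^(N+1) for N steps of the
schedule. The bit length of the coefficients plays no role at unit cost. -/

/-! ### Substitution of one variable, moments and Parseval's identity. -/

/-- The polynomial with variable `v` set to `σ`. -/
def fix (v : Fin n) (σ : ℤˣ) (p : MPoly n) : MPoly n := fun U =>
  if v ∈ U then 0 else p U + ((σ : ℤ) : ℝ) * p (insert v U)

/-- The sum of the squared coefficients. -/
def sqNorm (p : MPoly n) : ℝ := ∑ S : Finset (Fin n), p S ^ 2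

/-- The `r`-th moment of `p(x)` for uniform `x`. -/
noncomputable def moment (r : ℕ) (p : MPoly n) : ℝ := (∑ x : Fin n → ℤˣ, eval p x ^ r) / 2 ^ n

theorem sum_split (v : Fin n) (f : Finset (Fin n) → ℝ) :
    ∑ S, f S = ∑ S : Finset (Fin n) with v ∉ S, (f S + f (insert v S)) := by
  rw [← Finset.sum_filter_add_sum_filter_not Finset.univ (fun S => v ∉ S), Finset.sum_add_distrib]
  congr 1
  symm
  refine Finset.sum_bij' (fun S _ => insert v S) (fun S _ => S.erase v) ?_ ?_ ?_ ?_ ?_ <;>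
    simp +contextual

theorem eval_fix (v : Fin n) (σ : ℤˣ) (p : MPoly n) (x : Fin n → ℤˣ) :
    eval (fix v σ p) x = eval p (Function.update x v σ) := by
  unfold eval
  rw [sum_split v, sum_split v]
  refine Finset.sum_congr rfl fun S hS => ?_
  have hv : v ∉ S := by simpa using hS
  have h1 : ∏ i ∈ S, (((Function.update x v σ i : ℤˣ) : ℤ) : ℝ) = ∏ i ∈ S, (((x i : ℤˣ) : ℤ) : ℝ) :=
    Finset.prod_congr rfl fun i hi => by
      rw [Function.update_of_ne (by rintro rfl; exact hv hi)]
  rw [Finset.prod_insert hv, Finset.prod_insert hv, h1]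
  simp [fix, hv]
  ring

/-- Flipping coordinate `v` permutes the cube, and `x` together with its flip are exactly the two
points obtained by setting coordinate `v`. -/
theorem sum_cube_fix (v : Fin n) (g : (Fin n → ℤˣ) → ℝ) :
    ∑ x, g x = (∑ x, g (Function.update x v (-1)) + ∑ x, g (Function.update x v 1)) / 2 := by
  have hfl : ∑ x : Fin n → ℤˣ, g (Function.update x v (-(x v))) = ∑ x, g x := by
    refine Finset.sum_bij' (fun x _ => Function.update x v (-(x v)))
      (fun x _ => Function.update x v (-(x v))) ?_ ?_ ?_ ?_ ?_ <;> simp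
  have h : ∀ x : Fin n → ℤˣ, g (Function.update x v (-1)) + g (Function.update x v 1)
      = g x + g (Function.update x v (-(x v))) := by
    intro x
    rcases Int.units_eq_one_or (x v) with h | h
    · have h1 : Function.update x v 1 = x := by rw [← h]; simp
      rw [h, h1]; ring
    · have h1 : Function.update x v (-1) = x := by rw [← h]; simp
      rw [h, h1]; simp
  rw [← Finset.sum_add_distrib, Finset.sum_congr rfl fun x _ => h x, Finset.sum_add_distrib, hfl]
  ring

/-- The martingale property of moments. It serves twice: for inductions on the number of variables,
and for the random process below. -/
theorem moment_fix (v : Fin n) (r : ℕ) (p : MPoly n) :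
    (moment r (fix v (-1) p) + moment r (fix v 1 p)) / 2 = moment r p := by
  unfold moment
  simp only [eval_fix]
  rw [sum_cube_fix v (fun x => eval p x ^ r)]
  ring

theorem sqNorm_fix (v : Fin n) (p : MPoly n) :
    (sqNorm (fix v (-1) p) + sqNorm (fix v 1 p)) / 2 = sqNorm p := by
  unfold sqNorm
  rw [sum_split v, sum_split v, sum_split v (fun S => p S ^ 2), ← Finset.sum_add_distrib,
    Finset.sum_div]
  refine Finset.sum_congr rfl fun S hS => ?_
  have hv : v ∉ S := by simpa using hS
  simp [fix, hv]
  ring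

/-- All monomials of `p` use only variables of `A`. -/
def SuppOn (A : Finset (Fin n)) (p : MPoly n) : Prop := ∀ S, ¬ S ⊆ A → p S = 0

theorem suppOn_fix {A : Finset (Fin n)} {v : Fin n} {p : MPoly n} (h : SuppOn (insert v A) p)
    (σ : ℤˣ) : SuppOn A (fix v σ p) := by
  intro S hS
  by_cases hv : v ∈ S
  · simp [fix, hv]
  · have h1 : ¬ S ⊆ insert v A := fun h' => hS ((Finset.subset_insert_iff_of_notMem hv).1 h')
    have h2 : ¬ insert v S ⊆ insert v A := fun h' => h1 ((Finset.subset_insert v S).trans h')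
    simp [fix, hv, h S h1, h _ h2]

theorem hasDegree_fix {d : ℕ} {p : MPoly n} (h : HasDegree d p) (v : Fin n) (σ : ℤˣ) :
    HasDegree d (fix v σ p) := by
  intro S hS
  by_cases hv : v ∈ S
  · simp [fix, hv]
  · have h2 : d < (insert v S).card := by rw [Finset.card_insert_of_notMem hv]; omega
    simp [fix, hv, h S hS, h _ h2]

theorem eval_suppOn_empty {p : MPoly n} (h : SuppOn ∅ p) (x : Fin n → ℤˣ) :
    eval p x = p ∅ := by
  unfold eval
  rw [Finset.sum_eq_single ∅]
  · simp
  · intro S _ hS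
    rw [h S (by simpa using hS)]; simp
  · simp

theorem sqNorm_suppOn_empty {p : MPoly n} (h : SuppOn ∅ p) : sqNorm p = p ∅ ^ 2 := by
  unfold sqNorm
  rw [Finset.sum_eq_single ∅]
  · intro S _ hS
    rw [h S (by simpa using hS)]; simp
  · simp

theorem card_cube : (Fintype.card (Fin n → ℤˣ) : ℝ) = 2 ^ n := by
  simp

theorem moment_suppOn_empty {p : MPoly n} (h : SuppOn ∅ p) (r : ℕ) : moment r p = p ∅ ^ r := by
  unfold moment
  simp only [eval_suppOn_empty h]
  rw [Finset.sum_const, nsmul_eq_mul, Finset.card_univ, card_cube]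
  field_simp

/-- Parseval: both sides are averages of their values at the two substitutions, and they agree on
constants. -/
theorem moment_two (p : MPoly n) : moment 2 p = sqNorm p := by
  have key : ∀ (A : Finset (Fin n)) (p : MPoly n), SuppOn A p → moment 2 p = sqNorm p := by
    intro A
    induction A using Finset.induction_on with
    | empty => intro p hp; rw [moment_suppOn_empty hp, sqNorm_suppOn_empty hp]
    | insert v A _ ih =>
      intro p hp
      rw [← moment_fix v, ← sqNorm_fix v, ih _ (suppOn_fix hp _), ih _ (suppOn_fix hp _)]
  exact key Finset.univ p (fun S hS => absurd (Finset.subset_univ S) hS)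

/-! ### Hypercontractivity -/

/-- Induction on `j`. Passing from `j` to `j + 1` multiplies the two binomials by factors with
quotient (2m-2j-1)/(2j+1), which is at most 2m-1. In the proof, `t = m - j - 1` removes the
subtractions. -/
theorem choose_two_mul_le (m j : ℕ) :
    (Nat.choose (2 * m) (2 * j) : ℝ) ≤ (2 * m - 1 : ℝ) ^ j * Nat.choose m j := by
  induction j with
  | zero => simp
  | succ j ih =>
    rcases Nat.lt_or_ge j m with hj | hj
    · have e1 := Nat.choose_succ_right_eq (2 * m) (2 * j)
      have e2 := Nat.choose_succ_right_eq (2 * m) (2 * j + 1)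
      have e3 := Nat.choose_succ_right_eq m j
      obtain ⟨t, rfl⟩ : ∃ t, m = j + 1 + t := ⟨m - (j + 1), by omega⟩
      rw [show 2 * (j + 1 + t) - 2 * j = 2 * t + 2 by omega] at e1
      rw [show 2 * (j + 1 + t) - (2 * j + 1) = 2 * t + 1 by omega] at e2
      rw [show j + 1 + t - j = t + 1 by omega] at e3
      have f1 : (Nat.choose (2 * (j + 1 + t)) (2 * j + 1) : ℝ) * (2 * j + 1)
        = Nat.choose (2 * (j + 1 + t)) (2 * j) * (2 * t + 2) := by exact_mod_cast e1
      have f2 : (Nat.choose (2 * (j + 1 + t)) (2 * (j + 1)) : ℝ) * (2 * j + 2)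
        = Nat.choose (2 * (j + 1 + t)) (2 * j + 1) * (2 * t + 1) := by exact_mod_cast e2
      have f3 : (Nat.choose (j + 1 + t) (j + 1) : ℝ) * (j + 1)
        = Nat.choose (j + 1 + t) j * (t + 1) := by exact_mod_cast e3
      set a := (Nat.choose (2 * (j + 1 + t)) (2 * (j + 1)) : ℝ)
      set b := (Nat.choose (2 * (j + 1 + t)) (2 * j + 1) : ℝ)
      set c := (Nat.choose (2 * (j + 1 + t)) (2 * j) : ℝ)
      set u := (Nat.choose (j + 1 + t) (j + 1) : ℝ)
      set w := (Nat.choose (j + 1 + t) j : ℝ)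
      push_cast at ih ⊢
      set X := (2 * ((j : ℝ) + 1 + t) - 1) with hX
      have hX0 : 0 ≤ X := by rw [hX]; linarith [(Nat.cast_nonneg j : (0:ℝ) ≤ j), (Nat.cast_nonneg t : (0:ℝ) ≤ t)]
      have hXt : 2 * (t : ℝ) + 1 ≤ X := by rw [hX]; linarith [(Nat.cast_nonneg j : (0:ℝ) ≤ j)]
      have hu0 : 0 ≤ u := Nat.cast_nonneg _
      have hw0 : 0 ≤ w := Nat.cast_nonneg _
      have hj0 : (0:ℝ) ≤ j := Nat.cast_nonneg _
      have ht0 : (0:ℝ) ≤ t := Nat.cast_nonneg _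
      have g1 : a * ((2 * j + 2) * (2 * j + 1)) = c * (2 * t + 2) * (2 * t + 1) := by
        linear_combination (2 * (j:ℝ) + 1) * f2 + (2 * (t:ℝ) + 1) * f1
      have g2 : c * (2 * t + 2) * (2 * t + 1) ≤ X ^ j * w * (2 * t + 2) * X := by
        have : c * (2 * t + 2) ≤ X ^ j * w * (2 * t + 2) := by gcongr
        have h0 : 0 ≤ X ^ j * w * (2 * t + 2) := by positivity
        calc _ ≤ X ^ j * w * (2 * t + 2) * (2 * t + 1) := by gcongr
          _ ≤ _ := by gcongr
      have g3 : X ^ j * w * (2 * t + 2) * X = X ^ (j + 1) * u * (2 * j + 2) := by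
        rw [pow_succ]; linear_combination (-2 * X ^ j * X) * f3
      have h0 : 0 ≤ X ^ (j + 1) * u := by positivity
      have g4 : a * ((2 * j + 2) * (2 * j + 1)) ≤ X ^ (j + 1) * u * ((2 * j + 2) * (2 * j + 1)) := by
        rw [g1]
        refine g2.trans ?_
        rw [g3, ← mul_assoc]
        refine le_mul_of_one_le_right (by positivity) (by linarith)
      exact le_of_mul_le_mul_right g4 (by positivity)
    · rw [Nat.choose_eq_zero_of_lt (by omega), Nat.choose_eq_zero_of_lt (show m < j + 1 by omega)]
      simp

theorem sum_range_odd_zero (t : ℕ → ℝ) (h : ∀ j, t (2 * j + 1) = 0) (m : ℕ) :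
    ∑ i ∈ Finset.range (2 * m + 1), t i = ∑ j ∈ Finset.range (m + 1), t (2 * j) := by
  induction m with
  | zero => simp
  | succ m ih =>
    rw [show 2 * (m + 1) + 1 = 2 * m + 1 + 1 + 1 by ring, Finset.sum_range_succ,
      Finset.sum_range_succ, ih, h, Finset.sum_range_succ _ (m + 1)]
    simp [mul_add]

/-- The odd powers of `b` cancel, and the even ones are compared term by term by
`choose_two_mul_le`. -/
theorem two_point (m : ℕ) (hm : 1 ≤ m) (a b : ℝ) :
    ((a - b) ^ (2 * m) + (a + b) ^ (2 * m)) / 2 ≤ (a ^ 2 + (2 * m - 1) * b ^ 2) ^ m := by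
  have hm' : (1:ℝ) ≤ m := by exact_mod_cast hm
  have e : ((a - b) ^ (2 * m) + (a + b) ^ (2 * m)) / 2
      = ∑ j ∈ Finset.range (m + 1), b ^ (2 * j) * a ^ (2 * m - 2 * j) * (2 * m).choose (2 * j) := by
    rw [show a - b = -b + a by ring, show a + b = b + a by ring, add_pow, add_pow,
      ← Finset.sum_add_distrib, Finset.sum_div, sum_range_odd_zero]
    · refine Finset.sum_congr rfl fun j _ => ?_
      rw [(even_two_mul j).neg_pow]; ring
    · intro j
      rw [Odd.neg_pow ⟨j, rfl⟩]; ring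
  rw [e, show a ^ 2 + (2 * m - 1) * b ^ 2 = (2 * m - 1) * b ^ 2 + a ^ 2 by ring, add_pow]
  refine Finset.sum_le_sum fun j hj => ?_
  have h := choose_two_mul_le m j
  have h0 : 0 ≤ b ^ (2 * j) * a ^ (2 * m - 2 * j) := by
    rw [← Nat.mul_sub, pow_mul, pow_mul]; positivity
  calc _ ≤ b ^ (2 * j) * a ^ (2 * m - 2 * j) * ((2 * m - 1 : ℝ) ^ j * Nat.choose m j) := by gcongr
    _ = _ := by rw [← Nat.mul_sub, mul_pow, pow_mul, pow_mul]; ring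

/-- Jensen's inequality for the power `m` with weights proportional to `F` and `G`. With `F`, `G`
proportional to the bounds for the norms of the two summands, it replaces the triangle inequality in
L^m. -/
theorem pow_add_le_weighted (m : ℕ) {F G u w : ℝ} (hF : 0 < F) (hG : 0 < G) (hu : 0 ≤ u)
    (hw : 0 ≤ w) :
    (u + w) ^ m ≤ (F + G) ^ m * (F / (F + G) * (u / F) ^ m + G / (F + G) * (w / G) ^ m) := by
  have h := (convexOn_pow (𝕜 := ℝ) m).2
    (show u / F ∈ Set.Ici 0 from Set.mem_Ici.2 (by positivity))
    (show w / G ∈ Set.Ici 0 from Set.mem_Ici.2 (by positivity))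
    (show 0 ≤ F / (F + G) by positivity) (show 0 ≤ G / (F + G) by positivity) (by field_simp)
  simp only [smul_eq_mul] at h
  have e : F / (F + G) * (u / F) + G / (F + G) * (w / G) = (u + w) / (F + G) := by field_simp
  rw [e, div_pow] at h
  rwa [div_le_iff₀' (by positivity)] at h

theorem sqNorm_nonneg (p : MPoly n) : 0 ≤ sqNorm p := Finset.sum_nonneg fun _ _ => sq_nonneg _

theorem eq_zero_of_sqNorm {p : MPoly n} (h : sqNorm p = 0) : p = 0 := by
  funext S
  have := (Finset.sum_eq_zero_iff_of_nonneg (fun S _ => sq_nonneg (p S))).1 h S (Finset.mem_univ S)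
  simpa using this

@[simp] theorem eval_zero (x : Fin n → ℤˣ) : eval (0 : MPoly n) x = 0 := by simp [eval]

/-- Bonami's lemma for even moments. -/
theorem hypercontractive (m : ℕ) (hm : 1 ≤ m) (d : ℕ) (p : MPoly n) (hd : HasDegree d p) :
    moment (2 * m) p ≤ ((2 * m - 1 : ℝ) ^ d * sqNorm p) ^ m := by
  have hm' : (1:ℝ) ≤ m := by exact_mod_cast hm
  have key : ∀ (A : Finset (Fin n)) (d : ℕ) (p : MPoly n), SuppOn A p → HasDegree d p →
      moment (2 * m) p ≤ ((2 * m - 1 : ℝ) ^ d * sqNorm p) ^ m := by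
    intro A
    induction A using Finset.induction_on with
    | empty =>
      intro d p hp _
      rw [moment_suppOn_empty hp, sqNorm_suppOn_empty hp, pow_mul]
      gcongr
      refine le_mul_of_one_le_left (sq_nonneg _) (one_le_pow₀ (by linarith))
    | insert v A hvA ih =>
      intro d p hp hd
      -- The decomposition p = f + x_v g, with `f` and `g` free of `v`; `g` has degree at most d -
      -- 1.
      set f : MPoly n := fun U => if v ∈ U then 0 else p U with hf
      set g : MPoly n := fun U => if v ∈ U then 0 else p (insert v U) with hg
      have hfA : SuppOn A f := by
        intro S hS
        by_cases hv : v ∈ S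
        · simp [hf, hv]
        · simp only [hf, hv, if_false]
          exact hp S fun h' => hS ((Finset.subset_insert_iff_of_notMem hv).1 h')
      have hgA : SuppOn A g := by
        intro S hS
        by_cases hv : v ∈ S
        · simp [hg, hv]
        · simp only [hg, hv, if_false]
          exact hp _ fun h' => hS ((Finset.subset_insert_iff_of_notMem hv).1
            ((Finset.subset_insert v S).trans h'))
      have hfd : HasDegree d f := by
        intro S hS
        simp [hf, hd S hS]
      have hnorm : sqNorm p = sqNorm f + sqNorm g := by
        unfold sqNorm
        rw [sum_split v, sum_split v (fun S => f S ^ 2), sum_split v (fun S => g S ^ 2),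
          ← Finset.sum_add_distrib]
        refine Finset.sum_congr rfl fun S hS => ?_
        have hv : v ∉ S := by simpa using hS
        simp [hf, hg, hv]
      have hev : ∀ (σ : ℤˣ) x, eval (fix v σ p) x = eval f x + ((σ : ℤ) : ℝ) * eval g x := by
        intro σ x
        unfold eval
        rw [Finset.mul_sum, ← Finset.sum_add_distrib]
        refine Finset.sum_congr rfl fun S _ => ?_
        by_cases hv : v ∈ S
        · simp [fix, hf, hg, hv]
        · simp [fix, hf, hg, hv]
          ring
      set c : ℝ := 2 * m - 1 with hc
      have hc1 : 1 ≤ c := by rw [hc]; linarith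
      have hmom : moment (2 * m) p
          ≤ (∑ x, (eval f x ^ 2 + c * eval g x ^ 2) ^ m) / 2 ^ n := by
        rw [← moment_fix v]
        unfold moment
        rw [← add_div, ← Finset.sum_add_distrib, div_right_comm, Finset.sum_div]
        gcongr with x
        rw [hev, hev]
        have := two_point m hm (eval f x) (eval g x)
        rw [← hc] at this
        simpa [← sub_eq_add_neg] using this
      have hF := ih d f hfA hfd
      -- The two-point inequality multiplies the square of `g` by `c`; the degree of `g`, smaller by
      -- one, pays for this factor. For `d = 0` there is nothing to pay, as `g = 0`.
      have hG : c ^ m * moment (2 * m) g ≤ (c ^ d * sqNorm g) ^ m := by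
        rcases Nat.eq_zero_or_pos d with h0 | h0
        · have hg0 : g = 0 := by
            funext S
            by_cases hv : v ∈ S
            · simp [hg, hv]
            · simp only [hg, hv, if_false]
              exact hd _ (by rw [h0, Finset.card_insert_of_notMem hv]; omega)
          have : moment (2 * m) g = 0 := by
            rw [hg0]; unfold moment; simp; omega
          rw [this, mul_zero]
          have := sqNorm_nonneg g
          positivity
        · obtain ⟨e, rfl⟩ : ∃ e, d = e + 1 := ⟨d - 1, by omega⟩
          have hgd : HasDegree e g := by
            intro S hS
            by_cases hv : v ∈ S
            · simp [hg, hv]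
            · simp only [hg, hv, if_false]
              exact hd _ (by rw [Finset.card_insert_of_notMem hv]; omega)
          have := ih e g hgA hgd
          calc c ^ m * moment (2 * m) g ≤ c ^ m * (c ^ e * sqNorm g) ^ m := by gcongr
            _ = _ := by rw [← mul_pow]; ring
      refine hmom.trans ?_
      -- The weighted inequality divides by both norms, so the cases f = 0 and g = 0 are separate.
      rcases (sqNorm_nonneg f).eq_or_lt with hf0 | hf0
      · have : f = 0 := eq_zero_of_sqNorm hf0.symm
        have e : (∑ x, (eval f x ^ 2 + c * eval g x ^ 2) ^ m) / 2 ^ n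
            = c ^ m * moment (2 * m) g := by
          rw [this]; unfold moment
          simp [mul_pow, ← Finset.mul_sum, mul_div_assoc, ← pow_mul]
        rw [e, hnorm, ← hf0, zero_add]
        exact hG
      rcases (sqNorm_nonneg g).eq_or_lt with hg0 | hg0
      · have : g = 0 := eq_zero_of_sqNorm hg0.symm
        have e : (∑ x, (eval f x ^ 2 + c * eval g x ^ 2) ^ m) / 2 ^ n = moment (2 * m) f := by
          rw [this]; unfold moment
          simp [pow_mul]
        rw [e, hnorm, ← hg0, add_zero]
        exact hF
      set F := sqNorm f
      set G := sqNorm g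
      calc (∑ x, (eval f x ^ 2 + c * eval g x ^ 2) ^ m) / 2 ^ n
          ≤ (∑ x, (F + G) ^ m * (F / (F + G) * (eval f x ^ 2 / F) ^ m
              + G / (F + G) * (c * eval g x ^ 2 / G) ^ m)) / 2 ^ n := by
            gcongr with x
            exact pow_add_le_weighted m hf0 hg0 (sq_nonneg _) (by positivity)
        _ = (F + G) ^ m * (F / (F + G) * (moment (2 * m) f / F ^ m)
              + G / (F + G) * (c ^ m * moment (2 * m) g / G ^ m)) := by
            unfold moment
            rw [← Finset.mul_sum, Finset.sum_add_distrib, ← Finset.mul_sum, ← Finset.mul_sum]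
            simp only [div_pow, mul_pow, ← pow_mul]
            rw [← Finset.sum_div, ← Finset.sum_div, ← Finset.mul_sum]
            ring
        _ ≤ (F + G) ^ m * (F / (F + G) * ((c ^ d * F) ^ m / F ^ m)
              + G / (F + G) * ((c ^ d * G) ^ m / G ^ m)) := by gcongr
        _ = (c ^ d * (F + G)) ^ m := by
            simp only [mul_pow]
            field_simp
        _ = _ := by rw [hnorm]
  exact key Finset.univ d p (fun S hS => absurd (Finset.subset_univ S) hS) hd

/-! ### Skewed polynomials -/

/-- `p` without its constant term. -/
def center (p : MPoly n) : MPoly n := fun S => if S = ∅ then 0 else p S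

theorem sqNorm_center (p : MPoly n) : sqNorm (center p) = variance p := by
  unfold sqNorm variance center
  rw [Finset.sum_filter]
  refine Finset.sum_congr rfl fun S _ => ?_
  by_cases h : S = ∅ <;> simp [h]

theorem eval_center (p : MPoly n) (x : Fin n → ℤˣ) : eval (center p) x = eval p x - p ∅ := by
  have h : ∀ q : MPoly n, eval q x
      = q ∅ + ∑ S : Finset (Fin n) with S ≠ ∅, q S * ∏ i ∈ S, (((x i : ℤˣ) : ℤ) : ℝ) := by
    intro q
    unfold eval
    rw [← Finset.sum_filter_add_sum_filter_not Finset.univ (fun S => S = ∅),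
      Finset.filter_eq' Finset.univ ∅]
    simp
  rw [h, h p]
  have : ∑ S : Finset (Fin n) with S ≠ ∅, center p S * ∏ i ∈ S, (((x i : ℤˣ) : ℤ) : ℝ)
      = ∑ S : Finset (Fin n) with S ≠ ∅, p S * ∏ i ∈ S, (((x i : ℤˣ) : ℤ) : ℝ) := by
    refine Finset.sum_congr rfl fun S hS => ?_
    have : S ≠ ∅ := by simpa using hS
    simp [center, this]
  rw [this]
  simp [center]

theorem variance_nonneg (p : MPoly n) : 0 ≤ variance p := by
  rw [← sqNorm_center]; exact sqNorm_nonneg _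

theorem hasDegree_center {d : ℕ} {p : MPoly n} (h : HasDegree d p) : HasDegree d (center p) := by
  intro S hS
  unfold center
  split_ifs
  · rfl
  · exact h S hS

open Classical in
theorem cubeProb_mono {E F : (Fin n → ℤˣ) → Prop} (h : ∀ x, E x → F x) :
    cubeProb E ≤ cubeProb F := by
  unfold cubeProb
  gcongr with x
  exact h x

open Classical in
theorem markov_moment (m : ℕ) (p : MPoly n) {t : ℝ} (ht : 0 ≤ t) :
    cubeProb (fun x => t ≤ |eval p x|) * t ^ (2 * m) ≤ moment (2 * m) p := by
  unfold cubeProb moment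
  rw [div_mul_eq_mul_div]
  gcongr
  rw [← nsmul_eq_mul, ← Finset.sum_const]
  refine (Finset.sum_le_sum (g := fun x => eval p x ^ (2 * m)) fun x hx => ?_).trans
    (Finset.sum_le_sum_of_subset_of_nonneg (Finset.filter_subset _ _) fun x _ _ => ?_)
  · have hx' : t ≤ |eval p x| := by simpa using hx
    show t ^ (2 * m) ≤ eval p x ^ (2 * m)
    rw [← (even_two_mul m).pow_abs (eval p x)]
    gcongr
  · rw [pow_mul]; positivity

theorem log_ratio {d : ℕ} {ε : ℝ} (hd : 1 ≤ d) (h0 : 0 < ε) (h1 : ε < 1 / 4) :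
    1 ≤ Real.log (d / ε) := by
  have hd' : (1:ℝ) ≤ d := by exact_mod_cast hd
  rw [Real.le_log_iff_exp_le (by positivity)]
  have h3 : (4:ℝ) ≤ d / ε := by
    rw [le_div_iff₀ h0]; nlinarith
  have := Real.exp_one_lt_d9
  linarith

/-- Squaring removes the square root and turns the exponent d/2 into the natural number `d`. -/
theorem isSkewed_iff {C : ℝ} {d : ℕ} {ε : ℝ} {p : MPoly n}
    (h : 0 ≤ C * Real.log ((d : ℝ) / ε)) :
    IsSkewed C d ε p ↔ (C * Real.log ((d : ℝ) / ε)) ^ d * variance p ≤ p ∅ ^ 2 := by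
  unfold IsSkewed
  have e : (C * Real.log ((d : ℝ) / ε)) ^ ((d : ℝ) / 2) * Real.sqrt (variance p)
      = Real.sqrt ((C * Real.log ((d : ℝ) / ε)) ^ d * variance p) := by
    rw [Real.sqrt_mul (by positivity), ← Real.rpow_natCast, Real.sqrt_eq_rpow ((_ : ℝ) ^ (d : ℝ)),
      ← Real.rpow_mul h]
    congr 2
    ring
  rw [e, ← Real.sqrt_sq_eq_abs, Real.sqrt_le_sqrt_iff (sq_nonneg _)]

/-- The sign of a skewed polynomial is close to a constant. -/
theorem sgn_of_isSkewed {d : ℕ} {ε : ℝ} {p : MPoly n} (hd : 1 ≤ d) (h0 : 0 < ε) (h1 : ε < 1 / 4)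
    (hp : HasDegree d p) (hs : IsSkewed 12 d ε p) :
    cubeProb (fun x => sgn (eval p x) ≠ sgn (p ∅)) ≤ ε := by
  have hl := log_ratio hd h0 h1
  set l := Real.log (d / ε) with hldef
  rw [isSkewed_iff (by rw [← hldef]; linarith), ← hldef] at hs
  have hd' : (1:ℝ) ≤ d := by exact_mod_cast hd
  -- A value whose sign differs from that of the mean is at distance at least `|p ∅|` from it. The
  -- sign condition is kept for the case of variance zero, where the second condition alone could
  -- hold everywhere.
  have hmono : cubeProb (fun x => sgn (eval p x) ≠ sgn (p ∅))
      ≤ cubeProb (fun x => sgn (eval p x) ≠ sgn (p ∅) ∧ |p ∅| ≤ |eval (center p) x|) := by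
    refine cubeProb_mono fun x hx => ⟨hx, ?_⟩
    rw [eval_center]
    unfold sgn at hx
    by_cases a : 0 ≤ eval p x <;> by_cases b : 0 ≤ p ∅ <;> simp [a, b] at hx
    · push Not at b
      rw [abs_of_neg b, abs_of_nonneg (by linarith)]; linarith
    · push Not at a
      rw [abs_of_nonneg b, abs_of_neg (by linarith)]; linarith
  refine hmono.trans ?_
  rcases (variance_nonneg p).eq_or_lt with hv | hv
  · have hc : center p = 0 := eq_zero_of_sqNorm (by rw [sqNorm_center, hv])
    have : cubeProb (fun x => sgn (eval p x) ≠ sgn (p ∅) ∧ |p ∅| ≤ |eval (center p) x|) = 0 := by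
      have hE : (fun x => sgn (eval p x) ≠ sgn (p ∅) ∧ |p ∅| ≤ |eval (center p) x|)
          = fun _ => False := by
        funext x
        have := eval_center p x
        rw [hc, eval_zero] at this
        simp [show eval p x = p ∅ by linarith]
      rw [hE]
      simp [cubeProb]
    rw [this]; exact h0.le
  have hmono2 : cubeProb (fun x => sgn (eval p x) ≠ sgn (p ∅) ∧ |p ∅| ≤ |eval (center p) x|)
      ≤ cubeProb (fun x => |p ∅| ≤ |eval (center p) x|) := cubeProb_mono fun x hx => hx.2
  refine hmono2.trans ?_
  -- The order of the moment is 2m with m about log(d/ε); then 2m - 1 ≤ 4l, because l ≥ 1.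
  set m := ⌈l⌉₊ with hm
  have hml : l ≤ m := Nat.le_ceil _
  have hmu : (m : ℝ) < l + 1 := Nat.ceil_lt_add_one (by linarith)
  have hm1 : 1 ≤ m := by
    have : (1:ℝ) ≤ m := by linarith
    exact_mod_cast this
  have a1 := markov_moment m (center p) (abs_nonneg (p ∅))
  have a2 := hypercontractive m hm1 d (center p) (hasDegree_center hp)
  rw [sqNorm_center] at a2
  set V := variance p
  have hP : 0 < p ∅ ^ 2 := lt_of_lt_of_le (by positivity) hs
  set Pr := cubeProb (fun x => |p ∅| ≤ |eval (center p) x|)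
  have hPr0 : 0 ≤ Pr := by unfold Pr cubeProb; positivity
  rw [pow_mul, sq_abs] at a1
  have a3 : Pr * ((12 * l) ^ d * V) ^ m ≤ ((4 * l) ^ d * V) ^ m := by
    calc Pr * ((12 * l) ^ d * V) ^ m ≤ Pr * (p ∅ ^ 2) ^ m := by gcongr
      _ ≤ _ := a1
      _ ≤ _ := a2
      _ ≤ _ := by
        have h1m : (0:ℝ) ≤ 2 * m - 1 := by linarith
        have h2m : 2 * (m:ℝ) - 1 ≤ 4 * l := by linarith
        have h3m := pow_le_pow_left₀ h1m h2m d
        have h4m := pow_nonneg h1m d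
        exact pow_le_pow_left₀ (by positivity) (by gcongr) m
  -- The constant 12 is 3 · 4: the 4 absorbs 2m - 1, and the 3 > e leaves the factor 3^(dm) ≥ e^l =
  -- d/ε.
  have a4 : ((12 * l) ^ d * V) ^ m = ((4 * l) ^ d * V) ^ m * 3 ^ (d * m) := by
    have e : (12 * l) ^ d * V = 3 ^ d * ((4 * l) ^ d * V) := by
      rw [show 12 * l = 3 * (4 * l) by ring, mul_pow 3]; ring
    rw [e, mul_pow, ← pow_mul, mul_comm]
  have hpos : 0 < ((4 * l) ^ d * V) ^ m := by
    have : 0 < l := by linarith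
    positivity
  have a5 : Pr * 3 ^ (d * m) ≤ 1 := by
    rw [a4] at a3
    have : (Pr * 3 ^ (d * m)) * ((4 * l) ^ d * V) ^ m ≤ 1 * ((4 * l) ^ d * V) ^ m := by
      linarith
    exact le_of_mul_le_mul_right this hpos
  have a6 : (d:ℝ) / ε ≤ 3 ^ (d * m) := by
    calc (d:ℝ) / ε = Real.exp l := (Real.exp_log (by positivity)).symm
      _ ≤ Real.exp m := Real.exp_le_exp.2 hml
      _ = Real.exp 1 ^ m := by rw [← Real.exp_nat_mul]; simp
      _ ≤ 3 ^ m := by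
        have := Real.exp_one_lt_d9
        gcongr; linarith
      _ ≤ 3 ^ (d * m) := pow_le_pow_right₀ (by norm_num) (Nat.le_mul_of_pos_left _ hd)
  have a7 : Pr * (d / ε) ≤ 1 := le_trans (by gcongr) a5
  rw [mul_div_assoc', div_le_iff₀ h0, one_mul] at a7
  nlinarith

end PTFReg

namespace PTFReg

variable {n k : ℕ}

/-! ### Influences and variance under restriction of one variable -/

/-- The monomials of `p` that contain `v`. -/
def part (v : Fin n) (p : MPoly n) : MPoly n := fun S => if v ∈ S then p S else 0

theorem sqNorm_part (v : Fin n) (p : MPoly n) : sqNorm (part v p) = influence p v := by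
  unfold sqNorm influence part
  rw [Finset.sum_filter]
  exact Finset.sum_congr rfl fun S _ => by by_cases h : v ∈ S <;> simp [h]

theorem influence_nonneg (p : MPoly n) (v : Fin n) : 0 ≤ influence p v :=
  Finset.sum_nonneg fun _ _ => sq_nonneg _

theorem influence_split (v : Fin n) (p : MPoly n) :
    influence p v = ∑ S : Finset (Fin n) with v ∉ S, p (insert v S) ^ 2 := by
  rw [← sqNorm_part]
  unfold sqNorm
  rw [sum_split v]
  refine Finset.sum_congr rfl fun S hS => ?_
  have hv : v ∉ S := by simpa using hS
  simp [part, hv]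

theorem part_fix_of_ne {u v : Fin n} (h : u ≠ v) (σ : ℤˣ) (p : MPoly n) :
    part u (fix v σ p) = fix v σ (part u p) := by
  funext S
  unfold part fix
  by_cases hu : u ∈ S <;> by_cases hv : v ∈ S <;> simp [hu, hv, h]

theorem part_fix_self (v : Fin n) (σ : ℤˣ) (p : MPoly n) : part v (fix v σ p) = 0 := by
  funext S
  unfold part fix
  by_cases hv : v ∈ S <;> simp [hv]

theorem influence_fix_of_ne {u v : Fin n} (h : u ≠ v) (p : MPoly n) :
    (influence (fix v (-1) p) u + influence (fix v 1 p) u) / 2 = influence p u := by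
  simp only [← sqNorm_part]
  rw [part_fix_of_ne h, part_fix_of_ne h, sqNorm_fix]

theorem influence_fix_self (v : Fin n) (σ : ℤˣ) (p : MPoly n) :
    influence (fix v σ p) v = 0 := by
  rw [← sqNorm_part, part_fix_self]; simp [sqNorm]

/-- The total influence. -/
def totalInf (p : MPoly n) : ℝ := ∑ v, influence p v

theorem totalInf_eq (p : MPoly n) : totalInf p = ∑ S : Finset (Fin n), (S.card : ℝ) * p S ^ 2 := by
  unfold totalInf influence
  simp only [Finset.sum_filter]
  rw [Finset.sum_comm]
  refine Finset.sum_congr rfl fun S _ => ?_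
  rw [← Finset.sum_filter]
  simp

theorem variance_le_totalInf (p : MPoly n) : variance p ≤ totalInf p := by
  rw [totalInf_eq]
  unfold variance
  rw [Finset.sum_filter]
  refine Finset.sum_le_sum fun S _ => ?_
  split_ifs with h
  · have : (1:ℝ) ≤ S.card := by
      exact_mod_cast Finset.card_pos.2 (Finset.nonempty_iff_ne_empty.2 h)
    nlinarith [sq_nonneg (p S)]
  · positivity

theorem totalInf_le {d : ℕ} {p : MPoly n} (hd : HasDegree d p) :
    totalInf p ≤ d * variance p := by
  rw [totalInf_eq]
  unfold variance
  rw [Finset.sum_filter, Finset.mul_sum]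
  refine Finset.sum_le_sum fun S _ => ?_
  split_ifs with h
  · rcases Nat.lt_or_ge d S.card with h' | h'
    · simp [hd S h']
    · gcongr
  · have : S = ∅ := by simpa using h
    simp [this]

/-- The influence of `v` disappears, and every other influence is preserved on average. This is the
potential that greedy queries consume. -/
theorem totalInf_fix (v : Fin n) (p : MPoly n) :
    (totalInf (fix v (-1) p) + totalInf (fix v 1 p)) / 2 = totalInf p - influence p v := by
  unfold totalInf
  rw [← Finset.sum_add_distrib, Finset.sum_div,
    ← Finset.add_sum_erase Finset.univ (fun u => influence p u) (Finset.mem_univ v),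
    ← Finset.add_sum_erase Finset.univ _ (Finset.mem_univ v),
    influence_fix_self, influence_fix_self]
  rw [Finset.sum_congr rfl fun u hu => influence_fix_of_ne (Finset.ne_of_mem_erase hu) p]
  ring

theorem sqNorm_eq (p : MPoly n) : sqNorm p = p ∅ ^ 2 + variance p := by
  unfold sqNorm variance
  rw [← Finset.sum_filter_add_sum_filter_not Finset.univ (fun S => S = ∅),
    Finset.filter_eq' Finset.univ ∅]
  simp

theorem variance_le_sqNorm (p : MPoly n) : variance p ≤ sqNorm p := by
  rw [sqNorm_eq]; linarith [sq_nonneg (p ∅)]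

/-- The constant polynomial. -/
def const (c : ℝ) : MPoly n := fun S => if S = ∅ then c else 0

theorem fix_sub_const (v : Fin n) (σ : ℤˣ) (p : MPoly n) (c : ℝ) :
    fix v σ (p - const c) = fix v σ p - const c := by
  funext S
  by_cases hv : v ∈ S
  · have : S ≠ ∅ := by rintro rfl; simp at hv
    simp [fix, hv, const, this]
  · simp [fix, hv, const]; ring

theorem sqNorm_sub_const (p : MPoly n) (c : ℝ) :
    sqNorm (p - const c) = (p ∅ - c) ^ 2 + variance p := by
  have h0 : (p - const c : MPoly n) ∅ = p ∅ - c := by simp [const]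
  have h1 : variance (p - const c) = variance p := by
    unfold variance
    refine Finset.sum_congr rfl fun S hS => ?_
    have : S ≠ ∅ := (Finset.mem_filter.1 hS).2
    simp [const, this]
  rw [sqNorm_eq, h0, h1]

/-- Drift of the distance to a fixed `q` under one query. For each `S` without `v`, the slack is the
square of the difference of the coefficients of `p` and `q` at `insert v S`. -/
theorem sqNorm_fix_sub (v : Fin n) (p q : MPoly n) :
    (sqNorm (fix v (-1) p - q) + sqNorm (fix v 1 p - q)) / 2
      ≤ sqNorm (p - q) + influence p v + influence q v := by
  unfold sqNorm
  rw [sum_split v, sum_split v, sum_split v (fun S => (p - q) S ^ 2), influence_split,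
    influence_split, ← Finset.sum_add_distrib, ← Finset.sum_add_distrib, ← Finset.sum_add_distrib,
    Finset.sum_div]
  refine Finset.sum_le_sum fun S hS => ?_
  have hv : v ∉ S := by simpa using hS
  simp [fix, hv]
  nlinarith [sq_nonneg (p (insert v S) - q (insert v S))]

theorem sqNorm_sq_le (p : MPoly n) : sqNorm p ^ 2 ≤ moment 4 p := by
  rw [← moment_two]
  unfold moment
  rw [div_pow, div_le_div_iff₀ (by positivity) (by positivity)]
  have h := sq_sum_le_card_mul_sum_sq (s := Finset.univ) (f := fun x : Fin n → ℤˣ => eval p x ^ 2)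
  rw [Finset.card_univ, card_cube] at h
  simp only [← pow_mul] at h ⊢
  norm_num at h ⊢
  calc _ ≤ 2 ^ n * (∑ x, eval p x ^ 4) * 2 ^ n := by gcongr
    _ = _ := by rw [pow_mul]; ring

theorem moment_four_le {d : ℕ} {p : MPoly n} (hd : HasDegree d p) :
    moment 4 p ≤ 9 ^ d * sqNorm p ^ 2 := by
  have h := hypercontractive 2 (by norm_num) d p hd
  norm_num at h
  rw [mul_pow, ← pow_mul, mul_comm d 2, pow_mul] at h
  norm_num at h
  exact h

theorem moment_four_nonneg (p : MPoly n) : 0 ≤ moment 4 p :=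
  le_trans (sq_nonneg _) (sqNorm_sq_le p)

/-- The sum over the variables of the fourth moments of the derivatives. -/
noncomputable def kurt (p : MPoly n) : ℝ := ∑ v, moment 4 (part v p)

/-- Fourth moments of derivatives are martingales, except that the one in direction `v` drops to
zero. The maximal influence has no such property, and `kurt` replaces it as a quantity that controls
all influences along a random path. -/
theorem kurt_fix (v : Fin n) (p : MPoly n) :
    (kurt (fix v (-1) p) + kurt (fix v 1 p)) / 2 ≤ kurt p := by
  unfold kurt
  rw [← Finset.sum_add_distrib, Finset.sum_div]
  refine Finset.sum_le_sum fun u _ => ?_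
  by_cases h : u = v
  · subst h
    rw [part_fix_self, part_fix_self]
    have : moment 4 (0 : MPoly n) = 0 := by simp [moment]
    rw [this]
    simpa using moment_four_nonneg _
  · rw [part_fix_of_ne h, part_fix_of_ne h, moment_fix]

theorem influence_sq_le_kurt (p : MPoly n) (v : Fin n) : influence p v ^ 2 ≤ kurt p := by
  rw [← sqNorm_part]
  exact (sqNorm_sq_le _).trans (Finset.single_le_sum (f := fun v => moment 4 (part v p))
    (fun u _ => moment_four_nonneg _) (Finset.mem_univ v))

/-- By hypercontractivity each derivative has fourth moment at most 9^d times its squared influence;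
one factor is bounded by the maximum `t * variance p`, and the other sums to the total influence. -/
theorem kurt_le {d : ℕ} {p : MPoly n} (hd : HasDegree d p) {t : ℝ}
    (ht : ∀ v, influence p v ≤ t * variance p) :
    kurt p ≤ 9 ^ d * (t * d * variance p ^ 2) := by
  have h1 : kurt p ≤ ∑ v, 9 ^ d * (t * variance p * influence p v) := by
    refine Finset.sum_le_sum fun v _ => ?_
    have hpd : HasDegree d (part v p) := by
      intro S hS; unfold part; split_ifs
      · exact hd S hS
      · rfl
    refine (moment_four_le hpd).trans ?_
    rw [sqNorm_part, sq]
    have := influence_nonneg p v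
    have := ht v
    gcongr
  refine h1.trans ?_
  rw [← Finset.mul_sum, ← Finset.mul_sum]
  have h2 := totalInf_le hd
  unfold totalInf at h2
  have hv := variance_nonneg p
  by_cases h0 : 0 ≤ t * variance p
  · have : t * variance p * ∑ v, influence p v ≤ t * variance p * (d * variance p) := by gcongr
    have h9 : (0:ℝ) < 9 ^ d := by positivity
    nlinarith
  -- A negative bound on influences is possible only if there are no variables.
  · have hz : ∀ v, False := fun v => h0 ((influence_nonneg p v).trans (ht v))
    have hn : n = 0 := by
      by_contra hne
      exact hz ⟨0, Nat.pos_of_ne_zero hne⟩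
    subst hn
    have : variance p = 0 := by
      unfold variance
      refine Finset.sum_eq_zero fun S hS => ?_
      have : S ≠ ∅ := (Finset.mem_filter.1 hS).2
      exact absurd (Finset.eq_empty_of_isEmpty S) this
    simp [this]

/-! ### The greedy choice of a variable -/

/-- The set of the variables whose name is `w`. -/
def nameSet (n w : ℕ) : Finset (Fin n) := Finset.univ.filter (fun v => (v : ℕ) + 1 = w)

/-- The sum of the squared coefficients of the monomials that contain the variable named `w`. -/
def sumSq (p : MPoly n) (w : ℕ) : ℝ := ∑ S : Finset (Fin n) with nameSet n w ⊆ S, p S ^ 2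

theorem nameSet_succ (v : Fin n) : nameSet n ((v : ℕ) + 1) = {v} := by
  ext u
  simp [nameSet, Fin.ext_iff]

theorem nameSet_zero : nameSet n 0 = ∅ := by
  ext u
  simp [nameSet]

theorem sumSq_succ (p : MPoly n) (v : Fin n) : sumSq p ((v : ℕ) + 1) = influence p v := by
  unfold sumSq influence
  rw [nameSet_succ]
  simp

theorem sumSq_zero (p : MPoly n) : sumSq p 0 = sqNorm p := by
  unfold sumSq sqNorm
  rw [nameSet_zero]
  simp

/-- The largest name `w ≤ m` of a variable of influence more than `variance p / b`, or `0`. -/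
noncomputable def viol (b : ℕ) (p : MPoly n) : ℕ → ℕ
  | 0 => 0
  | m + 1 => if variance p < sumSq p (m + 1) * b then m + 1 else viol b p m

theorem viol_le (b : ℕ) (p : MPoly n) (m : ℕ) : viol b p m ≤ m := by
  induction m with
  | zero => simp [viol]
  | succ m ih => unfold viol; split_ifs <;> omega

theorem viol_pos {b : ℕ} {p : MPoly n} {m : ℕ} (h : 0 < viol b p m) :
    variance p < sumSq p (viol b p m) * b := by
  induction m with
  | zero => simp [viol] at h
  | succ m ih =>
    unfold viol at h ⊢
    split_ifs with h' <;> simp only [h', if_true, if_false] at h ⊢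
    exact ih h

theorem viol_zero {b : ℕ} {p : MPoly n} {m : ℕ} (h : viol b p m = 0) {w : ℕ} (h1 : 1 ≤ w)
    (hw : w ≤ m) : sumSq p w * b ≤ variance p := by
  induction m with
  | zero => omega
  | succ m ih =>
    unfold viol at h
    split_ifs at h with h'
    rcases Nat.lt_or_ge m w with h2 | h2
    · obtain rfl : w = m + 1 := by omega
      exact not_lt.1 h'
    · exact ih h h2

/-- A variable of influence more than `variance p / b`, if there is one. -/
noncomputable def pick (b : ℕ) (p : MPoly n) : Option (Fin n) :=
  if h : 0 < viol b p n then some ⟨viol b p n - 1, by have := viol_le b p n; omega⟩ else none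

/-- `1 / b`-regularity. -/
def Reg (b : ℕ) (p : MPoly n) : Prop := ∀ v, influence p v * b ≤ variance p

/-- The squared mean is at least `b` times the variance. -/
def Skew (b : ℕ) (p : MPoly n) : Prop := b * variance p ≤ p ∅ ^ 2

theorem pick_some {b : ℕ} {p : MPoly n} {v : Fin n} (h : pick b p = some v) :
    viol b p n = (v : ℕ) + 1 ∧ variance p < influence p v * b := by
  unfold pick at h
  split_ifs at h with h'
  have e : viol b p n = (v : ℕ) + 1 := by
    have := congrArg Fin.val (Option.some.inj h)
    simp at this; omega
  have := viol_pos h'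
  rw [e, sumSq_succ] at this
  exact ⟨e, this⟩

theorem viol_eq_zero_iff {b : ℕ} {p : MPoly n} : viol b p n = 0 ↔ Reg b p := by
  constructor
  · intro h v
    have := viol_zero h (w := v + 1) (by omega) (by omega)
    rwa [sumSq_succ] at this
  · intro h
    by_contra h0
    have h1 := viol_pos (Nat.pos_of_ne_zero h0)
    have h2 := viol_le b p n
    have := h ⟨viol b p n - 1, by omega⟩
    rw [← sumSq_succ] at this
    simp only [Nat.sub_add_cancel (Nat.pos_of_ne_zero h0)] at this
    linarith

theorem pick_eq_none_iff {b : ℕ} {p : MPoly n} : pick b p = none ↔ Reg b p := by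
  rw [← viol_eq_zero_iff]
  unfold pick
  split_ifs with h <;> simp <;> omega

/-! ### Expectations over random paths -/

/-- The tuple with variable `v` set to `σ`. -/
def fixAll (v : Fin n) (σ : ℤˣ) (P : Fin k → MPoly n) : Fin k → MPoly n := fun i => fix v σ (P i)

/-- The expectation of `F` after the given steps of the random process; the step `(j, b)` queries
the variable chosen by `pick b` for the `j`-th polynomial, if there is one. -/
noncomputable def Ex : List (Fin k × ℕ) → ((Fin k → MPoly n) → ℝ) → (Fin k → MPoly n) → ℝ
  | [], F, P => F P
  | (j, b) :: l, F, P =>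
    match pick b (P j) with
    | none => Ex l F P
    | some v => (Ex l F (fixAll v (-1) P) + Ex l F (fixAll v 1 P)) / 2

theorem Ex_append (l₁ l₂ : List (Fin k × ℕ)) (F : (Fin k → MPoly n) → ℝ) (P : Fin k → MPoly n) :
    Ex (l₁ ++ l₂) F P = Ex l₁ (Ex l₂ F) P := by
  induction l₁ generalizing P with
  | nil => rfl
  | cons a l ih =>
    obtain ⟨j, b⟩ := a
    simp only [List.cons_append, Ex]
    cases pick b (P j) <;> simp [ih]

/-- All polynomials of the tuple have degree at most `d`. -/
def AllDeg (d : ℕ) (P : Fin k → MPoly n) : Prop := ∀ i, HasDegree d (P i)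

theorem AllDeg.fixAll {d : ℕ} {P : Fin k → MPoly n} (h : AllDeg d P) (v : Fin n) (σ : ℤˣ) :
    AllDeg d (fixAll v σ P) := fun i => hasDegree_fix (h i) v σ

theorem Ex_mono {d : ℕ} {F G : (Fin k → MPoly n) → ℝ} (h : ∀ P, AllDeg d P → F P ≤ G P)
    (l : List (Fin k × ℕ)) {P : Fin k → MPoly n} (hP : AllDeg d P) : Ex l F P ≤ Ex l G P := by
  induction l generalizing P with
  | nil => exact h P hP
  | cons a l ih =>
    obtain ⟨j, b⟩ := a
    simp only [Ex]
    cases pick b (P j) with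
    | none => exact ih hP
    | some v =>
      have h1 := ih (hP.fixAll v (-1))
      have h2 := ih (hP.fixAll v 1)
      simp only
      linarith

theorem Ex_add (l : List (Fin k × ℕ)) (F G : (Fin k → MPoly n) → ℝ) (P : Fin k → MPoly n) :
    Ex l (fun P => F P + G P) P = Ex l F P + Ex l G P := by
  induction l generalizing P with
  | nil => rfl
  | cons a l ih =>
    obtain ⟨j, b⟩ := a
    simp only [Ex]
    cases pick b (P j) with
    | none => exact ih P
    | some v => simp only [ih]; ring

theorem Ex_smul (l : List (Fin k × ℕ)) (c : ℝ) (F : (Fin k → MPoly n) → ℝ) (P : Fin k → MPoly n) :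
    Ex l (fun P => c * F P) P = c * Ex l F P := by
  induction l generalizing P with
  | nil => rfl
  | cons a l ih =>
    obtain ⟨j, b⟩ := a
    simp only [Ex]
    cases pick b (P j) with
    | none => exact ih P
    | some v => simp only [ih]; ring

theorem Ex_sum {ι : Type*} (s : Finset ι) (l : List (Fin k × ℕ))
    (F : ι → (Fin k → MPoly n) → ℝ) (P : Fin k → MPoly n) :
    Ex l (fun P => ∑ i ∈ s, F i P) P = ∑ i ∈ s, Ex l (F i) P := by
  classical
  induction s using Finset.induction_on with
  | empty => simpa using Ex_smul l 0 (fun _ => 0) P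
  | insert a s ha ih =>
    simp only [Finset.sum_insert ha]
    rw [Ex_add, ih]

/-- The choice of the variables depends on the path, but the hypothesis holds for every variable, so
no further property of `pick` is needed. -/
theorem Ex_le_of_super {G : (Fin k → MPoly n) → ℝ}
    (h : ∀ v P, (G (fixAll v (-1) P) + G (fixAll v 1 P)) / 2 ≤ G P)
    (l : List (Fin k × ℕ)) (P : Fin k → MPoly n) : Ex l G P ≤ G P := by
  induction l generalizing P with
  | nil => exact le_rfl
  | cons a l ih =>
    obtain ⟨j, b⟩ := a
    simp only [Ex]
    cases pick b (P j) with
    | none => exact ih P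
    | some v =>
      have h1 := ih (fixAll v (-1) P)
      have h2 := ih (fixAll v 1 P)
      have h3 := h v P
      simp only
      linarith

theorem Ex_eq_of_mart {G : (Fin k → MPoly n) → ℝ}
    (h : ∀ v P, (G (fixAll v (-1) P) + G (fixAll v 1 P)) / 2 = G P)
    (l : List (Fin k × ℕ)) (P : Fin k → MPoly n) : Ex l G P = G P := by
  refine le_antisymm (Ex_le_of_super (fun v P => (h v P).le) l P) ?_
  have := Ex_le_of_super (G := fun P => -1 * G P) (fun v P => by have := h v P; linarith) l P
  rw [Ex_smul] at this
  linarith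

open Classical in
/-- The indicator of a proposition. -/
noncomputable def ind (p : Prop) : ℝ := if p then 1 else 0

theorem ind_nonneg (p : Prop) : 0 ≤ ind p := by unfold ind; split_ifs <;> norm_num

theorem ind_true {p : Prop} (h : p) : ind p = 1 := by simp [ind, h]

theorem ind_false {p : Prop} (h : ¬ p) : ind p = 0 := by simp [ind, h]

theorem ind_le_one (p : Prop) : ind p ≤ 1 := by unfold ind; split_ifs <;> norm_num

theorem ind_mono {p q : Prop} (h : p → q) : ind p ≤ ind q := by
  by_cases hp : p
  · rw [ind_true hp, ind_true (h hp)]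
  · rw [ind_false hp]; exact ind_nonneg _

theorem ind_not (p : Prop) : ind (¬ p) = 1 - ind p := by
  by_cases hp : p <;> simp [ind, hp]

theorem Ex_nonneg {F : (Fin k → MPoly n) → ℝ} (h : ∀ P, 0 ≤ F P) (l : List (Fin k × ℕ))
    (P : Fin k → MPoly n) : 0 ≤ Ex l F P := by
  induction l generalizing P with
  | nil => exact h P
  | cons a l ih =>
    obtain ⟨j, b⟩ := a
    simp only [Ex]
    cases pick b (P j) with
    | none => exact ih P
    | some v =>
      have h1 := ih (fixAll v (-1) P)
      have h2 := ih (fixAll v 1 P)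
      simp only
      linarith

/-- The case of threshold zero in Markov's inequality, where division by the threshold is
impossible. -/
theorem Ex_ind_pos_of_zero {G : (Fin k → MPoly n) → ℝ} (h : ∀ P, 0 ≤ G P) (l : List (Fin k × ℕ))
    (P : Fin k → MPoly n) (h0 : Ex l G P ≤ 0) : Ex l (fun P => ind (0 < G P)) P ≤ 0 := by
  induction l generalizing P with
  | nil => rw [Ex] at h0 ⊢; rw [ind_false (not_lt.2 h0)]
  | cons a l ih =>
    obtain ⟨j, b⟩ := a
    simp only [Ex] at h0 ⊢
    cases hp : pick b (P j) with
    | none => rw [hp] at h0; exact ih P h0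
    | some v =>
      rw [hp] at h0
      simp only at h0 ⊢
      have a1 := Ex_nonneg h l (fixAll v (-1) P)
      have a2 := Ex_nonneg h l (fixAll v 1 P)
      have h1 := ih (fixAll v (-1) P) (by linarith)
      have h2 := ih (fixAll v 1 P) (by linarith)
      linarith

/-- Markov's inequality. -/
theorem Ex_markov {d : ℕ} {G : (Fin k → MPoly n) → ℝ} (h : ∀ P, 0 ≤ G P) (l : List (Fin k × ℕ))
    {P : Fin k → MPoly n} (hP : AllDeg d P) {t β : ℝ} (ht : 0 ≤ t) (hβ : 0 ≤ β)
    (h0 : Ex l G P ≤ β * t) : Ex l (fun P => ind (t < G P)) P ≤ β := by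
  rcases ht.eq_or_lt with rfl | ht
  · exact (Ex_ind_pos_of_zero h l P (by simpa using h0)).trans hβ
  · have h1 : Ex l (fun P => ind (t < G P)) P ≤ Ex l (fun P => t⁻¹ * G P) P := by
      refine Ex_mono (fun P _ => ?_) l hP
      by_cases hh : t < G P
      · rw [ind_true hh, inv_mul_eq_div, le_div_iff₀ ht]; linarith
      · rw [ind_false hh]; have := h P; positivity
    rw [Ex_smul] at h1
    refine h1.trans ?_
    rw [inv_mul_eq_div, div_le_iff₀ ht]
    exact h0

end PTFReg

namespace PTFReg

variable {n k : ℕ}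

/-! ### Greedy queries for a single polynomial. -/

/-- A regular polynomial offers no variable to query, so all remaining steps of its phase are idle.
-/
theorem Ex_replicate_reg {F : (Fin k → MPoly n) → ℝ} {P : Fin k → MPoly n} {j : Fin k} {b : ℕ}
    (h : Reg b (P j)) (m : ℕ) : Ex (List.replicate m (j, b)) F P = F P := by
  induction m with
  | zero => rfl
  | succ m ih =>
    rw [List.replicate_succ]
    simp only [Ex, pick_eq_none_iff.2 h, ih]

theorem ind_mul_variance_le {b : ℕ} (p : MPoly n) :
    ind (¬ Reg b p) * variance p ≤ totalInf p := by
  have h1 := variance_le_totalInf p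
  have h2 := variance_nonneg p
  have h3 := ind_le_one (¬ Reg b p)
  nlinarith

/-- The variance left in the irregular leaves decays geometrically under greedy queries. -/
theorem Ex_greedy_decay {d b : ℕ} (hd : 1 ≤ d) (hb : 1 ≤ b) (j : Fin k) (m : ℕ)
    {P : Fin k → MPoly n} (hP : AllDeg d P) :
    Ex (List.replicate m (j, b)) (fun P => ind (¬ Reg b (P j)) * variance (P j)) P
      ≤ (1 - 1 / (b * d : ℝ)) ^ m * totalInf (P j) := by
  have hd' : (1:ℝ) ≤ d := by exact_mod_cast hd
  have hb' : (1:ℝ) ≤ b := by exact_mod_cast hb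
  have hr : 0 ≤ 1 - 1 / (b * d : ℝ) := by
    rw [sub_nonneg, div_le_one (by positivity)]; nlinarith
  have hT : ∀ p : MPoly n, 0 ≤ totalInf p := fun p => (variance_nonneg p).trans (variance_le_totalInf p)
  induction m generalizing P with
  | zero => simpa [Ex] using ind_mul_variance_le (P j)
  | succ m ih =>
    by_cases h : Reg b (P j)
    · rw [Ex_replicate_reg h, ind_false (by simpa using h), zero_mul]
      have := hT (P j)
      positivity
    · rw [List.replicate_succ]
      simp only [Ex]
      cases hp : pick b (P j) with
      | none => exact absurd (pick_eq_none_iff.1 hp) h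
      | some v =>
        simp only
        have h1 := ih (hP.fixAll v (-1))
        have h2 := ih (hP.fixAll v 1)
        have h3 := totalInf_fix v (P j)
        have h4 := (pick_some hp).2
        have h5 := totalInf_le (hP j)
        -- The queried influence exceeds Var/b, and Var is at least the total influence divided by
        -- d.
        have h6 : totalInf (P j) - influence (P j) v ≤ (1 - 1 / (b * d : ℝ)) * totalInf (P j) := by
          have : 1 / (b * d : ℝ) * totalInf (P j) ≤ influence (P j) v := by
            rw [div_mul_eq_mul_div, div_le_iff₀ (by positivity)]
            nlinarith
          linarith
        have h7 : 0 ≤ (1 - 1 / (b * d : ℝ)) ^ m := pow_nonneg hr m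
        have h8 : (1 - 1 / (b * d : ℝ)) ^ m * (totalInf (P j) - influence (P j) v)
            ≤ (1 - 1 / (b * d : ℝ)) ^ m * ((1 - 1 / (b * d : ℝ)) * totalInf (P j)) := by gcongr
        rw [← h3] at h8
        simp only [fixAll] at h1 h2 ⊢
        rw [pow_succ]
        linarith

/-- `p` is regular or skewed, with parameter `b`. -/
def Fine (b : ℕ) (p : MPoly n) : Prop := Reg b p ∨ Skew b p

/-- Second-moment method for the squared norm Z of the restricted polynomial. Its mean is z, and
E[Z^2] ≤ 9^d z^2. Leaves that are not fine contribute at most z/2 to the mean, so the fine ones have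
probability at least (z/2)^2 / (9^d z^2). -/
theorem Ex_greedy {d b m : ℕ} (hd : 1 ≤ d) (hb : 1 ≤ b) (j : Fin k)
    (hm : ((b : ℝ) + 1) * d * (1 - 1 / (b * d : ℝ)) ^ m ≤ 1 / 2)
    {P : Fin k → MPoly n} (hP : AllDeg d P) :
    1 / (4 * 9 ^ d) ≤ Ex (List.replicate m (j, b)) (fun P => ind (Fine b (P j))) P := by
  have h9 : (1:ℝ) ≤ 9 ^ d := one_le_pow₀ (by norm_num)
  rcases (sqNorm_nonneg (P j)).eq_or_lt with hz | hz
  · have hreg : Reg b (P j) := by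
      rw [eq_zero_of_sqNorm hz.symm]
      intro v
      simp [influence, variance]
    rw [Ex_replicate_reg hreg, ind_true (show Fine b (P j) from Or.inl hreg), div_le_one (by positivity)]
    linarith
  set z := sqNorm (P j) with hzdef
  -- The maximiser of s z - s^2 9^d z^2, with maximum 1 / (4 · 9^d).
  set s : ℝ := 1 / (2 * 9 ^ d * z) with hs
  have hs0 : 0 < s := by positivity
  set l := List.replicate m (j, b)
  have hdec := Ex_greedy_decay hd hb j m hP
  have hZ : Ex l (fun P => sqNorm (P j)) P = z := Ex_eq_of_mart (fun v P => sqNorm_fix v (P j)) l P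
  have hM : Ex l (fun P => moment 4 (P j)) P = moment 4 (P j) :=
    Ex_eq_of_mart (fun v P => moment_fix v 4 (P j)) l P
  have hM4 := moment_four_le (hP j)
  -- Cauchy–Schwarz in linear form: 2sZ - s^2 Z^2 ≤ 1 at fine leaves, and Z ≤ (b+1) Var at the
  -- others, so that only linear expectations are needed.
  have hpt : ∀ Q : Fin k → MPoly n, AllDeg d Q →
      2 * s * sqNorm (Q j) + (-(2 * s * (b + 1)) * (ind (¬ Reg b (Q j)) * variance (Q j))
        + -s ^ 2 * moment 4 (Q j)) ≤ ind (Fine b (Q j)) := by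
    intro Q _
    have a1 := sqNorm_sq_le (Q j)
    have a2 := variance_nonneg (Q j)
    have a3 : 0 ≤ s ^ 2 * (moment 4 (Q j) - sqNorm (Q j) ^ 2) :=
      mul_nonneg (sq_nonneg _) (by linarith)
    by_cases hg : Fine b (Q j)
    · rw [ind_true hg]
      have a4 := mul_nonneg (mul_nonneg hs0.le (by positivity : (0:ℝ) ≤ b + 1))
        (mul_nonneg (ind_nonneg (¬ Reg b (Q j))) a2)
      nlinarith [sq_nonneg (1 - s * sqNorm (Q j))]
    · rw [ind_false hg]
      have hn : ¬ Reg b (Q j) := fun h => hg (Or.inl h)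
      have hk : ¬ Skew b (Q j) := fun h => hg (Or.inr h)
      unfold Skew at hk
      rw [not_le] at hk
      rw [ind_true hn]
      have a5 : s * sqNorm (Q j) ≤ s * ((b + 1) * variance (Q j)) := by
        rw [sqNorm_eq]; gcongr; linarith
      nlinarith [sq_nonneg (s * sqNorm (Q j))]
  refine le_trans ?_ (Ex_mono hpt l hP)
  rw [Ex_add, Ex_add, Ex_smul, Ex_smul, Ex_smul, hZ, hM]
  have h5 := (totalInf_le (hP j)).trans
    (mul_le_mul_of_nonneg_left (variance_le_sqNorm (P j)) (Nat.cast_nonneg d))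
  rw [← hzdef] at h5
  have hd' : (1:ℝ) ≤ d := by exact_mod_cast hd
  have hb' : (1:ℝ) ≤ b := by exact_mod_cast hb
  have hr : 0 ≤ 1 - 1 / (b * d : ℝ) := by
    rw [sub_nonneg, div_le_one (by positivity)]; nlinarith
  have h6 : (1 - 1 / (b * d : ℝ)) ^ m * totalInf (P j) ≤ (1 - 1 / (b * d : ℝ)) ^ m * (d * z) := by
    have := pow_nonneg hr m
    gcongr
  set W := Ex l (fun P => ind (¬ Reg b (P j)) * variance (P j)) P
  have h7 : (b + 1) * W ≤ z / 2 := by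
    have : (b + 1) * W ≤ (b + 1) * ((1 - 1 / (b * d : ℝ)) ^ m * (d * z)) := by
      gcongr; exact hdec.trans h6
    have h8 := mul_le_mul_of_nonneg_right hm hz.le
    linarith
  have h8 : 2 * s * ((b + 1) * W) ≤ 2 * s * (z / 2) := by gcongr
  have h9 : s ^ 2 * moment 4 (P j) ≤ s ^ 2 * (9 ^ d * z ^ 2) := by gcongr
  have h10 : 2 * s * z - 2 * s * (z / 2) - s ^ 2 * (9 ^ d * z ^ 2) = 1 / (4 * 9 ^ d) := by
    rw [hs]; field_simp; norm_num
  linarith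

/-! ### Preservation of goodness under further queries -/

/-- The squared distance to the constant `c`, the original mean, is a martingale with initial value
V. By Markov it stays below tV except with probability 1/t; then the new variance is at most tV and
the new mean is still comparable to `c`, whose square is at least 4MtV. -/
theorem Ex_preserve_skew {d : ℕ} (i : Fin k) (l : List (Fin k × ℕ)) {P : Fin k → MPoly n}
    (hP : AllDeg d P) {M M' t : ℕ} (ht : 1 ≤ t) (hM : 1 ≤ M) (hM' : 4 * M * t ≤ M')
    (h : Skew M' (P i)) : Ex l (fun P => ind (¬ Skew M (P i))) P ≤ 1 / t := by
  have ht' : (1:ℝ) ≤ t := by exact_mod_cast ht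
  have hM1 : (1:ℝ) ≤ M := by exact_mod_cast hM
  have hM'' : 4 * (M:ℝ) * t ≤ M' := by exact_mod_cast hM'
  set c := P i ∅ with hc
  set V := variance (P i) with hV
  have hV0 : 0 ≤ V := variance_nonneg _
  have hG : Ex l (fun P => sqNorm (P i - const c)) P = V := by
    rw [Ex_eq_of_mart, sqNorm_sub_const]
    · simp [hc, hV]
    · intro v P
      simp only [fixAll]
      rw [← fix_sub_const, ← fix_sub_const, sqNorm_fix]
  refine le_trans (Ex_mono (d := d) (G := fun P => ind (t * V < sqNorm (P i - const c)))
    (fun Q _ => ind_mono fun hQ => ?_) l hP)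
    (Ex_markov (fun Q => sqNorm_nonneg _) l hP (by positivity) (by positivity) ?_)
  · by_contra hlt
    rw [not_lt, sqNorm_sub_const] at hlt
    apply hQ
    unfold Skew at h ⊢
    rw [← hc, ← hV] at h
    have hv := variance_nonneg (Q i)
    set w := variance (Q i)
    set y := Q i ∅
    have h1 : 4 * M * t * V ≤ c ^ 2 := le_trans (by gcongr) h
    have h2 : w ≤ t * V := by nlinarith [sq_nonneg (y - c)]
    have h3 : (y - c) ^ 2 + M * w ≤ M * (t * V) := by nlinarith
    nlinarith [sq_nonneg (2 * y - c), sq_nonneg (y - c), mul_nonneg (by linarith : (0:ℝ) ≤ M) hv]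
  · rw [hG, one_div, inv_mul_cancel_left₀ (by positivity)]

/-- Every query adds at most the influences of the queried variable on the current polynomial and on
`q`. The first is at most √kurt, which is linearised by the inequality between the means with weight
`s`, because it is `kurt`, not its root, that is known to be a supermartingale. -/
theorem Ex_sqNorm_sub_le (i : Fin k) (q : MPoly n) {s B : ℝ} (hs : 0 < s)
    (hB0 : 0 ≤ B) (hB : ∀ v, influence q v ≤ B) (l : List (Fin k × ℕ)) (P : Fin k → MPoly n) :
    Ex l (fun P => sqNorm (P i - q)) P
      ≤ sqNorm (P i - q) + l.length * (s * kurt (P i) / 2 + 1 / (2 * s) + B) := by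
  induction l generalizing P with
  | nil => simp [Ex]
  | cons a l ih =>
    obtain ⟨j, b⟩ := a
    simp only [Ex, List.length_cons]
    have hk : 0 ≤ kurt (P i) := Finset.sum_nonneg fun v _ => moment_four_nonneg _
    cases hp : pick b (P j) with
    | none =>
      refine (ih P).trans ?_
      gcongr
      linarith
    | some v =>
      simp only
      have h1 := ih (fixAll v (-1) P)
      have h2 := ih (fixAll v 1 P)
      have h3 := sqNorm_fix_sub v (P i) q
      have h4 := kurt_fix v (P i)
      have h5 := hB v
      have h6 : influence (P i) v ≤ s * kurt (P i) / 2 + 1 / (2 * s) := by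
        have a1 := influence_sq_le_kurt (P i) v
        have a2 : 0 ≤ (s * influence (P i) v - 1) ^ 2 / (2 * s) := by positivity
        have a3 : (s * influence (P i) v - 1) ^ 2 / (2 * s)
          = s * influence (P i) v ^ 2 / 2 - influence (P i) v + 1 / (2 * s) := by
          field_simp; ring
        have a4 : s * influence (P i) v ^ 2 / 2 ≤ s * kurt (P i) / 2 := by gcongr
        linarith
      simp only [fixAll] at h1 h2 ⊢
      have hl : (0:ℝ) ≤ l.length := Nat.cast_nonneg _
      have h7 : (l.length : ℝ) * (s * ((kurt (fix v (-1) (P i)) + kurt (fix v 1 (P i))) / 2) / 2)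
          ≤ l.length * (s * kurt (P i) / 2) := by gcongr
      push_cast
      linarith

theorem influence_le_sub (p q : MPoly n) (v : Fin n) :
    influence p v ≤ 2 * influence q v + 2 * sqNorm (p - q) := by
  have h : sqNorm (part v (p - q)) ≤ sqNorm (p - q) := by
    refine Finset.sum_le_sum fun S _ => ?_
    unfold part; split_ifs
    · exact le_rfl
    · simpa using sq_nonneg _
  refine le_trans ?_ (add_le_add_right (mul_le_mul_of_nonneg_left h (by norm_num)) _)
  rw [← sqNorm_part, ← sqNorm_part]
  unfold sqNorm
  rw [Finset.mul_sum, Finset.mul_sum, ← Finset.sum_add_distrib]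
  refine Finset.sum_le_sum fun S _ => ?_
  unfold part; split_ifs
  · simp only [Pi.sub_apply]; nlinarith [sq_nonneg (p S - 2 * q S)]
  · simp

theorem variance_le_sub (p q : MPoly n) :
    variance q ≤ 2 * variance p + 2 * sqNorm (p - q) := by
  have h : variance (p - q) ≤ sqNorm (p - q) := variance_le_sqNorm _
  refine le_trans ?_ (add_le_add_right (mul_le_mul_of_nonneg_left h (by norm_num)) _)
  unfold variance
  rw [Finset.mul_sum, Finset.mul_sum, ← Finset.sum_add_distrib]
  refine Finset.sum_le_sum fun S _ => ?_
  simp only [Pi.sub_apply]; nlinarith [sq_nonneg (2 * p S - q S)]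

/-- In the regular case, the polynomial moves in total by a squared distance much smaller than V/b
in expectation. Being close to a polynomial of tiny influences and variance V, it keeps variance at
least V/4 and influences at most V/(4b). -/
theorem Ex_preserve_fine {d b : ℕ} (hb : 512 ≤ b) (hdb : 9 ^ d * d ≤ b) (i : Fin k)
    (l : List (Fin k × ℕ)) (hl : l.length ≤ b ^ 3) {P : Fin k → MPoly n} (hP : AllDeg d P)
    (h : Fine (b ^ 16) (P i)) : Ex l (fun P => ind (¬ Fine b (P i))) P ≤ 1 / b := by
  have hskew : Skew (b ^ 16) (P i) → Ex l (fun P => ind (¬ Fine b (P i))) P ≤ 1 / b := by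
    intro hs
    refine (Ex_mono (fun Q _ => ind_mono fun hQ hs' => hQ (Or.inr hs')) l hP).trans
      (Ex_preserve_skew i l hP (M' := b ^ 16) (by omega) (by omega) ?_ hs)
    calc 4 * b * b ≤ b * b * b := by gcongr; omega
      _ = b ^ 3 := by ring
      _ ≤ b ^ 16 := Nat.pow_le_pow_right (by omega) (by norm_num)
  rcases h with hr | hs
  swap
  · exact hskew hs
  set q := P i with hq
  rcases (variance_nonneg q).eq_or_lt with hV | hV
  -- A polynomial of variance zero is skewed for every parameter.
  · exact hskew (by unfold Skew; rw [← hV, mul_zero]; exact sq_nonneg _)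
  set V := variance q with hVdef
  have hb' : (512:ℝ) ≤ b := by exact_mod_cast hb
  have hdb' : (9:ℝ) ^ d * d ≤ b := by exact_mod_cast hdb
  have hl' : (l.length : ℝ) ≤ b ^ 3 := by exact_mod_cast hl
  have hb0 : (0:ℝ) < b := by linarith
  have hinf : ∀ v, influence q v ≤ V / b ^ 16 := by
    intro v
    have := hr v
    rw [le_div_iff₀ (by positivity)]
    exact_mod_cast this
  have hK : kurt q ≤ b * (1 / b ^ 16) * V ^ 2 := by
    have := kurt_le (hP i) (t := 1 / (b:ℝ) ^ 16) (fun v => by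
      have := hinf v
      rwa [one_div, inv_mul_eq_div])
    refine this.trans ?_
    calc (9:ℝ) ^ d * (1 / b ^ 16 * d * V ^ 2) = (9 ^ d * d) * (1 / b ^ 16) * V ^ 2 := by ring
      _ ≤ _ := by gcongr
  -- With this weight, the three terms of the drift per query are at most 8V/b^9, V/(32 b^6) and
  -- V/b^16; multiplied by b^3 queries they stay below V/(16 b^2).
  set s : ℝ := 16 * b ^ 6 / V with hs
  have hs0 : 0 < s := by positivity
  have hN := Ex_sqNorm_sub_le i q hs0 (by positivity) hinf l P
  have hN0 : sqNorm (P i - q) = 0 := by simp [hq, sqNorm]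
  rw [hN0, zero_add] at hN
  have hN2 : Ex l (fun P => sqNorm (P i - q)) P ≤ 1 / b * (V / (16 * b)) := by
    refine hN.trans ?_
    rw [← hq]
    have hk : s * kurt q / 2 ≤ s * (b * (1 / b ^ 16) * V ^ 2) / 2 := by gcongr
    have hk0 : 0 ≤ kurt q := Finset.sum_nonneg fun v _ => moment_four_nonneg _
    have e1 : s * (b * (1 / b ^ 16) * V ^ 2) / 2 = 8 * V / b ^ 9 := by
      rw [hs]; field_simp; norm_num
    have e2 : 1 / (2 * s) = V / (32 * b ^ 6) := by
      rw [hs]; field_simp; norm_num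
    calc (l.length : ℝ) * (s * kurt q / 2 + 1 / (2 * s) + V / b ^ 16)
        ≤ b ^ 3 * (8 * V / b ^ 9 + V / (32 * b ^ 6) + V / b ^ 16) := by
          rw [← e1, ← e2]; gcongr
      _ ≤ b ^ 3 * (V / (512 * b ^ 5) + V / (32 * b ^ 5) + V / (512 * b ^ 5)) := by
          gcongr ?_ * (?_ + ?_ + ?_)
          · rw [div_le_div_iff₀ (by positivity) (by positivity)]
            have : 4096 * (b:ℝ) ^ 5 ≤ b ^ 9 := by
              have : (4096:ℝ) ≤ b ^ 4 := by nlinarith [pow_le_pow_left₀ (by norm_num) hb' 4]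
              calc 4096 * (b:ℝ) ^ 5 ≤ b ^ 4 * b ^ 5 := by gcongr
                _ = _ := by ring
            nlinarith
          · gcongr V / (32 * ?_)
            exact pow_le_pow_right₀ (by linarith) (by norm_num)
          · have : (b:ℝ) ^ 16 = b ^ 11 * b ^ 5 := by ring
            rw [this]
            gcongr
            calc (512:ℝ) ≤ b := hb'
              _ ≤ b ^ 11 := le_self_pow₀ (by linarith) (by norm_num)
      _ ≤ 1 / b * (V / (16 * b)) := by
          have : (b:ℝ) ^ 3 * (V / (512 * b ^ 5) + V / (32 * b ^ 5) + V / (512 * b ^ 5))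
            = 1 / b * (V / (16 * b)) * (9 / 16) := by field_simp; norm_num
          rw [this]
          have : 0 ≤ 1 / b * (V / (16 * b)) := by positivity
          linarith
  refine le_trans (Ex_mono (d := d) (G := fun P => ind (V / (16 * b) < sqNorm (P i - q)))
    (fun Q _ => ind_mono fun hQ => ?_) l hP)
    (Ex_markov (fun Q => sqNorm_nonneg _) l hP (by positivity) (by positivity) hN2)
  by_contra hlt
  rw [not_lt] at hlt
  -- Outside the exceptional event the squared distance to `q` is at most V/(16b), and regularity
  -- with parameter `b` follows from the weak triangle inequalities `influence_le_sub` and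
  -- `variance_le_sub`.
  refine hQ (Or.inl fun v => ?_)
  have a1 := influence_le_sub (Q i) q v
  have a2 := variance_le_sub (Q i) q
  have a3 := hinf v
  rw [← hVdef] at a2
  have a4 : V / b ^ 16 ≤ V / (32 * b) := by
    gcongr
    calc 32 * (b:ℝ) ≤ b * b := by gcongr; linarith
      _ = b ^ 2 := by ring
      _ ≤ b ^ 16 := pow_le_pow_right₀ (by linarith) (by norm_num)
  have a5 : influence (Q i) v * b ≤ V / 4 := by
    have : influence (Q i) v * b ≤ (2 * (V / (32 * b)) + 2 * (V / (16 * b))) * b := by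
      gcongr; linarith
    refine this.trans ?_
    have : (2 * (V / (32 * b)) + 2 * (V / (16 * b))) * b = 3 * V / 16 := by field_simp; norm_num
    rw [this]; linarith
  have a6 : V / (16 * b) ≤ V / 4 := by
    gcongr; linarith
  linarith

end PTFReg

namespace PTFReg

variable {n k : ℕ}

/-! ### The schedule -/

/-- The parameter after `j` of `k` phases. -/
def lev (B k j : ℕ) : ℕ := B ^ (16 ^ (k - j))

/-- One phase costs exactly the loss from b^16 to b that `Ex_preserve_fine` permits. -/
theorem lev_succ {B j : ℕ} (h : j < k) : lev B k j = lev B k (j + 1) ^ 16 := by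
  unfold lev
  rw [← pow_mul, ← pow_succ]
  congr 2
  omega

theorem lev_self (B k : ℕ) : lev B k k = B := by simp [lev]

theorem le_lev (B k j : ℕ) : B ≤ lev B k j :=
  Nat.le_self_pow (by positivity) B

/-- Phase `j`: greedy queries for the `j`-th polynomial. -/
def phase (B : ℕ) (j : Fin k) : List (Fin k × ℕ) :=
  List.replicate (lev B k (j + 1) ^ 3) (j, lev B k (j + 1))

/-- The first `j` phases. -/
def phases (B k j : ℕ) : List (Fin k × ℕ) := ((List.finRange k).take j).flatMap (phase B)

theorem phases_succ {B j : ℕ} (h : j < k) :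
    phases B k (j + 1) = phases B k j ++ phase B ⟨j, h⟩ := by
  unfold phases
  rw [List.take_add_one, List.getElem?_eq_getElem (by simpa using h)]
  simp

/-- The requirements on the basic parameter. -/
structure Large (B d k : ℕ) : Prop where
  b512 : 512 ≤ B
  deg : 9 ^ d * d ≤ B
  num : 8 * 9 ^ d * k ≤ B

/-- The power is at most exp(-b^2/d) ≤ exp(-b), since d ≤ b, and exp(b) ≥ b^3/6 beats the factor
(b+1)d. -/
theorem greedy_hyp {b d : ℕ} (hd : 1 ≤ d) (hb : 512 ≤ b) (hdb : d ≤ b) :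
    ((b : ℝ) + 1) * d * (1 - 1 / (b * d : ℝ)) ^ (b ^ 3) ≤ 1 / 2 := by
  have hd' : (1:ℝ) ≤ d := by exact_mod_cast hd
  have hb' : (512:ℝ) ≤ b := by exact_mod_cast hb
  have hdb' : (d:ℝ) ≤ b := by exact_mod_cast hdb
  have hr : 0 ≤ 1 - 1 / (b * d : ℝ) := by
    rw [sub_nonneg, div_le_one (by positivity)]; nlinarith
  have h1 : (1 - 1 / (b * d : ℝ)) ^ (b ^ 3) ≤ Real.exp (-b) := by
    calc (1 - 1 / (b * d : ℝ)) ^ (b ^ 3) ≤ Real.exp (-(1 / (b * d : ℝ))) ^ (b ^ 3) := by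
          gcongr
          have := Real.add_one_le_exp (-(1 / (b * d : ℝ)))
          linarith
      _ = Real.exp ((b ^ 3 : ℕ) * -(1 / (b * d : ℝ))) := by rw [← Real.exp_nat_mul]
      _ ≤ Real.exp (-b) := by
          rw [Real.exp_le_exp]
          have : (b:ℝ) * b ≤ b ^ 3 * (1 / (b * d : ℝ)) * b := by
            have e : (b:ℝ) ^ 3 * (1 / (b * d : ℝ)) * b = b * b * (b / d) := by field_simp
            rw [e]
            refine le_mul_of_one_le_right (by positivity) ?_
            rw [one_le_div (by positivity)]; exact hdb'
          have := le_of_mul_le_mul_right this (by linarith)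
          push_cast
          linarith
  have h2 : (b:ℝ) ^ 3 / 6 ≤ Real.exp b := by
    have := Real.pow_div_factorial_le_exp (b:ℝ) (by positivity) 3
    norm_num [Nat.factorial] at this
    exact this
  have h3 : ((b : ℝ) + 1) * d ≤ (b:ℝ) ^ 3 / 12 := by
    calc ((b : ℝ) + 1) * d ≤ (b + 1) * b := by gcongr
      _ ≤ _ := by
        have : 512 * (b:ℝ) ^ 2 ≤ b ^ 3 := by
          rw [pow_succ _ 2, mul_comm]; gcongr
        nlinarith
  calc ((b : ℝ) + 1) * d * (1 - 1 / (b * d : ℝ)) ^ (b ^ 3)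
      ≤ (b:ℝ) ^ 3 / 12 * Real.exp (-b) := by gcongr
    _ ≤ (Real.exp b / 2) * Real.exp (-b) :=
        mul_le_mul_of_nonneg_right (by linarith) (Real.exp_pos _).le
    _ = 1 / 2 := by rw [Real.exp_neg]; field_simp

/-- Induction over the phases. If the first j polynomials are fine at level j, then in phase j the
next one becomes fine with probability at least 1/(4·9^d), and the earlier ones fail to survive with
total probability at most k/b ≤ 1/(8·9^d). Every phase thus costs a factor 1/(8·9^d). -/
theorem Ex_phases {B d : ℕ} (hd : 1 ≤ d) (hB : Large B d k) {P : Fin k → MPoly n}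
    (hP : AllDeg d P) (j : ℕ) (hj : j ≤ k) :
    (1 / (8 * 9 ^ d) : ℝ) ^ j
      ≤ Ex (phases B k j) (fun P => ind (∀ i : Fin k, (i : ℕ) < j → Fine (lev B k j) (P i))) P := by
  have h9 : (1:ℝ) ≤ 9 ^ d := one_le_pow₀ (by norm_num)
  have hBb := hB.b512
  induction j with
  | zero =>
    rw [show phases B k 0 = [] by simp [phases], Ex, ind_true (by simp)]
    simp
  | succ j ih =>
    have hjk : j < k := hj
    rw [phases_succ hjk, Ex_append]
    set b := lev B k (j + 1) with hb
    have hbB : B ≤ b := le_lev _ _ _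
    have hstep : ∀ Q : Fin k → MPoly n, AllDeg d Q →
        (1 / (8 * 9 ^ d) : ℝ) * ind (∀ i : Fin k, (i : ℕ) < j → Fine (lev B k j) (Q i))
        ≤ Ex (phase B ⟨j, hjk⟩)
            (fun P => ind (∀ i : Fin k, (i : ℕ) < j + 1 → Fine b (P i))) Q := by
      intro Q hQ
      by_cases hG : ∀ i : Fin k, (i : ℕ) < j → Fine (lev B k j) (Q i)
      swap
      · rw [ind_false hG, mul_zero]
        exact Ex_nonneg (fun _ => ind_nonneg _) _ _
      rw [ind_true hG, mul_one]
      set s : Finset (Fin k) := Finset.univ.filter (fun i => (i : ℕ) < j) with hs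
      -- The union bound, as an inequality between indicators.
      have hpt : ∀ R : Fin k → MPoly n, AllDeg d R →
          ind (Fine b (R ⟨j, hjk⟩)) + -1 * ∑ i ∈ s, ind (¬ Fine b (R i))
            ≤ ind (∀ i : Fin k, (i : ℕ) < j + 1 → Fine b (R i)) := by
        intro R _
        by_cases hall : ∀ i : Fin k, (i : ℕ) < j + 1 → Fine b (R i)
        · rw [ind_true hall]
          have := ind_le_one (Fine b (R ⟨j, hjk⟩))
          have : 0 ≤ ∑ i ∈ s, ind (¬ Fine b (R i)) := Finset.sum_nonneg fun _ _ => ind_nonneg _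
          linarith
        · rw [ind_false hall]
          push Not at hall
          obtain ⟨i, hi, hbad⟩ := hall
          rcases Nat.lt_or_ge (i : ℕ) j with h | h
          · have h1 : ind (¬ Fine b (R i)) ≤ ∑ i ∈ s, ind (¬ Fine b (R i)) :=
              Finset.single_le_sum (f := fun i => ind (¬ Fine b (R i)))
                (fun _ _ => ind_nonneg _) (by simp [hs, h])
            rw [ind_true hbad] at h1
            have := ind_le_one (Fine b (R ⟨j, hjk⟩))
            linarith
          · obtain rfl : i = ⟨j, hjk⟩ := Fin.ext (show (i : ℕ) = j by omega)
            rw [ind_false hbad]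
            have : 0 ≤ ∑ i ∈ s, ind (¬ Fine b (R i)) := Finset.sum_nonneg fun _ _ => ind_nonneg _
            linarith
      refine le_trans ?_ (Ex_mono hpt _ hQ)
      rw [Ex_add, Ex_smul, Ex_sum]
      have hdle : d ≤ b := (Nat.le_mul_of_pos_left d (by positivity)).trans (hB.deg.trans hbB)
      have g1 : 1 / (4 * 9 ^ d) ≤ Ex (phase B ⟨j, hjk⟩) (fun P => ind (Fine b (P ⟨j, hjk⟩))) Q :=
        Ex_greedy hd (by omega) ⟨j, hjk⟩ (greedy_hyp hd (by omega) hdle) hQ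
      have g2 : ∑ i ∈ s, Ex (phase B ⟨j, hjk⟩) (fun P => ind (¬ Fine b (P i))) Q
          ≤ ∑ i ∈ s, 1 / (b : ℝ) := by
        refine Finset.sum_le_sum fun i hi => ?_
        refine Ex_preserve_fine (by omega) (hB.deg.trans hbB) i _ ?_ hQ ?_
        · simp [phase, hb]
        · rw [hb, ← lev_succ hjk]
          exact hG i (by simpa [hs] using hi)
      have g3 : ∑ i ∈ s, 1 / (b : ℝ) ≤ 1 / (8 * 9 ^ d) := by
        rw [Finset.sum_const, nsmul_eq_mul]
        have c1 : (s.card : ℝ) ≤ k := by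
          have := Finset.card_le_univ s
          rw [Fintype.card_fin] at this
          exact_mod_cast this
        have c2 : 8 * (9:ℝ) ^ d * k ≤ b := by exact_mod_cast hB.num.trans hbB
        have c3 : (0:ℝ) < b := by
          have : 0 < b := by omega
          exact_mod_cast this
        rw [mul_one_div, div_le_div_iff₀ c3 (by positivity)]
        nlinarith
      have g4 : (1:ℝ) / (4 * 9 ^ d) = 1 / (8 * 9 ^ d) + 1 / (8 * 9 ^ d) := by
        field_simp; norm_num
      linarith
    refine le_trans ?_ (Ex_mono hstep _ hP)
    rw [Ex_smul, pow_succ']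
    have := ih hjk.le
    gcongr

/-! ### The tree -/

open Classical in
/-- The label of a polynomial. -/
noncomputable def lab (B : ℕ) (p : MPoly n) : Label :=
  if Reg B p then .regular else if Skew B p then .const (sgn (p ∅)) else .fail

/-- The data at a leaf. -/
noncomputable def mkLeaf (B : ℕ) (P : Fin k → MPoly n) : LeafData n k :=
  ⟨P, fun i => lab B (P i)⟩

theorem lab_ne_fail {B : ℕ} {p : MPoly n} : lab B p ≠ .fail ↔ Fine B p := by
  unfold lab Fine
  by_cases h1 : Reg B p <;> by_cases h2 : Skew B p <;> simp [h1, h2]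

open Classical in
/-- The tree that queries according to a schedule until all polynomials are good. -/
noncomputable def build (B : ℕ) : List (Fin k × ℕ) → (Fin k → MPoly n) → DTree n (LeafData n k)
  | [], P => .leaf (mkLeaf B P)
  | (j, b) :: l, P =>
    if ∀ i, Fine B (P i) then .leaf (mkLeaf B P)
    else match pick b (P j) with
      | none => build B l P
      | some v => .node v (build B l (fixAll v (-1) P)) (build B l (fixAll v 1 P))

theorem build_of_fine {B : ℕ} {P : Fin k → MPoly n} (h : ∀ i, Fine B (P i))
    (l : List (Fin k × ℕ)) : build B l P = .leaf (mkLeaf B P) := by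
  cases l with
  | nil => rfl
  | cons a l => simp only [build, h, implies_true, if_true]

theorem depth_build (B : ℕ) (l : List (Fin k × ℕ)) (P : Fin k → MPoly n) :
    (build B l P).depth ≤ l.length := by
  induction l generalizing P with
  | nil => simp [build, DTree.depth]
  | cons a l ih =>
    obtain ⟨j, b⟩ := a
    simp only [build, List.length_cons]
    split_ifs
    · simp [DTree.depth]
    · cases pick b (P j) with
      | none => have := ih P; simp only; omega
      | some v =>
        have h1 := ih (fixAll v (-1) P)
        have h2 := ih (fixAll v 1 P)
        simp only [DTree.depth]; omega

/-- All labels are different from `fail`. -/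
def NoFail (_ : Restriction n) (a : LeafData n k) : Prop := ∀ i, a.label i ≠ .fail

theorem leafProb_leaf_of_fine {B : ℕ} {P : Fin k → MPoly n} (h : ∀ i, Fine B (P i))
    (ρ : Restriction n) : (DTree.leaf (mkLeaf B P)).leafProbFrom NoFail ρ = 1 := by
  simp only [DTree.leafProbFrom]
  rw [if_pos]
  intro i
  exact lab_ne_fail.2 (h i)

/-- The tree stops as soon as all polynomials are fine, while `Ex` runs through the whole list.
Stopping early does no harm: the left side is then zero. At the end of `l`, the rest `l'` starts
afresh from the current tuple. -/
theorem fail_build_append {B d : ℕ} (l l' : List (Fin k × ℕ)) {q : ℝ} (hq : 0 ≤ q)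
    (hl' : ∀ (P : Fin k → MPoly n) (ρ : Restriction n), AllDeg d P →
      1 - (build B l' P).leafProbFrom NoFail ρ ≤ q)
    {P : Fin k → MPoly n} (hP : AllDeg d P) (ρ : Restriction n) :
    1 - (build B (l ++ l') P).leafProbFrom NoFail ρ
      ≤ Ex l (fun P => q * ind (¬ ∀ i, Fine B (P i))) P := by
  induction l generalizing P ρ with
  | nil =>
    simp only [List.nil_append, Ex]
    by_cases h : ∀ i, Fine B (P i)
    · rw [build_of_fine h, leafProb_leaf_of_fine h, ind_false (by simpa using h)]; simp
    · rw [ind_true h, mul_one]; exact hl' P ρ hP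
  | cons a l ih =>
    by_cases h : ∀ i, Fine B (P i)
    · rw [build_of_fine h, leafProb_leaf_of_fine h, sub_self]
      exact Ex_nonneg (fun _ => mul_nonneg hq (ind_nonneg _)) _ _
    · obtain ⟨j, b⟩ := a
      simp only [List.cons_append, build, if_neg h, Ex]
      cases pick b (P j) with
      | none => exact ih hP ρ
      | some v =>
        simp only [DTree.leafProbFrom]
        have h1 := ih (hP.fixAll v (-1)) (Function.update ρ v (some (-1)))
        have h2 := ih (hP.fixAll v 1) (Function.update ρ v (some 1))
        linarith

theorem Ex_const (l : List (Fin k × ℕ)) (c : ℝ) (P : Fin k → MPoly n) :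
    Ex l (fun _ => c) P = c := Ex_eq_of_mart (fun _ _ => by ring) l P

/-- `R` rounds of all phases. -/
def sched (B k R : ℕ) : List (Fin k × ℕ) := (List.replicate R (phases B k k)).flatten

/-- A round succeeds with probability at least (8·9^d)^(-k) from every tuple of degree d, whatever
earlier rounds have done, so the failure probabilities multiply. -/
theorem fail_build_sched {B d : ℕ} (hd : 1 ≤ d) (hB : Large B d k) (R : ℕ) {P : Fin k → MPoly n}
    (hP : AllDeg d P) (ρ : Restriction n) :
    1 - (build B (sched B k R) P).leafProbFrom NoFail ρ
      ≤ (1 - (1 / (8 * 9 ^ d) : ℝ) ^ k) ^ R := by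
  have h9 : (1:ℝ) ≤ 9 ^ d := one_le_pow₀ (by norm_num)
  have hγ : (1 / (8 * 9 ^ d) : ℝ) ^ k ≤ 1 := by
    refine pow_le_one₀ (by positivity) ?_
    rw [div_le_one (by positivity)]; linarith
  induction R generalizing P ρ with
  | zero =>
    simp only [sched, List.replicate_zero, List.flatten_nil, pow_zero, build, DTree.leafProbFrom]
    split_ifs <;> norm_num
  | succ R ih =>
    have e : sched B k (R + 1) = phases B k k ++ sched B k R := by
      simp [sched, List.replicate_succ]
    rw [e]
    refine (fail_build_append _ _ (pow_nonneg (sub_nonneg.2 hγ) R)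
      (fun P ρ hP => ih hP ρ) hP ρ).trans ?_
    rw [Ex_smul, pow_succ]
    refine mul_le_mul_of_nonneg_left ?_ (pow_nonneg (sub_nonneg.2 hγ) R)
    have h := Ex_phases hd hB hP k le_rfl
    rw [lev_self] at h
    have h2 : Ex (phases B k k) (fun P => ind (¬ ∀ i, Fine B (P i))) P
        = 1 - Ex (phases B k k) (fun P => ind (∀ i : Fin k, (i:ℕ) < k → Fine B (P i))) P := by
      have : (fun P : Fin k → MPoly n => ind (¬ ∀ i, Fine B (P i)))
          = fun P => 1 + -1 * ind (∀ i : Fin k, (i:ℕ) < k → Fine B (P i)) := by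
        funext P
        rw [ind_not]
        simp; ring
      rw [this, Ex_add, Ex_smul, Ex_const]; ring
    rw [h2]
    linarith

/-! ### Restrictions along the paths of the tree -/

theorem restrict_none (p : MPoly n) : restrict p (fun _ => none) = p := by
  funext U
  unfold restrict
  simp [Finset.sum_filter]

/-- Links the step-by-step substitution of the process to the restriction at the leaf. A monomial
`S` with free part `T` contributes to `U` afterwards exactly if `T = U` or `T = insert v U`. -/
theorem restrict_update (p : MPoly n) {ρ : Restriction n} {v : Fin n} (h : ρ v = none) (σ : ℤˣ) :
    restrict p (Function.update ρ v (some σ)) = fix v σ (restrict p ρ) := by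
  funext U
  have hf : ∀ S : Finset (Fin n), S.filter (fun i => Function.update ρ v (some σ) i = none)
      = (S.filter (fun i => ρ i = none)).erase v := by
    intro S
    ext i
    by_cases hi : i = v
    · subst hi; simp
    · simp [hi]
  have hw : ∀ S : Finset (Fin n), ∏ i ∈ S, ((((Function.update ρ v (some σ) i).getD 1 : ℤˣ) : ℤ) : ℝ)
      = (if v ∈ S then ((σ : ℤ) : ℝ) else 1) * ∏ i ∈ S, ((((ρ i).getD 1 : ℤˣ) : ℤ) : ℝ) := by
    intro S
    split_ifs with hv
    · rw [← Finset.mul_prod_erase S _ hv,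
        ← Finset.mul_prod_erase S (fun i => ((((ρ i).getD 1 : ℤˣ) : ℤ) : ℝ)) hv]
      simp only [Function.update_self, Option.getD_some, h, Option.getD_none, Units.val_one,
        Int.cast_one, one_mul]
      congr 1
      refine Finset.prod_congr rfl fun i hi => ?_
      rw [Function.update_of_ne (Finset.ne_of_mem_erase hi)]
    · rw [one_mul]
      refine Finset.prod_congr rfl fun i hi => ?_
      rw [Function.update_of_ne (by rintro rfl; exact hv hi)]
  unfold fix restrict
  simp only [hf, hw]
  split_ifs with hv
  · refine Finset.sum_eq_zero fun S hS => ?_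
    have := (Finset.mem_filter.1 hS).2
    rw [← this] at hv
    simp at hv
  · simp only [Finset.sum_filter]
    rw [Finset.mul_sum, ← Finset.sum_add_distrib]
    refine Finset.sum_congr rfl fun S _ => ?_
    set T := S.filter (fun i => ρ i = none) with hT
    have hvT : v ∈ S ↔ v ∈ T := by simp [hT, h]
    by_cases hvS : v ∈ S
    · have hv2 := hvT.1 hvS
      have e1 : T.erase v = U ↔ T = insert v U := by
        constructor
        · rintro rfl; rw [Finset.insert_erase hv2]
        · rintro h'; rw [h', Finset.erase_insert hv]
      have e2 : T ≠ U := by rintro h'; exact hv (h' ▸ hv2)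
      simp only [hvS, e1, e2, if_true, if_false, zero_add]
      split_ifs <;> ring
    · have hv2 : v ∉ T := fun h' => hvS (hvT.2 h')
      have e1 : T.erase v = T := Finset.erase_eq_of_notMem hv2
      have e2 : T ≠ insert v U := by rintro h'; exact hv2 (h' ▸ Finset.mem_insert_self v U)
      simp only [hvS, e1, e2, if_false, one_mul, mul_zero, add_zero]

theorem influence_restrict {p : MPoly n} {ρ : Restriction n} {v : Fin n} (h : ρ v ≠ none) :
    influence (restrict p ρ) v = 0 := by
  unfold influence
  refine Finset.sum_eq_zero fun U hU => ?_
  have hv : v ∈ U := by simpa using hU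
  have : restrict p ρ U = 0 := by
    unfold restrict
    refine Finset.sum_eq_zero fun S hS => ?_
    have := (Finset.mem_filter.1 hS).2
    rw [← this] at hv
    exact absurd (Finset.mem_filter.1 hv).2 h
  rw [this]; norm_num

theorem build_spec (B : ℕ) (p : Fin k → MPoly n) (l : List (Fin k × ℕ)) (ρ : Restriction n) :
    (build B l (fun i => restrict (p i) ρ)).ReadOnceAvoiding
        (Finset.univ.filter (fun v => ρ v ≠ none)) ∧
      (build B l (fun i => restrict (p i) ρ)).ForallLeavesFrom
        (fun ρ a => a = mkLeaf B (fun i => restrict (p i) ρ)) ρ := by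
  induction l generalizing ρ with
  | nil => simp [build, DTree.ReadOnceAvoiding, DTree.ForallLeavesFrom]
  | cons a l ih =>
    obtain ⟨j, b⟩ := a
    simp only [build]
    split_ifs
    · simp [DTree.ReadOnceAvoiding, DTree.ForallLeavesFrom]
    · cases hp : pick b (restrict (p j) ρ) with
      | none => exact ih ρ
      | some v =>
        -- A fixed variable has influence zero and is never picked; hence no path queries a variable
        -- twice.
        have hv : ρ v = none := by
          by_contra hne
          have h1 := (pick_some hp).2
          rw [influence_restrict hne, zero_mul] at h1
          exact absurd (variance_nonneg (restrict (p j) ρ)) (not_le.2 h1)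
        have hs : ∀ σ : ℤˣ, (Finset.univ.filter (fun u => Function.update ρ v (some σ) u ≠ none))
            = insert v (Finset.univ.filter (fun u => ρ u ≠ none)) := by
          intro σ
          ext u
          by_cases hu : u = v
          · subst hu; simp
          · simp [hu]
        have he : ∀ σ : ℤˣ, fixAll v σ (fun i => restrict (p i) ρ)
            = fun i => restrict (p i) (Function.update ρ v (some σ)) := by
          intro σ; funext i
          rw [restrict_update _ hv]; rfl
        have h1 := ih (Function.update ρ v (some (-1)))
        have h2 := ih (Function.update ρ v (some 1))
        rw [hs] at h1 h2
        simp only [DTree.ReadOnceAvoiding, DTree.ForallLeavesFrom, he]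
        exact ⟨⟨by simp [hv], h1.1, h2.1⟩, h1.2, h2.2⟩

theorem readOnce_build (B : ℕ) (p : Fin k → MPoly n) (l : List (Fin k × ℕ)) :
    (build B l p).ReadOnce := by
  have := (build_spec B p l (fun _ => none)).1
  simp only [restrict_none] at this
  simpa [DTree.ReadOnce] using this

theorem forallLeaves_build (B : ℕ) (p : Fin k → MPoly n) (l : List (Fin k × ℕ)) :
    (build B l p).ForallLeaves (fun ρ a => a = mkLeaf B (fun i => restrict (p i) ρ)) := by
  have := (build_spec B p l (fun _ => none)).2
  simp only [restrict_none] at this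
  exact this

theorem DTree.ForallLeavesFrom.imp {α : Type} {p q : Restriction n → α → Prop}
    (h : ∀ ρ a, p ρ a → q ρ a) {T : DTree n α} {ρ : Restriction n}
    (hT : T.ForallLeavesFrom p ρ) : T.ForallLeavesFrom q ρ := by
  induction T generalizing ρ with
  | leaf a => exact h _ _ hT
  | node v lo hi ih1 ih2 => exact ⟨ih1 hT.1, ih2 hT.2⟩

/-- The tree without the data at the leaves. -/
def DTree.forget {α : Type} : DTree n α → DTree n Unit
  | leaf _ => leaf ()
  | node v lo hi => node v lo.forget hi.forget

theorem DTree.depth_forget {α : Type} (T : DTree n α) : T.forget.depth = T.depth := by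
  induction T with
  | leaf a => rfl
  | node v lo hi h1 h2 => simp [forget, depth, h1, h2]

theorem DTree.readOnce_forget {α : Type} {T : DTree n α} {Q : Finset (Fin n)}
    (h : T.ReadOnceAvoiding Q) : T.forget.ReadOnceAvoiding Q := by
  induction T generalizing Q with
  | leaf a => trivial
  | node v lo hi h1 h2 => exact ⟨h.1, h1 h.2.1, h2 h.2.2⟩

theorem DTree.leafProb_forget {α : Type} {p : Restriction n → α → Prop} {q : Restriction n → Prop}
    {T : DTree n α} {ρ : Restriction n} (h : T.ForallLeavesFrom (fun ρ a => p ρ a → q ρ) ρ) :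
    T.leafProbFrom p ρ ≤ T.forget.leafProbFrom (fun ρ _ => q ρ) ρ := by
  induction T generalizing ρ with
  | leaf a =>
    simp only [ForallLeavesFrom] at h
    simp only [forget, leafProbFrom]
    split_ifs with h1 h2 <;> first | exact absurd (h h1) h2 | norm_num
  | node v lo hi h1 h2 =>
    have := h1 h.1
    have := h2 h.2
    simp only [forget, leafProbFrom]
    linarith

end PTFReg

namespace PTFReg

variable {n k : ℕ}

/-! ### Parameters -/

/-- Integer approximations of the parameters: `L` bounds `1 / τ` and `log (1 / ε)`, and `K` bounds
`log (1 / δ)`. -/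
structure Approx (τ ε δ : ℝ) (L K : ℕ) : Prop where
  tau : 1 / τ ≤ L
  eps : 1 / ε ≤ 2 ^ L
  upper : (L : ℝ) ≤ 1 / τ + 2 * Real.log (1 / ε) + 1
  del : 1 / δ ≤ 2 ^ K
  upper' : (K : ℝ) ≤ 2 * Real.log (1 / δ) + 1

/-- The basic parameter. -/
def base (L k d : ℕ) : ℕ := (L * k * d * 1024) ^ (d + 1)

/-- The number of rounds. -/
def rounds (L K k d : ℕ) : ℕ := base L k d ^ k * K

/-- The number of steps of the schedule. -/
def total (L K k d : ℕ) : ℕ := (sched (base L k d) k (rounds L K k d)).length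

theorem le_base (L k d : ℕ) :
    L * k * d * 1024 ≤ base L k d := Nat.le_self_pow (by omega) _

/-- Of the d + 1 factors 1024 L k d of the base, d absorb 9^d, and the last one absorbs `d` or `8k`.
-/
theorem large_base {L k d : ℕ} (hL : 1 ≤ L) (hk : 1 ≤ k) (hd : 1 ≤ d) :
    Large (base L k d) d k := by
  have h0 : 1 ≤ L * k * d := Nat.mul_pos (Nat.mul_pos hL hk) hd
  have hk' : k ≤ L * k * d := by
    calc k = 1 * k * 1 := by ring
      _ ≤ L * k * d := by gcongr
  have hd' : d ≤ L * k * d := Nat.le_mul_of_pos_left d (Nat.mul_pos hL hk)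
  have h9 : 9 ^ d ≤ (L * k * d * 1024) ^ d := Nat.pow_le_pow_left (by omega) d
  refine ⟨?_, ?_, ?_⟩
  · exact le_trans (by omega) (le_base L k d)
  · unfold base
    rw [pow_succ]
    gcongr
    omega
  · calc 8 * 9 ^ d * k = 9 ^ d * (8 * k) := by ring
      _ ≤ (L * k * d * 1024) ^ d * (L * k * d * 1024) := Nat.mul_le_mul h9 (by omega)
      _ = base L k d := by rw [base, pow_succ]

theorem quarter_facts {ε : ℝ} (h0 : 0 < ε) (h1 : ε < 1 / 4) :
    4 ≤ 1 / ε ∧ 1 ≤ Real.log (1 / ε) := by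
  constructor
  · rw [le_div_iff₀ h0]; linarith
  · have := log_ratio (d := 1) le_rfl h0 h1
    simpa using this

theorem Approx.one_le_left {τ ε δ : ℝ} {L K : ℕ} (h : Approx τ ε δ L K) (h0 : 0 < τ)
    (h1 : τ < 1 / 4) : 1 ≤ L := by
  have h4 := (quarter_facts h0 h1).1
  have : (1:ℝ) ≤ L := by linarith [h.tau]
  exact_mod_cast this

theorem Approx.one_le_right {τ ε δ : ℝ} {L K : ℕ} (h : Approx τ ε δ L K) (h0 : 0 < δ)
    (h1 : δ < 1 / 4) : 1 ≤ K := by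
  have h4 := (quarter_facts h0 h1).1
  by_contra hK
  obtain rfl : K = 0 := by omega
  have := h.del
  norm_num at this h4
  linarith

/-- Since log(d/ε) ≤ d + L, the base exceeds (12 log(d/ε))^d. The integer test in the program is
therefore stronger than skewness. -/
theorem skew_isSkewed {τ ε δ : ℝ} {L K d : ℕ} (h : Approx τ ε δ L K) (hL : 1 ≤ L) (hk : 1 ≤ k)
    (hd : 1 ≤ d) (h0 : 0 < ε) (h1 : ε < 1 / 4) {p : MPoly n} (hp : Skew (base L k d) p) :
    IsSkewed 12 d ε p := by
  have hl := log_ratio hd h0 h1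
  rw [isSkewed_iff (by linarith)]
  refine le_trans ?_ hp
  have hd' : (1:ℝ) ≤ d := by exact_mod_cast hd
  have hk' : (1:ℝ) ≤ k := by exact_mod_cast hk
  have hL' : (1:ℝ) ≤ L := by exact_mod_cast hL
  have a1 : Real.log (d / ε) = Real.log d + Real.log (1 / ε) := by
    rw [← Real.log_mul (by positivity) (by positivity)]; congr 1; ring
  have a2 : Real.log d ≤ d := (Real.log_le_sub_one_of_pos (by positivity)).trans (by linarith)
  have a3 : Real.log (1 / ε) ≤ L := by
    calc Real.log (1 / ε) ≤ Real.log (2 ^ L) := Real.log_le_log (by positivity) h.eps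
      _ = L * Real.log 2 := by rw [Real.log_pow]
      _ ≤ L * 1 := by
        gcongr
        have := Real.log_two_lt_d9
        linarith
      _ = L := mul_one _
  have a4 : 12 * Real.log (d / ε) ≤ L * k * d * 1024 := by
    have b1 : (L:ℝ) ≤ L * k * d := by
      calc (L:ℝ) = L * 1 * 1 := by ring
        _ ≤ _ := by gcongr
    have b2 : (d:ℝ) ≤ L * k * d := by
      calc (d:ℝ) = 1 * 1 * d := by ring
        _ ≤ _ := by gcongr
    rw [a1]; linarith
  have a5 : (12 * Real.log (d / ε)) ^ d ≤ (base L k d : ℝ) := by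
    unfold base
    push_cast
    calc (12 * Real.log (d / ε)) ^ d ≤ (L * k * d * 1024 : ℝ) ^ d := by gcongr
      _ ≤ _ := by
        refine pow_le_pow_right₀ ?_ (by omega)
        linarith
  have := variance_nonneg p
  gcongr

theorem reg_isRegular {τ ε δ : ℝ} {L K d : ℕ} (h : Approx τ ε δ L K) (hk : 1 ≤ k)
    (hd : 1 ≤ d) (h0 : 0 < τ) {p : MPoly n} (hp : Reg (base L k d) p) : IsRegular τ p := by
  intro v
  have a1 : (L : ℝ) ≤ base L k d := by
    have : L ≤ base L k d := by
      refine le_trans ?_ (le_base L k d)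
      calc L = L * 1 * 1 * 1 := by ring
        _ ≤ L * k * d * 1024 := by gcongr; norm_num
    exact_mod_cast this
  have a2 := hp v
  have a3 := influence_nonneg p v
  have a4 : 1 ≤ τ * base L k d := by
    have := h.tau.trans a1
    rwa [div_le_iff₀' h0] at this
  nlinarith

/-- A round succeeds with probability γ ≥ B^(-k), so B^k · K rounds fail with probability at most
exp(-K) ≤ 2^(-K) ≤ δ. -/
theorem prob_bound {τ ε δ : ℝ} {L K d : ℕ} (h : Approx τ ε δ L K) (hL : 1 ≤ L) (hk : 1 ≤ k)
    (hd : 1 ≤ d) (h0 : 0 < δ) :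
    (1 - (1 / (8 * 9 ^ d) : ℝ) ^ k) ^ rounds L K k d ≤ δ := by
  have hB := large_base hL hk hd
  set B := base L k d with hBdef
  have hB0 : (0:ℝ) < B := by
    have := hB.b512
    have : 0 < B := by omega
    exact_mod_cast this
  have h9 : (1:ℝ) ≤ 9 ^ d := one_le_pow₀ (by norm_num)
  have hk' : (1:ℝ) ≤ k := by exact_mod_cast hk
  have g1 : (1 / B : ℝ) ≤ 1 / (8 * 9 ^ d) := by
    have := hB.num
    have : 8 * (9:ℝ) ^ d * k ≤ B := by exact_mod_cast this
    gcongr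
    nlinarith
  set γ : ℝ := (1 / (8 * 9 ^ d) : ℝ) ^ k with hγ
  have g2 : 1 / (B:ℝ) ^ k ≤ γ := by
    rw [hγ, ← one_div_pow]; gcongr
  have g3 : γ ≤ 1 := by
    refine pow_le_one₀ (by positivity) ?_
    rw [div_le_one (by positivity)]; linarith
  calc (1 - γ) ^ rounds L K k d ≤ Real.exp (-γ) ^ rounds L K k d := by
        have := Real.add_one_le_exp (-γ)
        refine pow_le_pow_left₀ (by linarith) (by linarith) _
    _ = Real.exp (rounds L K k d * -γ) := by rw [← Real.exp_nat_mul]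
    _ ≤ Real.exp (-K) := by
        rw [Real.exp_le_exp]
        unfold rounds
        rw [← hBdef]
        push_cast
        have : (K:ℝ) ≤ B ^ k * K * γ := by
          calc (K:ℝ) = B ^ k * K * (1 / (B:ℝ) ^ k) := by field_simp
            _ ≤ _ := by gcongr
        linarith
    _ ≤ δ := by
        rw [Real.exp_neg, inv_le_comm₀ (Real.exp_pos _) h0, ← one_div]
        refine h.del.trans ?_
        calc (2:ℝ) ^ K ≤ Real.exp 1 ^ K := by
              have := Real.add_one_le_exp (1:ℝ)
              gcongr; linarith
          _ = Real.exp K := by rw [← Real.exp_nat_mul]; simp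

theorem length_sched (B k R : ℕ) :
    (sched B k R).length = R * ((List.finRange k).map fun j : Fin k => lev B k ((j : ℕ) + 1) ^ 3).sum := by
  have : phases B k k = (List.finRange k).flatMap (phase B) := by
    unfold phases
    rw [List.take_of_length_le (by simp)]
  simp [sched, this, List.length_flatMap, phase]

theorem total_ge {L K k d : ℕ} (hL : 1 ≤ L) (hk : 1 ≤ k) (hd : 1 ≤ d) :
    rounds L K k d ≤ total L K k d := by
  unfold total
  rw [length_sched]
  refine Nat.le_mul_of_pos_right _ ?_
  have hB := (large_base hL hk hd).b512
  have h1 := List.le_sum_of_mem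
    (List.mem_map_of_mem (f := fun j : Fin k => lev (base L k d) k ((j : ℕ) + 1) ^ 3)
      (List.mem_finRange (⟨0, hk⟩ : Fin k)))
  have h2 := le_lev (base L k d) k (((⟨0, hk⟩ : Fin k) : ℕ) + 1)
  exact lt_of_lt_of_le (pow_pos (lt_of_lt_of_le (by omega) h2) 3) h1

theorem base_le_total {L K k d : ℕ} (hL : 1 ≤ L) (hK : 1 ≤ K) (hk : 1 ≤ k) (hd : 1 ≤ d) :
    base L k d ≤ total L K k d := by
  refine le_trans ?_ (total_ge hL hk hd)
  unfold rounds
  exact (Nat.le_self_pow (by omega) _).trans (Nat.le_mul_of_pos_right _ hK)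

theorem K_le_total {L K k d : ℕ} (hL : 1 ≤ L) (hk : 1 ≤ k) (hd : 1 ≤ d) :
    K ≤ total L K k d := by
  refine le_trans ?_ (total_ge hL hk hd)
  unfold rounds
  refine Nat.le_mul_of_pos_left _ (pow_pos ?_ _)
  have := (large_base hL hk hd).b512
  omega

/-- A round has at most k · B^(3·16^(k-1)) steps, because the first phase is the longest. With B^k ·
K rounds and k ≤ B, the exponent k + 1 + 3·16^(k-1) is at most 16^k. -/
theorem total_le {L K k d : ℕ} (hL : 1 ≤ L) (hk : 1 ≤ k) (hd : 1 ≤ d) :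
    total L K k d ≤ K * base L k d ^ (16 ^ k) := by
  unfold total
  rw [length_sched]
  have hB := large_base hL hk hd
  have hB0 : 1 ≤ base L k d := by have := hB.b512; omega
  have hkB : k ≤ base L k d := le_trans (Nat.le_mul_of_pos_left _ (by positivity)) hB.num
  unfold rounds
  set B := base L k d
  have h1 : ((List.finRange k).map fun j : Fin k => lev B k ((j : ℕ) + 1) ^ 3).sum
      ≤ k * B ^ (3 * 16 ^ (k - 1)) := by
    have := List.sum_le_card_nsmul ((List.finRange k).map fun j : Fin k => lev B k ((j : ℕ) + 1) ^ 3)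
      (B ^ (3 * 16 ^ (k - 1))) (by
        intro x hx
        obtain ⟨j, _, rfl⟩ := List.mem_map.1 hx
        unfold lev
        rw [← pow_mul]
        refine Nat.pow_le_pow_right hB0 ?_
        rw [mul_comm]
        gcongr
        · norm_num
        · omega)
    simpa using this
  calc B ^ k * K * ((List.finRange k).map fun j : Fin k => lev B k ((j : ℕ) + 1) ^ 3).sum
      ≤ B ^ k * K * (B * B ^ (3 * 16 ^ (k - 1))) := by gcongr; exact h1.trans (by gcongr)
    _ = K * B ^ (k + 1 + 3 * 16 ^ (k - 1)) := by ring
    _ ≤ K * B ^ (16 ^ k) := by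
      refine Nat.mul_le_mul_left _ (Nat.pow_le_pow_right hB0 ?_)
      obtain ⟨t, rfl⟩ : ∃ t, k = t + 1 := ⟨k - 1, by omega⟩
      rw [Nat.add_sub_cancel, pow_succ]
      have : t < 16 ^ t := Nat.lt_pow_self (by norm_num)
      omega

/-- The source of the exponent 11: with y = 2d, the factors 7 + k + d, y, 2 and 16^k are bounded by
y^(5k), y^k, y^k and y^(4k). -/
theorem exponent_bound {k d : ℕ} (hk : 1 ≤ k) (hd : 1 ≤ d) :
    (7 + k + d) * (2 * d) * (2 * 16 ^ k) ≤ (2 * d) ^ (11 * k) := by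
  set y := 2 * d with hy
  have hy2 : 2 ≤ y := by omega
  have hy1 : 1 ≤ y := by omega
  have a0 : ∀ a : ℕ, 2 ^ (a * k) ≤ y ^ (a * k) := fun a => Nat.pow_le_pow_left hy2 _
  have a1 : 16 ^ k ≤ y ^ (4 * k) := by
    refine le_trans (le_of_eq ?_) (a0 4)
    rw [pow_mul]; norm_num
  have a2 : y ≤ y ^ k := Nat.le_self_pow (by omega) y
  have a3 : 2 ≤ y ^ k := hy2.trans a2
  have a4 : k ≤ y ^ k := (Nat.lt_pow_self (by omega)).le
  have a5 : d ≤ y ^ k := le_trans (by omega) a2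
  have a6 : 7 + k + d ≤ y ^ (5 * k) := by
    have e : y ^ (5 * k) = y ^ k * y ^ (4 * k) := by rw [← pow_add]; congr 1; ring
    have b1 : 16 ≤ y ^ (4 * k) := by
      refine le_trans ?_ a1
      exact Nat.le_self_pow (by omega) 16
    rw [e]
    nlinarith
  calc (7 + k + d) * y * (2 * 16 ^ k) ≤ y ^ (5 * k) * y ^ k * (y ^ k * y ^ (4 * k)) := by gcongr
    _ = y ^ (11 * k) := by rw [← pow_add, ← pow_add, ← pow_add]; congr 1; ring

/-- Everything is expressed by β = (1/τ) log(1/ε) ≥ 4, which absorbs constants, k and d as powers of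
itself. The extra 1 on the left is needed for the running time, where 2^(N+1) appears. -/
theorem total_le_depthBound {τ ε δ : ℝ} {L K d k : ℕ} (h : Approx τ ε δ L K)
    (hk : 1 ≤ k) (hd : 1 ≤ d) (hτ : 0 < τ) (hτ' : τ < 1 / 4) (hε : 0 < ε) (hε' : ε < 1 / 4)
    (hδ : 0 < δ) (hδ' : δ < 1 / 4) :
    ((total L K k d + 1 : ℕ) : ℝ) ≤ depthBound 11 d k τ ε δ := by
  have hL := h.one_le_left hτ hτ'
  have hK := h.one_le_right hδ hδ'
  obtain ⟨t1, t2⟩ := quarter_facts hτ hτ'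
  obtain ⟨e1, e2⟩ := quarter_facts hε hε'
  obtain ⟨_, d2⟩ := quarter_facts hδ hδ'
  have hd' : (1:ℝ) ≤ d := by exact_mod_cast hd
  have hk' : (1:ℝ) ≤ k := by exact_mod_cast hk
  have hL' : (1:ℝ) ≤ L := by exact_mod_cast hL
  unfold depthBound
  set β : ℝ := 1 / τ * Real.log (1 / ε) with hβ
  have hβ4 : 4 ≤ β := by rw [hβ]; nlinarith
  have hLβ : (L:ℝ) ≤ 2 * β := by
    have := h.upper
    have u1 : 1 / τ ≤ β := by rw [hβ]; nlinarith
    have u2 : 4 * Real.log (1 / ε) ≤ β := by rw [hβ]; gcongr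
    linarith
  have hB := large_base hL hk hd
  have hBβ : (base L k d : ℝ) ≤ β ^ ((7 + k + d) * (2 * d)) := by
    have f1 : (k:ℝ) ≤ β ^ k := by
      have : k ≤ 4 ^ k := (Nat.lt_pow_self (by norm_num)).le
      calc (k:ℝ) ≤ 4 ^ k := by exact_mod_cast this
        _ ≤ _ := by gcongr
    have f2 : (d:ℝ) ≤ β ^ d := by
      have : d ≤ 4 ^ d := (Nat.lt_pow_self (by norm_num)).le
      calc (d:ℝ) ≤ 4 ^ d := by exact_mod_cast this
        _ ≤ _ := by gcongr
    have f3 : (2048:ℝ) ≤ β ^ 6 := by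
      calc (2048:ℝ) ≤ 4 ^ 6 := by norm_num
        _ ≤ _ := by gcongr
    have f4 : (L * k * d * 1024 : ℝ) ≤ β ^ (7 + k + d) := by
      calc (L * k * d * 1024 : ℝ) ≤ (2 * β) * β ^ k * β ^ d * 1024 := by gcongr
        _ = 2048 * (β * β ^ k * β ^ d) := by ring
        _ ≤ β ^ 6 * (β * β ^ k * β ^ d) := by gcongr
        _ = β ^ (7 + k + d) := by ring
    unfold base
    push_cast
    calc (L * k * d * 1024 : ℝ) ^ (d + 1) ≤ (β ^ (7 + k + d)) ^ (d + 1) := by gcongr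
      _ = β ^ ((7 + k + d) * (d + 1)) := by rw [← pow_mul]
      _ ≤ _ := by
        refine pow_le_pow_right₀ (by linarith) ?_
        gcongr; omega
  have hB6 : (6:ℝ) ≤ base L k d := by
    have := hB.b512
    have : 6 ≤ base L k d := by omega
    exact_mod_cast this
  have hN1 : 1 ≤ total L K k d := hK.trans (K_le_total hL hk hd)
  have hN : (total L K k d : ℝ) ≤ K * (base L k d : ℝ) ^ (16 ^ k) := by
    exact_mod_cast total_le hL hk hd
  have hN1' : (1:ℝ) ≤ total L K k d := by exact_mod_cast hN1
  push_cast
  set B : ℝ := (base L k d : ℝ)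
  have hKδ : (K:ℝ) ≤ 3 * Real.log (1 / δ) := by linarith [h.upper']
  have hBe : B ≤ B ^ (16 ^ k) := le_self_pow₀ (by linarith) (by positivity)
  calc (total L K k d : ℝ) + 1 ≤ 2 * (K * B ^ (16 ^ k)) := by linarith
    _ ≤ 2 * (3 * Real.log (1 / δ) * B ^ (16 ^ k)) := by gcongr
    _ = 6 * B ^ (16 ^ k) * Real.log (1 / δ) := by ring
    _ ≤ B ^ (16 ^ k) * B ^ (16 ^ k) * Real.log (1 / δ) := by gcongr; linarith
    _ = B ^ (2 * 16 ^ k) * Real.log (1 / δ) := by rw [← pow_add]; congr 2; ring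
    _ ≤ (β ^ ((7 + k + d) * (2 * d))) ^ (2 * 16 ^ k) * Real.log (1 / δ) := by gcongr
    _ = β ^ ((7 + k + d) * (2 * d) * (2 * 16 ^ k)) * Real.log (1 / δ) := by rw [← pow_mul]
    _ ≤ β ^ ((2 * d) ^ (11 * k)) * Real.log (1 / δ) := by
      gcongr
      · linarith
      · exact exponent_bound hk hd

/-- The least such `m`, characterised as the loop of the program finds it. Minimality gives (m-1)
log 2 < log(1/x), and log 2 > 1/2. -/
theorem exists_log_approx {x : ℝ} (h0 : 0 < x) (h1 : x < 1 / 4) :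
    ∃ m : ℕ, 1 / x ≤ 2 ^ m ∧ (∀ m' < m, (2:ℝ) ^ m' < 1 / x) ∧ (m : ℝ) ≤ 2 * Real.log (1 / x) + 1 := by
  obtain ⟨a1, a2⟩ := quarter_facts h0 h1
  have hex : ∃ m : ℕ, 1 / x ≤ 2 ^ m := by
    obtain ⟨m, hm⟩ := pow_unbounded_of_one_lt (1 / x) (one_lt_two)
    exact ⟨m, hm.le⟩
  classical
  refine ⟨Nat.find hex, Nat.find_spec hex, fun m' hm' => not_le.1 (Nat.find_min hex hm'), ?_⟩
  rcases Nat.eq_zero_or_pos (Nat.find hex) with h | (h : 1 ≤ Nat.find hex)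
  · rw [h]; simp only [Nat.cast_zero]; linarith
  · have h2 := not_le.1 (Nat.find_min hex (show Nat.find hex - 1 < Nat.find hex by omega))
    have h3 := Real.log_lt_log (by positivity) h2
    rw [Real.log_pow, Nat.cast_sub h] at h3
    have := Real.log_two_gt_d9
    have h4 : (1:ℝ) ≤ Nat.find hex := by exact_mod_cast h
    push_cast at h3
    nlinarith

/-- The tree for given approximations of the parameters. -/
noncomputable def theTree (d L K : ℕ) (p : Fin k → MPoly n) : DTree n (LeafData n k) :=
  build (base L k d) (sched (base L k d) k (rounds L K k d)) p

theorem leafProb_theTree {τ ε δ : ℝ} {L K d : ℕ} (h : Approx τ ε δ L K) (hL : 1 ≤ L)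
    (hk : 1 ≤ k) (hd : 1 ≤ d) (hδ : 0 < δ) {p : Fin k → MPoly n} (hp : AllDeg d p) :
    1 - δ ≤ (theTree d L K p).leafProb NoFail := by
  have h1 := fail_build_sched hd (large_base hL hk hd) (rounds L K k d) hp (fun _ => none)
  have h2 := prob_bound h hL hk hd hδ
  unfold DTree.leafProb theTree
  linarith

theorem fine_isGood {τ ε δ : ℝ} {L K d : ℕ} (h : Approx τ ε δ L K) (hL : 1 ≤ L) (hk : 1 ≤ k)
    (hd : 1 ≤ d) (hτ : 0 < τ) (hε : 0 < ε) (hε' : ε < 1 / 4) {p : MPoly n}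
    (hp : Fine (base L k d) p) : IsGood 12 d τ ε p :=
  hp.imp (reg_isRegular h hk hd hτ) (skew_isSkewed h hL hk hd hε hε')

theorem exists_tree {τ ε δ : ℝ} {L K d : ℕ} (h : Approx τ ε δ L K) (hk : 1 ≤ k)
    (hd : 1 ≤ d) (hτ : 0 < τ) (hτ' : τ < 1 / 4) (hε : 0 < ε) (hε' : ε < 1 / 4)
    (hδ : 0 < δ) (hδ' : δ < 1 / 4) (p : Fin k → MPoly n) (hp : ∀ i, HasDegree d (p i)) :
    ∃ T : DTree n Unit, T.ReadOnce ∧ (T.depth : ℝ) ≤ depthBound 11 d k τ ε δ ∧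
      1 - δ ≤ T.leafProb (fun ρ _ => ∀ i, IsGood 12 d τ ε (restrict (p i) ρ)) := by
  have hL := h.one_le_left hτ hτ'
  refine ⟨(theTree d L K p).forget, DTree.readOnce_forget (readOnce_build _ _ _), ?_, ?_⟩
  · rw [DTree.depth_forget]
    refine le_trans ?_ (total_le_depthBound h hk hd hτ hτ' hε hε' hδ hδ')
    have := depth_build (base L k d) (sched (base L k d) k (rounds L K k d)) p
    exact_mod_cast this.trans (Nat.le_succ _)
  · refine (leafProb_theTree h hL hk hd hδ hp).trans (DTree.leafProb_forget
      ((forallLeaves_build _ p _).imp fun ρ a ha hnf i => ?_))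
    subst ha
    exact fine_isGood h hL hk hd hτ hε hε' (lab_ne_fail.1 (hnf i))

end PTFReg

namespace PTFReg

/-! ### Reasoning about programs -/

/-- The length of a program. -/
def Prog.size : Prog → ℕ
  | .skip => 0
  | .instr _ => 1
  | .seq P Q => P.size + Q.size
  | .ite _ P Q => P.size + Q.size + 1
  | .while _ P => P.size + 2

/-- The nesting depth of the loops. -/
def Prog.loops : Prog → ℕ
  | .skip => 0
  | .instr _ => 0
  | .seq P Q => max P.loops Q.loops
  | .ite _ P Q => max P.loops Q.loops
  | .while _ P => P.loops + 1

/-- The program halts in a state with `post`; the time bound holds if every loop runs for at most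
`X` iterations. -/
def Run (X : ℕ) (P : Prog) (s : State) (post : State → Prop) : Prop :=
  ∃ s' t, Exec P s s' t ∧ t ≤ P.size * X ^ P.loops ∧ post s'

/-- The instruction writes to the natural register `x`. -/
def Instr.wi : Instr → ℕ → Bool
  | iconst r _, x => r == x
  | iadd r _ _, x => r == x
  | isub r _ _, x => r == x
  | imul r _ _, x => r == x
  | iload r _, x => r == x
  | _, _ => false

/-- The instruction writes to the real register `x`. -/
def Instr.wr : Instr → ℕ → Bool
  | rconst r _, x => r == x
  | rofNat r _, x => r == x
  | radd r _ _, x => r == x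
  | rsub r _ _, x => r == x
  | rmul r _ _, x => r == x
  | rdiv r _ _, x => r == x
  | rload r _, x => r == x
  | _, _ => false

/-- The instruction writes to the memory for natural numbers. -/
def Instr.wim : Instr → Bool
  | istore _ _ => true
  | _ => false

/-- The instruction writes to the memory for real numbers. -/
def Instr.wrm : Instr → Bool
  | rstore _ _ => true
  | _ => false

/-- Some instruction of the program satisfies `f`. -/
def Prog.any (f : Instr → Bool) : Prog → Bool
  | .skip => false
  | .instr i => f i
  | .seq P Q => P.any f || Q.any f
  | .ite _ P Q => P.any f || Q.any f
  | .while _ P => P.any f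

/-- The program writes to the natural register `x`. -/
def Prog.wi (P : Prog) (x : ℕ) : Bool := P.any (fun i => i.wi x)

/-- The states agree except where `P` writes. -/
structure Frame (P : Prog) (s s' : State) : Prop where
  ir : ∀ x, P.wi x = false → s'.ireg x = s.ireg x
  rr : ∀ x, P.any (fun i => i.wr x) = false → s'.rreg x = s.rreg x
  im : P.any Instr.wim = false → s'.imem = s.imem
  rm : P.any Instr.wrm = false → s'.rmem = s.rmem

theorem Frame.refl (P : Prog) (s : State) : Frame P s s :=
  ⟨fun _ _ => rfl, fun _ _ => rfl, fun _ => rfl, fun _ => rfl⟩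

theorem Frame.trans {P : Prog} {s₁ s₂ s₃ : State} (h : Frame P s₁ s₂) (h' : Frame P s₂ s₃) :
    Frame P s₁ s₃ :=
  ⟨fun x hx => (h'.ir x hx).trans (h.ir x hx), fun x hx => (h'.rr x hx).trans (h.rr x hx),
    fun hx => (h'.im hx).trans (h.im hx), fun hx => (h'.rm hx).trans (h.rm hx)⟩

theorem Frame.mono {P Q : Prog} {s s' : State} (h : Frame P s s')
    (hPQ : ∀ f, Q.any f = false → P.any f = false) : Frame Q s s' :=
  ⟨fun x hx => h.ir x (hPQ _ hx), fun x hx => h.rr x (hPQ _ hx),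
    fun hx => h.im (hPQ _ hx), fun hx => h.rm (hPQ _ hx)⟩

theorem Frame.instr (i : Instr) (s : State) : Frame (.instr i) s (i.run s) := by
  constructor
  · intro x hx
    cases i <;> simp [Prog.wi, Prog.any, Instr.wi] at hx <;>
      first | rfl | exact Function.update_of_ne (Ne.symm hx) _ _
  · intro x hx
    cases i <;> simp [Prog.any, Instr.wr] at hx <;>
      first | rfl | exact Function.update_of_ne (Ne.symm hx) _ _
  · intro hx
    cases i <;> simp [Prog.any, Instr.wim] at hx <;> rfl
  · intro hx
    cases i <;> simp [Prog.any, Instr.wrm] at hx <;> rfl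

/-- The frame is syntactic and decidable, so that the preservation of a register by a concrete
program is settled by evaluation. -/
theorem Exec.frame {P : Prog} {s s' : State} {t : ℕ} (h : Exec P s s' t) : Frame P s s' := by
  induction h with
  | skip s => exact Frame.refl _ _
  | instr i s => exact Frame.instr i s
  | seq _ _ h1 h2 =>
    exact (h1.mono fun f hf => by simp [Prog.any] at hf; exact hf.1).trans
      (h2.mono fun f hf => by simp [Prog.any] at hf; exact hf.2)
  | iteTrue _ _ h1 => exact h1.mono fun f hf => by simp [Prog.any] at hf; exact hf.1
  | iteFalse _ _ h1 => exact h1.mono fun f hf => by simp [Prog.any] at hf; exact hf.2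
  | whileTrue _ _ _ h1 h2 =>
    refine Frame.trans ?_ h2
    exact h1.mono fun f hf => hf
  | whileFalse _ => exact Frame.refl _ _

theorem Run.mono {X : ℕ} {P : Prog} {s : State} {p q : State → Prop} (h : Run X P s p)
    (hpq : ∀ s', Frame P s s' → p s' → q s') : Run X P s q := by
  obtain ⟨s', t, h1, h2, h3⟩ := h
  exact ⟨s', t, h1, h2, hpq s' h1.frame h3⟩

theorem Run.skip {X : ℕ} {s : State} {p : State → Prop} (h : p s) : Run X .skip s p :=
  ⟨s, 0, .skip s, Nat.zero_le _, h⟩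

theorem Run.instr {X : ℕ} {i : Instr} {s : State} {p : State → Prop} (h : p (i.run s)) :
    Run X (.instr i) s p :=
  ⟨_, 1, .instr i s, by simp [Prog.size, Prog.loops], h⟩

theorem Run.seq {X : ℕ} [hX : NeZero X] {P Q : Prog} {s : State} {p : State → Prop}
    (h : Run X P s (fun s' => Run X Q s' p)) : Run X (.seq P Q) s p := by
  obtain ⟨s', t, h1, h2, s'', t', h3, h4, h5⟩ := h
  refine ⟨s'', t + t', .seq h1 h3, ?_, h5⟩
  have hX1 : 1 ≤ X := Nat.one_le_iff_ne_zero.2 hX.out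
  have g1 : X ^ P.loops ≤ X ^ (Prog.seq P Q).loops := Nat.pow_le_pow_right hX1 (le_max_left _ _)
  have g2 : X ^ Q.loops ≤ X ^ (Prog.seq P Q).loops := Nat.pow_le_pow_right hX1 (le_max_right _ _)
  simp only [Prog.size, add_mul]
  exact add_le_add (h2.trans (Nat.mul_le_mul_left _ g1)) (h4.trans (Nat.mul_le_mul_left _ g2))

theorem Run.ite {X : ℕ} [hX : NeZero X] {c : Test} {P Q : Prog} {s : State} {p : State → Prop}
    (h1 : c.Holds s → Run X P s p) (h2 : ¬ c.Holds s → Run X Q s p) :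
    Run X (.ite c P Q) s p := by
  have hX1 : 1 ≤ X := Nat.one_le_iff_ne_zero.2 hX.out
  have g1 : X ^ P.loops ≤ X ^ (Prog.ite c P Q).loops := Nat.pow_le_pow_right hX1 (le_max_left _ _)
  have g2 : X ^ Q.loops ≤ X ^ (Prog.ite c P Q).loops := Nat.pow_le_pow_right hX1 (le_max_right _ _)
  have g3 : 1 ≤ X ^ (Prog.ite c P Q).loops := Nat.one_le_pow _ _ hX1
  by_cases hc : c.Holds s
  · obtain ⟨s', t, a1, a2, a3⟩ := h1 hc
    refine ⟨s', t + 1, .iteTrue hc a1, ?_, a3⟩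
    simp only [Prog.size, add_mul, one_mul]
    have := a2.trans (Nat.mul_le_mul_left P.size g1)
    omega
  · obtain ⟨s', t, a1, a2, a3⟩ := h2 hc
    refine ⟨s', t + 1, .iteFalse hc a1, ?_, a3⟩
    simp only [Prog.size, add_mul, one_mul]
    have := a2.trans (Nat.mul_le_mul_left Q.size g2)
    omega

/-- The rule for loops with an invariant that contains a bound for the remaining iterations. -/
theorem Run.while {X : ℕ} [hX : NeZero X] {c : Test} {P : Prog} {s : State} {p : State → Prop}
    (I : ℕ → State → Prop) {m : ℕ} (hm : m ≤ X) (h0 : I m s)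
    (hbody : ∀ m s', Frame (.while c P) s s' → I m s' → c.Holds s' →
      Run X P s' (fun s'' => ∃ m' < m, I m' s''))
    (hexit : ∀ m s', Frame (.while c P) s s' → I m s' → ¬ c.Holds s' → p s') :
    Run X (.while c P) s p := by
  have hX1 : 1 ≤ X := Nat.one_le_iff_ne_zero.2 hX.out
  -- Strong induction, because the variant may drop by more than one, as in the main loop. The
  -- additional 1 is the last, failing test.
  have key : ∀ m s₁, Frame (.while c P) s s₁ → I m s₁ → ∃ s' t, Exec (.while c P) s₁ s' t ∧
      t ≤ m * (P.size * X ^ P.loops + 1) + 1 ∧ p s' := by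
    intro m
    induction m using Nat.strong_induction_on with
    | _ m ih =>
      intro s₁ hs hI
      by_cases hc : c.Holds s₁
      · obtain ⟨s₂, t, a1, a2, m', hm', hI'⟩ := hbody m s₁ hs hI hc
        obtain ⟨s₃, t', b1, b2, b3⟩ := ih m' hm' s₂ (hs.trans (a1.frame.mono fun f hf => hf)) hI'
        refine ⟨s₃, t + t' + 1, .whileTrue hc a1 b1, ?_, b3⟩
        have : (m' + 1) * (P.size * X ^ P.loops + 1) ≤ m * (P.size * X ^ P.loops + 1) :=
          Nat.mul_le_mul_right _ hm'
        rw [add_mul, one_mul] at this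
        omega
      · exact ⟨s₁, 1, .whileFalse hc, by omega, hexit m s₁ hs hI hc⟩
  obtain ⟨s', t, a1, a2, a3⟩ := key m s (Frame.refl _ _) h0
  refine ⟨s', t, a1, a2.trans ?_, a3⟩
  have h1 : 1 ≤ X ^ P.loops := Nat.one_le_pow _ _ hX1
  have h2 : X ≤ X ^ P.loops * X := Nat.le_mul_of_pos_left _ h1
  calc m * (P.size * X ^ P.loops + 1) + 1 ≤ X * (P.size * X ^ P.loops + 1) + 1 := by gcongr
    _ = P.size * (X ^ P.loops * X) + X + 1 := by ring
    _ ≤ P.size * (X ^ P.loops * X) + X ^ P.loops * X + X ^ P.loops * X := by gcongr; omega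
    _ = (Prog.while c P).size * X ^ (Prog.while c P).loops := by
      simp only [Prog.size, Prog.loops, pow_succ]; ring

/-- Sequential composition of a list of programs. -/
def seqs : List Prog → Prog
  | [] => .skip
  | P :: l => .seq P (seqs l)

theorem Run.nil {X : ℕ} {s : State} {p : State → Prop} (h : p s) : Run X (seqs []) s p :=
  Run.skip h

theorem Run.cons {X : ℕ} [NeZero X] {P : Prog} {l : List Prog} {s : State} {p : State → Prop}
    (h : Run X P s (fun s' => Run X (seqs l) s' p)) : Run X (seqs (P :: l)) s p :=
  Run.seq h

theorem Run.instr_cons {X : ℕ} [NeZero X] {i : Instr} {l : List Prog} {s : State}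
    {p : State → Prop} (h : Run X (seqs l) (i.run s) p) : Run X (seqs (.instr i :: l)) s p :=
  Run.seq (Run.instr h)

/-- The state with the natural register `i` set to `v`. -/
def State.seti (s : State) (i v : ℕ) : State := { s with ireg := Function.update s.ireg i v }

/-- The loop in which register `i` runs from `0` to the value of register `r`; register `4` must
contain `1`. -/
def forLoop (i r : ℕ) (P : Prog) : Prog :=
  .seq (.instr (.iconst i 0)) (.while (.ilt i r) (.seq P (.instr (.iadd i i 4))))

/-- The invariant is stated for the state after the increment of the counter. The Boolean hypothesis
says that the body leaves the counter, the bound and the constant 1 alone, and that these are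
different registers. -/
theorem Run.forLoop {X : ℕ} [NeZero X] {i r : ℕ} {P : Prog} {s : State} {p : State → Prop}
    (I : ℕ → State → Prop) {N : ℕ} (hN : s.ireg r = N) (hNX : N ≤ X) (h1 : s.ireg 4 = 1)
    (hw : (P.wi i || P.wi r || P.wi 4 || (i == r) || (i == 4)) = false) (h0 : I 0 (s.seti i 0))
    (hbody : ∀ m s', m < N → Frame (forLoop i r P) s s' → s'.ireg i = m → I m s' →
      Run X P s' (fun s'' => I (m + 1) (s''.seti i (m + 1))))
    (hexit : ∀ s', Frame (PTFReg.forLoop i r P) s s' → s'.ireg i = N → I N s' → p s') :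
    Run X (PTFReg.forLoop i r P) s p := by
  simp only [Bool.or_eq_false_iff, beq_eq_false_iff_ne] at hw
  obtain ⟨⟨⟨⟨w1, w2⟩, w3⟩, w4⟩, w5⟩ := hw
  have hf0 : Frame (PTFReg.forLoop i r P) s (s.seti i 0) :=
    (Frame.instr (.iconst i 0) s).mono fun f hf => by
      simp only [PTFReg.forLoop, Prog.any, Bool.or_eq_false_iff] at hf ⊢; exact hf.1
  refine Run.seq (Run.instr ?_)
  refine Run.while (fun m s' => ∃ q, q + m = N ∧ s'.ireg i = q ∧ s'.ireg r = N ∧ s'.ireg 4 = 1 ∧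
    I q s') (m := N) hNX ⟨0, by omega, ?_⟩ ?_ ?_
  · have e4 : (s.seti i 0).ireg 4 = 1 := by simp [State.seti, Ne.symm w5, h1]
    have er : (s.seti i 0).ireg r = N := by simp [State.seti, Ne.symm w4, hN]
    exact ⟨by simp [Instr.run], er, e4, h0⟩
  · rintro m s' hf ⟨q, hq, hi, hr, h4, hI⟩ hc
    have hc' : q < N := by simpa [Test.Holds, hi, hr] using hc
    have hf' : Frame (PTFReg.forLoop i r P) s s' := hf0.trans (hf.mono fun f hf => by
      simp only [PTFReg.forLoop, Prog.any, Bool.or_eq_false_iff] at hf ⊢; exact hf.2)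
    refine Run.seq ((hbody q s' hc' hf' hi hI).mono fun s'' hf2 hI2 => Run.instr ?_)
    have hi2 : s''.ireg i = q := (hf2.ir i w1).trans hi
    have hr2 : s''.ireg r = N := (hf2.ir r w2).trans hr
    have h42 : s''.ireg 4 = 1 := (hf2.ir 4 w3).trans h4
    have he : (Instr.iadd i i 4).run s'' = s''.seti i (q + 1) := by
      simp [Instr.run, State.seti, hi2, h42]
    rw [he]
    refine ⟨m - 1, by omega, q + 1, by omega, by simp [State.seti], ?_, ?_, hI2⟩
    · simp [State.seti, Ne.symm w4, hr2]
    · simp [State.seti, Ne.symm w5, h42]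
  · rintro m s' hf ⟨q, hq, hi, hr, h4, hI⟩ hc
    have hc' : ¬ q < N := by simpa [Test.Holds, hi, hr] using hc
    obtain rfl : q = N := by omega
    have hf' : Frame (PTFReg.forLoop i r P) s s' := hf0.trans (hf.mono fun f hf => by
      simp only [PTFReg.forLoop, Prog.any, Bool.or_eq_false_iff] at hf ⊢; exact hf.2)
    exact hexit s' hf' hi hI

end PTFReg

namespace PTFReg

variable {n k : ℕ}

/-! ### Codes of tuples -/

theorem card_tupleSet_le (n d e : ℕ) : (tupleSet n d e).card ≤ d := by
  have h : tupleSet n d e ⊆ (Finset.univ : Finset (Fin d)).biUnion fun j =>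
      nameSet n (e / (n + 1) ^ (j : ℕ) % (n + 1)) := by
    intro v hv
    obtain ⟨j, hj⟩ := (Finset.mem_filter.1 hv).2
    simp only [Finset.mem_biUnion, Finset.mem_univ, true_and]
    exact ⟨j, by simp [nameSet, hj]⟩
  refine (Finset.card_le_card h).trans (Finset.card_biUnion_le.trans ?_)
  have h1 : ∀ w, (nameSet n w).card ≤ 1 := by
    intro w
    rw [Finset.card_le_one]
    intro a ha b hb
    simp only [nameSet, Finset.mem_filter, Finset.mem_univ, true_and] at ha hb
    exact Fin.ext (by omega)
  refine (Finset.sum_le_sum fun j _ => h1 _).trans ?_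
  simp

theorem exists_tupleSet {d : ℕ} {S : Finset (Fin n)} (h : S.card ≤ d) :
    ∃ e < (n + 1) ^ d, tupleSet n d e = S := by
  set l := S.toList with hl
  have hlen : l.length = S.card := Finset.length_toList S
  set f : Fin d → Fin (n + 1) := fun j => if hj : (j : ℕ) < l.length then l[(j:ℕ)].succ else 0
    with hf
  refine ⟨finFunctionFinEquiv f, (finFunctionFinEquiv f).2, ?_⟩
  have hdig : ∀ j : Fin d, (finFunctionFinEquiv f : ℕ) / (n + 1) ^ (j : ℕ) % (n + 1) = f j := by
    intro j
    have := congrFun (finFunctionFinEquiv.symm_apply_apply f) j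
    rw [← finFunctionFinEquiv_symm_apply_val, this]
  ext v
  simp only [tupleSet, Finset.mem_filter, Finset.mem_univ, true_and, hdig]
  constructor
  · rintro ⟨j, hj⟩
    rw [hf] at hj
    simp only at hj
    split_ifs at hj with h'
    · have : l[(j:ℕ)] = v := Fin.ext (by simpa using hj)
      rw [← Finset.mem_toList, ← hl, ← this]
      exact List.getElem_mem _
    · simp at hj
  · intro hv
    rw [← Finset.mem_toList, ← hl] at hv
    obtain ⟨j, hj, hjv⟩ := List.getElem_of_mem hv
    refine ⟨⟨j, by omega⟩, ?_⟩
    simp [hf, hj, hjv]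

/-- The last code less than `m` of the set `S`, or `(n + 1) ^ d`. -/
def repUpTo (d : ℕ) (S : Finset (Fin n)) : ℕ → ℕ
  | 0 => (n + 1) ^ d
  | m + 1 => if tupleSet n d m = S then m else repUpTo d S m

/-- A code of the set `S`, or `(n + 1) ^ d`. -/
def rep (d : ℕ) (S : Finset (Fin n)) : ℕ := repUpTo d S ((n + 1) ^ d)

theorem repUpTo_spec (d : ℕ) (S : Finset (Fin n)) (m : ℕ) :
    (repUpTo d S m < m ∧ tupleSet n d (repUpTo d S m) = S) ∨
      (repUpTo d S m = (n + 1) ^ d ∧ ∀ e < m, tupleSet n d e ≠ S) := by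
  induction m with
  | zero => right; simp [repUpTo]
  | succ m ih =>
    unfold repUpTo
    split_ifs with h
    · left; exact ⟨by omega, h⟩
    · rcases ih with ⟨h1, h2⟩ | ⟨h1, h2⟩
      · left; exact ⟨by omega, h2⟩
      · right
        refine ⟨h1, fun e he => ?_⟩
        rcases Nat.lt_or_ge e m with h' | h'
        · exact h2 e h'
        · obtain rfl : e = m := by omega
          exact h

theorem rep_of_card_le {d : ℕ} {S : Finset (Fin n)} (h : S.card ≤ d) :
    rep d S < (n + 1) ^ d ∧ tupleSet n d (rep d S) = S := by
  rcases repUpTo_spec d S ((n + 1) ^ d) with h1 | ⟨_, h2⟩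
  · exact h1
  · obtain ⟨e, he, h3⟩ := exists_tupleSet h
    exact absurd h3 (h2 e he)

theorem rep_of_lt_card {d : ℕ} {S : Finset (Fin n)} (h : d < S.card) : rep d S = (n + 1) ^ d := by
  rcases repUpTo_spec d S ((n + 1) ^ d) with h1 | ⟨h2, _⟩
  · have := card_tupleSet_le n d (repUpTo d S ((n + 1) ^ d))
    rw [h1.2] at this
    omega
  · exact h2

/-- Many tuples name the same set, and each monomial must be counted once. The condition holds
exactly if `e` is the chosen code of its set and this set contains the variable named `w`: otherwise
the union is another set, or is too large and gets the invalid code. -/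
theorem sum_codes {d : ℕ} {p : MPoly n} (hp : HasDegree d p) (w : ℕ) :
    ∑ e ∈ Finset.range ((n + 1) ^ d),
      (if rep d (tupleSet n d e ∪ nameSet n w) = e then p (tupleSet n d e) ^ 2 else 0)
      = sumSq p w := by
  have h1 : sumSq p w = ∑ S : Finset (Fin n) with nameSet n w ⊆ S ∧ S.card ≤ d, p S ^ 2 := by
    unfold sumSq
    symm
    refine Finset.sum_subset (fun S hS => ?_) fun S hS hS2 => ?_
    · simp at hS ⊢; exact hS.1
    · simp at hS hS2
      rw [hp S (hS2 hS)]; norm_num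
  rw [h1, ← Finset.sum_filter]
  refine Finset.sum_nbij' (fun e => tupleSet n d e) (fun S => rep d S) ?_ ?_ ?_ ?_ ?_
  · intro e he
    obtain ⟨he1, he2⟩ := Finset.mem_filter.1 he
    have he1 := Finset.mem_range.1 he1
    simp only [Finset.mem_filter, Finset.mem_univ, true_and]
    refine ⟨?_, card_tupleSet_le _ _ _⟩
    rcases Nat.lt_or_ge d (tupleSet n d e ∪ nameSet n w).card with h | h
    · rw [rep_of_lt_card h] at he2; omega
    · have := (rep_of_card_le h).2
      rw [he2] at this
      rw [this]
      exact Finset.subset_union_right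
  · intro S hS
    simp only [Finset.mem_filter, Finset.mem_univ, true_and, Finset.mem_range] at hS ⊢
    have := rep_of_card_le hS.2
    refine ⟨this.1, ?_⟩
    rw [this.2, Finset.union_eq_left.2 hS.1]
  · intro e he
    obtain ⟨he1, he2⟩ := Finset.mem_filter.1 he
    have he1 := Finset.mem_range.1 he1
    rcases Nat.lt_or_ge d (tupleSet n d e ∪ nameSet n w).card with h | h
    · rw [rep_of_lt_card h] at he2; omega
    · have := (rep_of_card_le h).2
      rw [he2] at this
      rw [← this] at he2
      exact he2
  · intro S hS
    simp only [Finset.mem_filter, Finset.mem_univ, true_and] at hS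
    exact (rep_of_card_le hS.2).2
  · intro e _
    rfl

/-- Substitution expressed through codes alone: equal chosen codes mean that `v` is already in the
set, and the invalid code (n+1)^d means that adding `v` exceeds the degree, where the coefficient is
zero. -/
theorem fix_code {d : ℕ} {p : MPoly n} (hp : HasDegree d p) (v : Fin n) (σ : ℤˣ) (e : ℕ) :
    fix v σ p (tupleSet n d e) =
      if rep d (tupleSet n d e ∪ nameSet n (v + 1)) = rep d (tupleSet n d e ∪ nameSet n 0) then 0
      else if rep d (tupleSet n d e ∪ nameSet n (v + 1)) = (n + 1) ^ d then p (tupleSet n d e)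
      else p (tupleSet n d e) + ((σ : ℤ) : ℝ) *
        p (tupleSet n d (rep d (tupleSet n d e ∪ nameSet n (v + 1)))) := by
  rw [nameSet_zero, nameSet_succ, Finset.union_empty, Finset.union_singleton]
  set T := tupleSet n d e
  have hT : T.card ≤ d := card_tupleSet_le n d e
  have h1 := rep_of_card_le hT
  unfold fix
  by_cases hv : v ∈ T
  · simp [hv]
  · have hne : insert v T ≠ T := fun h => hv (h ▸ Finset.mem_insert_self v T)
    rcases Nat.lt_or_ge d (insert v T).card with h | h
    · rw [rep_of_lt_card h, if_neg hv, if_neg (by omega), if_pos rfl, hp _ h]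
      simp
    · have h2 := rep_of_card_le h
      rw [if_neg hv, if_neg, if_neg (by omega), h2.2]
      intro h'
      rw [h', h1.2] at h2
      exact hne h2.2.symm

theorem length_table (d : ℕ) (p : MPoly n) : (table d p).length = (n + 1) ^ d := by
  simp [table]

theorem length_tables (d : ℕ) (P : Fin k → MPoly n) :
    (tables d P).length = k * (n + 1) ^ d := by
  unfold tables
  rw [List.length_flatten, List.map_ofFn]
  have : (List.length ∘ fun i => table d (P i)) = fun _ => (n + 1) ^ d := by
    funext i; exact length_table d (P i)
  rw [this, List.sum_ofFn]
  simp

theorem stores_nil {β : Type} (mem : ℕ → β) (a : ℕ) : Stores mem a [] := by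
  intro j h; simp at h

theorem stores_append {β : Type} {mem : ℕ → β} {a : ℕ} {l₁ l₂ : List β} :
    Stores mem a (l₁ ++ l₂) ↔ Stores mem a l₁ ∧ Stores mem (a + l₁.length) l₂ := by
  constructor
  · intro h
    refine ⟨fun j hj => ?_, fun j hj => ?_⟩
    · rw [h j (by simp; omega), List.getElem_append_left hj]
    · rw [add_assoc, h (l₁.length + j) (by simp; omega), List.getElem_append_right (by omega)]
      simp
  · rintro ⟨h1, h2⟩ j hj
    rcases Nat.lt_or_ge j l₁.length with h | h
    · rw [h1 j h, List.getElem_append_left h]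
    · rw [List.getElem_append_right h, ← h2 _ (by simp at hj; omega), add_assoc,
        Nat.add_sub_cancel' h]

theorem stores_cons {β : Type} {mem : ℕ → β} {a : ℕ} {x : β} {l : List β} :
    Stores mem a (x :: l) ↔ mem a = x ∧ Stores mem (a + 1) l := by
  rw [← List.singleton_append, stores_append]
  simp [Stores]

theorem Stores.congr {β : Type} {mem mem' : ℕ → β} {a : ℕ} {l : List β} (h : Stores mem a l)
    (hm : ∀ x, a ≤ x → x < a + l.length → mem' x = mem x) : Stores mem' a l := by
  intro j hj
  rw [hm _ (by omega) (by omega), h j hj]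

theorem stores_table {mem : ℕ → ℝ} {a d : ℕ} {p : MPoly n} :
    Stores mem a (table d p) ↔ ∀ e < (n + 1) ^ d, mem (a + e) = p (tupleSet n d e) := by
  constructor
  · intro h e he
    rw [h e (by rwa [length_table])]
    simp [table]
  · intro h e he
    rw [length_table] at he
    rw [h e he]
    simp [table]

theorem stores_flatten_ofFn {β : Type} {mem : ℕ → β} {a m k : ℕ} {f : Fin k → List β}
    (hf : ∀ i, (f i).length = m) :
    Stores mem a (List.ofFn f).flatten ↔ ∀ i : Fin k, Stores mem (a + i * m) (f i) := by
  induction k generalizing a with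
  | zero => simp [stores_nil]
  | succ k ih =>
    rw [List.ofFn_succ, List.flatten_cons, stores_append, ih (fun i => hf _), Fin.forall_fin_succ,
      hf 0]
    simp only [Fin.val_zero, zero_mul, add_zero, Fin.val_succ]
    refine and_congr Iff.rfl (forall_congr' fun i => ?_)
    rw [show a + m + (i:ℕ) * m = a + ((i:ℕ) + 1) * m by ring]

theorem stores_tables {mem : ℕ → ℝ} {a d : ℕ} {P : Fin k → MPoly n} :
    Stores mem a (tables d P) ↔ ∀ i : Fin k, ∀ e < (n + 1) ^ d,
      mem (a + i * (n + 1) ^ d + e) = P i (tupleSet n d e) := by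
  unfold tables
  rw [stores_flatten_ofFn (m := (n + 1) ^ d) (fun i => length_table d (P i))]
  exact forall_congr' fun i => stores_table

end PTFReg

namespace PTFReg

variable {n k : ℕ}

/-! ### Programs for variances, influences and the choice of a variable. -/

abbrev Prog.iconst (r c : ℕ) : Prog := .instr (.iconst r c)
abbrev Prog.iadd (r a b : ℕ) : Prog := .instr (.iadd r a b)
abbrev Prog.isub (r a b : ℕ) : Prog := .instr (.isub r a b)
abbrev Prog.imul (r a b : ℕ) : Prog := .instr (.imul r a b)
abbrev Prog.iload (r a : ℕ) : Prog := .instr (.iload r a)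
abbrev Prog.istore (a b : ℕ) : Prog := .instr (.istore a b)
abbrev Prog.rconst (r : ℕ) (c : ℤ) : Prog := .instr (.rconst r c)
abbrev Prog.rofNat (r a : ℕ) : Prog := .instr (.rofNat r a)
abbrev Prog.radd (r a b : ℕ) : Prog := .instr (.radd r a b)
abbrev Prog.rsub (r a b : ℕ) : Prog := .instr (.rsub r a b)
abbrev Prog.rmul (r a b : ℕ) : Prog := .instr (.rmul r a b)
abbrev Prog.rdiv (r a b : ℕ) : Prog := .instr (.rdiv r a b)
abbrev Prog.rload (r a : ℕ) : Prog := .instr (.rload r a)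
abbrev Prog.rstore (a b : ℕ) : Prog := .instr (.rstore a b)

/-- The row of the insertion table at address `a` is correct for codes and names. -/
def InsTable (n d : ℕ) (mem : ℕ → ℕ) (a : ℕ) : Prop :=
  ∀ e < (n + 1) ^ d, ∀ w ≤ n, mem (a + e * (n + 1) + w) = rep d (tupleSet n d e ∪ nameSet n w)

/-- The sum of the squared coefficients of the monomials that contain the variable named by
register `31`, for the table at the address in register `30`. -/
def sumSqProg : Prog := seqs [
  .rconst 10 0, .iadd 33 10 31,
  forLoop 32 6 (seqs [
    .iload 34 33, .iadd 33 33 5,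
    .ite (.ile 34 32)
      (.ite (.ile 32 34)
        (seqs [.iadd 35 30 32, .rload 11 35, .rmul 11 11 11, .radd 10 10 11])
        .skip)
      .skip])]

theorem run_sumSq {X d : ℕ} [NeZero X] (hX : (n + 1) ^ d ≤ X) {p : MPoly n} (hp : HasDegree d p)
    {s : State} (h4 : s.ireg 4 = 1) (h5 : s.ireg 5 = n + 1) (h6 : s.ireg 6 = (n + 1) ^ d)
    (hI : InsTable n d s.imem (s.ireg 10)) (hw : s.ireg 31 ≤ n)
    (hT : Stores s.rmem (s.ireg 30) (table d p)) :
    Run X sumSqProg s (fun s' => s'.rreg 10 = sumSq p (s.ireg 31)) := by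
  rw [stores_table] at hT
  unfold sumSqProg
  refine Run.instr_cons (Run.instr_cons (Run.cons ?_))
  refine Run.forLoop (fun m s' => s'.ireg 33 = s.ireg 10 + m * (n + 1) + s.ireg 31 ∧
    s'.rreg 10 = ∑ e ∈ Finset.range m,
      (if rep d (tupleSet n d e ∪ nameSet n (s.ireg 31)) = e then p (tupleSet n d e) ^ 2 else 0))
    (N := (n + 1) ^ d) (by simp [Instr.run, h6]) hX (by simp [Instr.run, h4]) (by decide)
    (by simp [Instr.run, State.seti]) ?_ ?_
  · rintro m s' hm hf hi ⟨h33, hacc⟩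
    have f5 : s'.ireg 5 = n + 1 := by rw [hf.ir 5 (by decide)]; simp [Instr.run, h5]
    have f30 : s'.ireg 30 = s.ireg 30 := by rw [hf.ir 30 (by decide)]; simp [Instr.run]
    have fim : s'.imem = s.imem := by rw [hf.im (by decide)]; simp [Instr.run]
    have frm : s'.rmem = s.rmem := by rw [hf.rm (by decide)]; simp [Instr.run]
    have hrep := hI m hm _ hw
    refine Run.instr_cons (Run.instr_cons (Run.cons (Run.ite (fun c1 => Run.ite (fun c2 => ?_)
      fun c2 => ?_) fun c1 => ?_)))
    · have e : rep d (tupleSet n d m ∪ nameSet n (s.ireg 31)) = m := by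
        simp [Test.Holds, Instr.run, h33, hi, fim, hrep] at c1 c2
        omega
      refine Run.instr_cons (Run.instr_cons (Run.instr_cons (Run.instr_cons
        (Run.nil (Run.nil ⟨?_, ?_⟩)))))
      · simp [Instr.run, State.seti, h33, f5]; ring
      · rw [Finset.sum_range_succ, if_pos e]
        simp [Instr.run, State.seti, hacc, frm, f30, hi, hT m hm]; ring
    · have e : rep d (tupleSet n d m ∪ nameSet n (s.ireg 31)) ≠ m := by
        simp [Test.Holds, Instr.run, h33, hi, fim, hrep] at c1 c2
        omega
      refine Run.skip (Run.nil ⟨?_, ?_⟩)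
      · simp [Instr.run, State.seti, h33, f5]; ring
      · rw [Finset.sum_range_succ, if_neg e]
        simp [Instr.run, State.seti, hacc]
    · have e : rep d (tupleSet n d m ∪ nameSet n (s.ireg 31)) ≠ m := by
        simp [Test.Holds, Instr.run, h33, hi, fim, hrep] at c1
        omega
      refine Run.skip (Run.nil ⟨?_, ?_⟩)
      · simp [Instr.run, State.seti, h33, f5]; ring
      · rw [Finset.sum_range_succ, if_neg e]
        simp [Instr.run, State.seti, hacc]
  · rintro s' - - ⟨-, h⟩
    exact Run.nil (h.trans (sum_codes hp _))

/-- The variance (real register `12`) of the polynomial with the table at the address in register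
`30`, its constant coefficient (`13`) and the square of it (`14`), and the name (register `37`) of
a variable of large influence, with respect to the number in register `36`. -/
def violProg : Prog := seqs [
  .iconst 31 0, sumSqProg, .rload 13 30, .rmul 14 13 13, .rsub 12 10 14, .iconst 37 0,
  .rofNat 15 36,
  forLoop 38 0 (seqs [
    .iadd 31 38 4, sumSqProg, .rmul 16 10 15,
    .ite (.rlt 12 16) (.iadd 37 31 3) .skip])]

theorem tupleSet_zero (n d : ℕ) : tupleSet n d 0 = ∅ := by
  ext v
  simp [tupleSet]

/-- Name 0 gives the sum of all squares, from which the square of the constant coefficient, stored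
first since code 0 is the empty set, is subtracted. The scan is upward and overwrites register 37,
so the largest violating name remains, as in `viol`. -/
theorem run_viol {X d : ℕ} [NeZero X] (hX : (n + 1) ^ d ≤ X) (hn : n ≤ X) {p : MPoly n}
    (hp : HasDegree d p) {s : State} (h0 : s.ireg 0 = n) (h3 : s.ireg 3 = 0) (h4 : s.ireg 4 = 1)
    (h5 : s.ireg 5 = n + 1) (h6 : s.ireg 6 = (n + 1) ^ d)
    (hI : InsTable n d s.imem (s.ireg 10))
    (hT : Stores s.rmem (s.ireg 30) (table d p)) :
    Run X violProg s (fun s' => s'.ireg 37 = viol (s.ireg 36) p n ∧ s'.rreg 12 = variance p ∧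
      s'.rreg 13 = p ∅ ∧ s'.rreg 14 = p ∅ ^ 2) := by
  have hT0 : s.rmem (s.ireg 30) = p ∅ := by
    have := stores_table.1 hT 0 (by positivity)
    rwa [tupleSet_zero] at this
  unfold violProg
  refine Run.instr_cons (Run.cons ((run_sumSq hX hp (by simp [Instr.run, h4])
    (by simp [Instr.run, h5]) (by simp [Instr.run, h6]) (by simpa [Instr.run] using hI)
    (by simp [Instr.run]) (by simpa [Instr.run] using hT)).mono fun s1 hf1 hp1 => ?_))
  have hp1' : s1.rreg 10 = sqNorm p := by rw [hp1]; simp [Instr.run, sumSq_zero]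
  have g0 : s1.ireg 0 = n := by rw [hf1.ir 0 (by decide)]; simp [Instr.run, h0]
  have g3 : s1.ireg 3 = 0 := by rw [hf1.ir 3 (by decide)]; simp [Instr.run, h3]
  have g4 : s1.ireg 4 = 1 := by rw [hf1.ir 4 (by decide)]; simp [Instr.run, h4]
  have g5 : s1.ireg 5 = n + 1 := by rw [hf1.ir 5 (by decide)]; simp [Instr.run, h5]
  have g6 : s1.ireg 6 = (n + 1) ^ d := by rw [hf1.ir 6 (by decide)]; simp [Instr.run, h6]
  have g10 : s1.ireg 10 = s.ireg 10 := by rw [hf1.ir 10 (by decide)]; simp [Instr.run]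
  have g30 : s1.ireg 30 = s.ireg 30 := by rw [hf1.ir 30 (by decide)]; simp [Instr.run]
  have g36 : s1.ireg 36 = s.ireg 36 := by rw [hf1.ir 36 (by decide)]; simp [Instr.run]
  have gim : s1.imem = s.imem := by rw [hf1.im (by decide)]; simp [Instr.run]
  have grm : s1.rmem = s.rmem := by rw [hf1.rm (by decide)]; simp [Instr.run]
  refine Run.instr_cons (Run.instr_cons (Run.instr_cons (Run.instr_cons (Run.instr_cons
    (Run.cons ?_)))))
  refine Run.forLoop (fun m s' => s'.ireg 37 = viol (s.ireg 36) p m ∧ s'.rreg 12 = variance p ∧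
      s'.rreg 13 = p ∅ ∧ s'.rreg 14 = p ∅ ^ 2 ∧ s'.rreg 15 = s.ireg 36)
    (N := n) (by simp [Instr.run, g0]) hn (by simp [Instr.run, g4]) (by decide) ?_ ?_ ?_
  · refine ⟨?_, ?_, ?_, ?_, ?_⟩
    · simp [Instr.run, State.seti, viol]
    · simp [Instr.run, State.seti, hp1', grm, g30, hT0, sqNorm_eq p]; ring
    · simp [Instr.run, State.seti, grm, g30, hT0]
    · simp [Instr.run, State.seti, grm, g30, hT0]; ring
    · simp [Instr.run, State.seti, g36]
  · rintro m s2 hm hf hi ⟨i1, i2, i3, i4, i5⟩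
    have k3 : s2.ireg 3 = 0 := by rw [hf.ir 3 (by decide)]; simp [Instr.run, g3]
    have k4 : s2.ireg 4 = 1 := by rw [hf.ir 4 (by decide)]; simp [Instr.run, g4]
    have k5 : s2.ireg 5 = n + 1 := by rw [hf.ir 5 (by decide)]; simp [Instr.run, g5]
    have k6 : s2.ireg 6 = (n + 1) ^ d := by rw [hf.ir 6 (by decide)]; simp [Instr.run, g6]
    have k10 : s2.ireg 10 = s.ireg 10 := by rw [hf.ir 10 (by decide)]; simp [Instr.run, g10]
    have k30 : s2.ireg 30 = s.ireg 30 := by rw [hf.ir 30 (by decide)]; simp [Instr.run, g30]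
    have kim : s2.imem = s.imem := by rw [hf.im (by decide)]; simp [Instr.run, gim]
    have krm : s2.rmem = s.rmem := by rw [hf.rm (by decide)]; simp [Instr.run, grm]
    refine Run.instr_cons (Run.cons ((run_sumSq hX hp (by simp [Instr.run, k4])
      (by simp [Instr.run, k5]) (by simp [Instr.run, k6]) (by simpa [Instr.run, kim, k10] using hI)
      (by simp [Instr.run, hi, k4]; omega)
      (by simpa [Instr.run, krm, k30] using hT)).mono fun s3 hf3 hp3 => ?_))
    have hp3' : s3.rreg 10 = sumSq p (m + 1) := by rw [hp3]; simp [Instr.run, hi, k4]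
    have l3 : s3.ireg 3 = 0 := by rw [hf3.ir 3 (by decide)]; simp [Instr.run, k3]
    have l31 : s3.ireg 31 = m + 1 := by rw [hf3.ir 31 (by decide)]; simp [Instr.run, hi, k4]
    have l37 : s3.ireg 37 = viol (s.ireg 36) p m := by
      rw [hf3.ir 37 (by decide)]; simp [Instr.run, i1]
    have l12 : s3.rreg 12 = variance p := by rw [hf3.rr 12 (by decide)]; simp [Instr.run, i2]
    have l13 : s3.rreg 13 = p ∅ := by rw [hf3.rr 13 (by decide)]; simp [Instr.run, i3]
    have l14 : s3.rreg 14 = p ∅ ^ 2 := by rw [hf3.rr 14 (by decide)]; simp [Instr.run, i4]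
    have l15 : s3.rreg 15 = s.ireg 36 := by rw [hf3.rr 15 (by decide)]; simp [Instr.run, i5]
    refine Run.instr_cons (Run.cons (Run.ite (fun c => Run.instr (Run.nil ?_))
      fun c => Run.skip (Run.nil ?_)))
    · have c' : variance p < sumSq p (m + 1) * s.ireg 36 := by
        simpa [Test.Holds, Instr.run, l12, hp3', l15] using c
      simp [Instr.run, State.seti, l31, l3, l12, l13, l14, l15, viol, c']
    · have c' : ¬ variance p < sumSq p (m + 1) * s.ireg 36 := by
        simpa [Test.Holds, Instr.run, l12, hp3', l15] using c
      simp [Instr.run, State.seti, l37, l12, l13, l14, l15, viol, c']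
  · rintro s' - - ⟨a1, a2, a3, a4, -⟩
    exact Run.nil ⟨a1, a2, a3, a4⟩

end PTFReg

namespace PTFReg

variable {n k : ℕ}

/-! ### Copying, labelling and substitution in the memory. -/

/-- The contents of the registers that hold constants in the main loop. -/
structure Ctx (n k d B IB SB OB RB : ℕ) (s : State) : Prop where
  r0 : s.ireg 0 = n
  r1 : s.ireg 1 = k
  r3 : s.ireg 3 = 0
  r4 : s.ireg 4 = 1
  r5 : s.ireg 5 = n + 1
  r6 : s.ireg 6 = (n + 1) ^ d
  r7 : s.ireg 7 = k * (n + 1) ^ d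
  r8 : s.ireg 8 = B
  r10 : s.ireg 10 = IB
  r12 : s.ireg 12 = SB
  r13 : s.ireg 13 = OB
  r14 : s.ireg 14 = RB

theorem Ctx.frame {d B IB SB OB RB : ℕ} {s s' : State} {P : Prog}
    (h : Ctx n k d B IB SB OB RB s) (hf : Frame P s s') (hP : ∀ x < 15, P.wi x = false) :
    Ctx n k d B IB SB OB RB s' := by
  constructor
  · rw [hf.ir _ (hP _ (by norm_num)), h.r0]
  · rw [hf.ir _ (hP _ (by norm_num)), h.r1]
  · rw [hf.ir _ (hP _ (by norm_num)), h.r3]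
  · rw [hf.ir _ (hP _ (by norm_num)), h.r4]
  · rw [hf.ir _ (hP _ (by norm_num)), h.r5]
  · rw [hf.ir _ (hP _ (by norm_num)), h.r6]
  · rw [hf.ir _ (hP _ (by norm_num)), h.r7]
  · rw [hf.ir _ (hP _ (by norm_num)), h.r8]
  · rw [hf.ir _ (hP _ (by norm_num)), h.r10]
  · rw [hf.ir _ (hP _ (by norm_num)), h.r12]
  · rw [hf.ir _ (hP _ (by norm_num)), h.r13]
  · rw [hf.ir _ (hP _ (by norm_num)), h.r14]

theorem Ctx.run {d B IB SB OB RB : ℕ} {s : State} {i : Instr}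
    (h : Ctx n k d B IB SB OB RB s) (hi : ∀ x < 15, i.wi x = false) :
    Ctx n k d B IB SB OB RB (i.run s) := h.frame (Frame.instr i s) hi

theorem InsTable.congr {d a : ℕ} {mem mem' : ℕ → ℕ} (h : InsTable n d mem a)
    (hm : ∀ x, a ≤ x → x < a + (n + 1) ^ d * (n + 1) → mem' x = mem x) : InsTable n d mem' a := by
  intro e he w hw
  have : e * (n + 1) + w < (n + 1) ^ d * (n + 1) := by
    calc e * (n + 1) + w < (e + 1) * (n + 1) := by rw [add_mul]; omega
      _ ≤ (n + 1) ^ d * (n + 1) := Nat.mul_le_mul_right _ he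
  rw [hm _ (by omega) (by omega), h e he w hw]

theorem block_lt {i m e Q : ℕ} (hi : i < m) (he : e < Q) : i * Q + e < m * Q := by
  calc i * Q + e < (i + 1) * Q := by rw [add_mul]; omega
    _ ≤ m * Q := Nat.mul_le_mul_right _ hi

/-- Copies a block of real numbers, of the length in register `7`, from the address in register
`30` to the address in register `31`. -/
def copyProg : Prog :=
  forLoop 32 7 (seqs [.iadd 33 30 32, .rload 11 33, .iadd 34 31 32, .rstore 34 11])

theorem run_copy {X K : ℕ} [NeZero X] (hX : K ≤ X) {s : State} (h4 : s.ireg 4 = 1)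
    (h7 : s.ireg 7 = K)
    (hd : s.ireg 30 + K ≤ s.ireg 31 ∨ s.ireg 31 + K ≤ s.ireg 30) :
    Run X copyProg s (fun s' => (∀ x < K, s'.rmem (s.ireg 31 + x) = s.rmem (s.ireg 30 + x)) ∧
      ∀ y, y < s.ireg 31 ∨ s.ireg 31 + K ≤ y → s'.rmem y = s.rmem y) := by
  unfold copyProg
  refine Run.forLoop (fun m s' => (∀ x < m, s'.rmem (s.ireg 31 + x) = s.rmem (s.ireg 30 + x)) ∧
      ∀ y, y < s.ireg 31 ∨ s.ireg 31 + m ≤ y → s'.rmem y = s.rmem y)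
    (N := K) h7 hX h4 (by decide) (by simp [State.seti]) ?_ ?_
  · rintro m s' hm hf hi ⟨i1, i2⟩
    have f30 : s'.ireg 30 = s.ireg 30 := hf.ir 30 (by decide)
    have f31 : s'.ireg 31 = s.ireg 31 := hf.ir 31 (by decide)
    have hsrc : s'.rmem (s.ireg 30 + m) = s.rmem (s.ireg 30 + m) := by
      rcases hd with h | h
      · exact i2 _ (by omega)
      · exact i2 _ (by omega)
    refine Run.instr_cons (Run.instr_cons (Run.instr_cons (Run.instr_cons (Run.nil ⟨?_, ?_⟩))))
    · intro x hx
      rcases Nat.lt_or_ge x m with h | h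
      · simp [Instr.run, State.seti, hi, f30, f31, Function.update_apply, hsrc]
        rw [if_neg (by omega)]; exact i1 x h
      · obtain rfl : x = m := by omega
        simp [Instr.run, State.seti, hi, f30, f31, hsrc]
    · intro y hy
      simp [Instr.run, State.seti, hi, f30, f31, Function.update_apply, hsrc]
      rw [if_neg (by omega)]; exact i2 y (by omega)
  · intro s' _ _ h
    exact h

/-- Writes the labels of the polynomials with tables at the address in register `40` to the
address after the one in register `21`; register `42` becomes `0` if no label is `fail`. -/
def labelProg : Prog := seqs [
  .iconst 42 0, .iadd 30 40 3, .iadd 43 21 4, .iadd 36 8 3, .rconst 17 0, .rofNat 18 8,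
  forLoop 39 1 (seqs [
    violProg, .rmul 19 18 12,
    .ite (.ile 37 3) (.iconst 44 0)
      (.ite (.rle 19 14) (.ite (.rle 17 13) (.iconst 44 1) (.iconst 44 2))
        (.seq (.iconst 44 3) (.iconst 42 1))),
    .istore 43 44, .iadd 43 43 4, .iadd 30 30 6])]

theorem run_label_aux {X : ℕ} [NeZero X] {B : ℕ} {p : MPoly n} {s : State} {post : State → Prop}
    (h3 : s.ireg 3 = 0) (h37 : s.ireg 37 = viol B p n) (h12 : s.rreg 19 = B * variance p)
    (h13 : s.rreg 13 = p ∅) (h14 : s.rreg 14 = p ∅ ^ 2) (h17 : s.rreg 17 = 0)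
    (hf : Fine B p → post (s.seti 44 (lab B p).code))
    (hnf : ¬ Fine B p → post ((s.seti 44 (lab B p).code).seti 42 1)) :
    Run X (.ite (.ile 37 3) (.iconst 44 0)
      (.ite (.rle 19 14) (.ite (.rle 17 13) (.iconst 44 1) (.iconst 44 2))
        (.seq (.iconst 44 3) (.iconst 42 1)))) s post := by
  refine Run.ite (fun c => Run.instr ?_) fun c => Run.ite (fun c2 => Run.ite (fun c3 => Run.instr ?_)
    fun c3 => Run.instr ?_) fun c2 => Run.seq (Run.instr (Run.instr ?_))
  · have hr : Reg B p := by
      simpa [Test.Holds, h3, h37, viol_eq_zero_iff] using c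
    have := hf (Or.inl hr)
    simpa [lab, hr, Label.code, Instr.run, State.seti] using this
  all_goals
    have hr : ¬ Reg B p := by
      simpa [Test.Holds, h3, h37, viol_eq_zero_iff] using c
    simp only [Test.Holds, h12, h14] at c2
  · have hs : Skew B p := c2
    have c3' : 0 ≤ p ∅ := by simpa [Test.Holds, h13, h17] using c3
    have := hf (Or.inr hs)
    simpa [lab, hr, hs, Label.code, sgn, c3', Instr.run,
      State.seti] using this
  · have hs : Skew B p := c2
    have c3' : ¬ 0 ≤ p ∅ := by simpa [Test.Holds, h13, h17] using c3
    have := hf (Or.inr hs)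
    simpa [lab, hr, hs, Label.code, sgn, c3', Instr.run,
      State.seti] using this
  · have hs : ¬ Skew B p := c2
    have := hnf (by rintro (h | h) <;> contradiction)
    simpa [lab, hr, hs, Label.code, Instr.run, State.seti] using this

/-- The labels are written ahead of the output pointer, whose own cell stays free for the mark of a
leaf or a node. They count as output only if the entry turns out to be a leaf; otherwise later
output overwrites them. -/
theorem run_label {X d B IB SB OB RB : ℕ} [NeZero X] (hX : (n + 1) ^ d ≤ X) (hn : n ≤ X)
    (hk : k ≤ X) {P : Fin k → MPoly n} (hP : AllDeg d P) {s : State}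
    (hc : Ctx n k d B IB SB OB RB s) (hI : InsTable n d s.imem IB)
    (hIB : IB + (n + 1) ^ d * (n + 1) ≤ s.ireg 21)
    (hT : Stores s.rmem (s.ireg 40) (tables d P)) :
    Run X labelProg s (fun s' =>
      Stores s'.imem (s.ireg 21 + 1) (List.ofFn fun i => (lab B (P i)).code) ∧
      (∀ x ≤ s.ireg 21, s'.imem x = s.imem x) ∧
      (s'.ireg 42 = 0 ↔ ∀ i, Fine B (P i))) := by
  rw [stores_tables] at hT
  unfold labelProg
  refine Run.instr_cons (Run.instr_cons (Run.instr_cons (Run.instr_cons (Run.instr_cons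
    (Run.instr_cons (Run.cons ?_))))))
  have hc0 := (((((hc.run (i := .iconst 42 0) (by decide)).run (i := .iadd 30 40 3) (by decide)).run
    (i := .iadd 43 21 4) (by decide)).run (i := .iadd 36 8 3) (by decide)).run
    (i := .rconst 17 0) (by decide)).run (i := .rofNat 18 8) (by decide)
  refine Run.forLoop (fun m s' => s'.ireg 30 = s.ireg 40 + m * (n + 1) ^ d ∧
      s'.ireg 43 = s.ireg 21 + 1 + m ∧
      (∀ i : Fin k, (i : ℕ) < m → s'.imem (s.ireg 21 + 1 + i) = (lab B (P i)).code) ∧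
      (∀ x ≤ s.ireg 21, s'.imem x = s.imem x) ∧
      (s'.ireg 42 = 0 ↔ ∀ i : Fin k, (i : ℕ) < m → Fine B (P i)))
    (N := k) hc0.r1 hk hc0.r4 (by decide) ?_ ?_ ?_
  · simp [Instr.run, State.seti, hc.r3, hc.r4]
  · rintro m s1 hm hf hi ⟨i30, i43, ilab, iim, i42⟩
    have c1 := hc0.frame hf (by decide)
    have f36 : s1.ireg 36 = B := by rw [hf.ir 36 (by decide)]; simp [Instr.run, hc.r8, hc.r3]
    have f17 : s1.rreg 17 = 0 := by rw [hf.rr 17 (by decide)]; simp [Instr.run]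
    have f18 : s1.rreg 18 = B := by rw [hf.rr 18 (by decide)]; simp [Instr.run, hc.r8]
    have frm : s1.rmem = s.rmem := by rw [hf.rm (by decide)]; simp [Instr.run]
    have hI1 : InsTable n d s1.imem (s1.ireg 10) := by
      rw [c1.r10]; exact hI.congr fun x _ hx => iim x (by omega)
    refine Run.cons ((run_viol hX hn (hP ⟨m, hm⟩) c1.r0 c1.r3 c1.r4 c1.r5 c1.r6 hI1
      (by rw [stores_table, i30, frm]; exact hT ⟨m, hm⟩)).mono ?_)
    rintro s2 hf2 ⟨a37, a12, a13, a14⟩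
    rw [f36] at a37
    have c2 := c1.frame hf2 (by decide)
    have g17 : s2.rreg 17 = 0 := by rw [hf2.rr 17 (by decide), f17]
    have g18 : s2.rreg 18 = B := by rw [hf2.rr 18 (by decide), f18]
    have g30 : s2.ireg 30 = s.ireg 40 + m * (n + 1) ^ d := by rw [hf2.ir 30 (by decide), i30]
    have g43 : s2.ireg 43 = s.ireg 21 + 1 + m := by rw [hf2.ir 43 (by decide), i43]
    have g42 : s2.ireg 42 = s1.ireg 42 := hf2.ir 42 (by decide)
    have gim : s2.imem = s1.imem := hf2.im (by decide)
    refine Run.instr_cons (Run.cons (run_label_aux (B := B) (p := P ⟨m, hm⟩)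
      (by simp [Instr.run, c2.r3]) (by simp [Instr.run, a37])
      (by simp [Instr.run, g18, a12]) (by simp [Instr.run, a13]) (by simp [Instr.run, a14])
      (by simp [Instr.run, g17]) (fun hfine => ?_) (fun hfine => ?_)))
    all_goals
      refine Run.instr_cons (Run.instr_cons (Run.instr_cons (Run.nil ⟨?_, ?_, ?_, ?_, ?_⟩)))
      · simp [Instr.run, State.seti, g30, c2.r6]; ring
      · simp [Instr.run, State.seti, g43, c2.r4]; ring
      · intro i him
        rcases Nat.lt_or_ge (i : ℕ) m with h | h
        · have : (s.ireg 21 + 1 + i : ℕ) ≠ s.ireg 21 + 1 + m := by omega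
          simp [Instr.run, State.seti, g43, gim, Function.update_of_ne, h.ne, ilab i h]
        · obtain rfl : i = ⟨m, hm⟩ := Fin.ext (show (i : ℕ) = m by omega)
          simp [Instr.run, State.seti, g43]
      · intro x hx
        have : x ≠ s.ireg 21 + 1 + m := by omega
        simp [Instr.run, State.seti, g43, gim, Function.update_of_ne this, iim x hx]
    · simp [Instr.run, State.seti, g42, i42]
      constructor
      · intro h i him
        rcases Nat.lt_or_ge (i : ℕ) m with h' | h'
        · exact h i h'
        · obtain rfl : i = ⟨m, hm⟩ := Fin.ext (show (i : ℕ) = m by omega)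
          exact hfine
      · intro h i him
        exact h i (by omega)
    · simp [Instr.run, State.seti]
      exact ⟨⟨m, hm⟩, by simp, hfine⟩
  · rintro s' - - ⟨-, -, h1, h2, h3⟩
    refine Run.nil ⟨?_, h2, ?_⟩
    · intro j hj
      simp at hj
      simpa using h1 ⟨j, hj⟩ hj
    · rw [h3]
      exact ⟨fun h i => h i i.2, fun h i _ => h i⟩

/-- Writes the tables at the address in register `40`, with the variable named by register `37`
set to `-1` and to `1`, into the next two blocks. -/
def fixProg : Prog := seqs [
  .rconst 17 0, .iadd 50 40 7, .iadd 51 50 7, .iadd 52 40 3,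
  forLoop 53 1 (seqs [
    .iadd 54 10 3,
    forLoop 55 6 (seqs [
      .iload 56 54, .iadd 57 54 37, .iload 58 57, .iadd 54 54 5, .iadd 59 52 55, .rload 20 59,
      .isub 61 56 58, .isub 62 58 56, .iadd 61 61 62,
      .ite (.ile 61 3) (seqs [.rconst 21 0, .rconst 22 0])
        (.ite (.ile 6 58) (seqs [.radd 21 20 17, .radd 22 20 17])
          (seqs [.iadd 60 52 58, .rload 23 60, .rsub 21 20 23, .radd 22 20 23])),
      .rstore 50 21, .rstore 51 22, .iadd 50 50 4, .iadd 51 51 4]),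
    .iadd 52 52 6])]

/-- The three cases of `fix_code`. Register 61 holds the absolute difference of two codes, as the
sum of both truncated differences, so it vanishes exactly if the codes agree. -/
theorem run_fix_aux {X d : ℕ} [NeZero X] {p : MPoly n} (hp : HasDegree d p) (v : Fin n) (e : ℕ)
    {s : State} {post : State → Prop} (h6 : s.ireg 6 = (n + 1) ^ d) (h3 : s.ireg 3 = 0)
    (h58 : s.ireg 58 = rep d (tupleSet n d e ∪ nameSet n (v + 1)))
    (h61 : s.ireg 61 = (rep d (tupleSet n d e ∪ nameSet n 0)
      - rep d (tupleSet n d e ∪ nameSet n (v + 1)))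
      + (rep d (tupleSet n d e ∪ nameSet n (v + 1)) - rep d (tupleSet n d e ∪ nameSet n 0)))
    (h17 : s.rreg 17 = 0) (h20 : s.rreg 20 = p (tupleSet n d e))
    (ht : ∀ e < (n + 1) ^ d, s.rmem (s.ireg 52 + e) = p (tupleSet n d e))
    (hpost : ∀ s', (∀ x, x ≠ 60 → s'.ireg x = s.ireg x) → s'.imem = s.imem → s'.rmem = s.rmem →
      s'.rreg 21 = fix v (-1) p (tupleSet n d e) → s'.rreg 22 = fix v 1 p (tupleSet n d e) →
      s'.rreg 17 = 0 → post s') :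
    Run X (.ite (.ile 61 3) (seqs [.rconst 21 0, .rconst 22 0])
        (.ite (.ile 6 58) (seqs [.radd 21 20 17, .radd 22 20 17])
          (seqs [.iadd 60 52 58, .rload 23 60, .rsub 21 20 23, .radd 22 20 23]))) s post := by
  have hfix := fix_code hp v
  have hlt : rep d (tupleSet n d e ∪ nameSet n (v + 1)) ≤ (n + 1) ^ d := by
    rcases Nat.lt_or_ge d (tupleSet n d e ∪ nameSet n (v + 1)).card with h | h
    · exact (rep_of_lt_card h).le
    · exact (rep_of_card_le h).1.le
  refine Run.ite (fun c => ?_) fun c => Run.ite (fun c2 => ?_) fun c2 => ?_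
  · have c' : rep d (tupleSet n d e ∪ nameSet n (v + 1)) = rep d (tupleSet n d e ∪ nameSet n 0) := by
      simp only [Test.Holds, h61, h3] at c; omega
    refine Run.instr_cons (Run.instr_cons (Run.nil (hpost _ ?_ rfl rfl ?_ ?_ ?_)))
    · intro x _; simp [Instr.run]
    · simp [Instr.run, hfix, c']
    · simp [Instr.run, hfix, c']
    · simp [Instr.run, h17]
  all_goals
    have c' : rep d (tupleSet n d e ∪ nameSet n (v + 1)) ≠ rep d (tupleSet n d e ∪ nameSet n 0) := by
      simp only [Test.Holds, h61, h3] at c; omega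
    simp only [Test.Holds, h6, h58] at c2
  · have c2' : rep d (tupleSet n d e ∪ nameSet n (v + 1)) = (n + 1) ^ d := le_antisymm hlt c2
    refine Run.instr_cons (Run.instr_cons (Run.nil (hpost _ ?_ rfl rfl ?_ ?_ ?_)))
    · intro x _; simp [Instr.run]
    · rw [hfix, if_neg c', if_pos c2']; simp [Instr.run, h20, h17]
    · rw [hfix, if_neg c', if_pos c2']; simp [Instr.run, h20, h17]
    · simp [Instr.run, h17]
  · have c2' : rep d (tupleSet n d e ∪ nameSet n (v + 1)) ≠ (n + 1) ^ d := by omega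
    have ht' := ht _ (not_le.1 c2)
    refine Run.instr_cons (Run.instr_cons (Run.instr_cons (Run.instr_cons
      (Run.nil (hpost _ ?_ rfl rfl ?_ ?_ ?_)))))
    · intro x hx; simp [Instr.run, Function.update_of_ne hx]
    · rw [hfix, if_neg c', if_neg c2']; simp [Instr.run, h20, h58, ht']; ring
    · rw [hfix, if_neg c', if_neg c2']; simp [Instr.run, h20, h58, ht']
    · simp [Instr.run, h17]

theorem run_fix {X d B IB SB OB RB : ℕ} [NeZero X] (hX : (n + 1) ^ d ≤ X)
    (hk : k ≤ X) {P : Fin k → MPoly n} (hP : AllDeg d P) {s : State}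
    (hc : Ctx n k d B IB SB OB RB s) (hI : InsTable n d s.imem IB) (v : Fin n)
    (hv : s.ireg 37 = v + 1) {a : ℕ} (h40 : s.ireg 40 = a)
    (hT : Stores s.rmem a (tables d P)) :
    Run X fixProg s (fun s' =>
      Stores s'.rmem (a + k * (n + 1) ^ d) (tables d (fixAll v (-1) P)) ∧
      Stores s'.rmem (a + 2 * (k * (n + 1) ^ d)) (tables d (fixAll v 1 P)) ∧
      (∀ y, y < a + k * (n + 1) ^ d ∨ a + 3 * (k * (n + 1) ^ d) ≤ y → s'.rmem y = s.rmem y) ∧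
      s'.ireg 51 = a + 3 * (k * (n + 1) ^ d)) := by
  rw [stores_tables] at hT
  set Q := (n + 1) ^ d with hQ
  set K := k * Q with hK
  unfold fixProg
  refine Run.instr_cons (Run.instr_cons (Run.instr_cons (Run.instr_cons (Run.cons ?_))))
  have hc0 := (((hc.run (i := .rconst 17 0) (by decide)).run (i := .iadd 50 40 7) (by decide)).run
    (i := .iadd 51 50 7) (by decide)).run (i := .iadd 52 40 3) (by decide)
  refine Run.forLoop (fun m s' => s'.ireg 50 = a + K + m * Q ∧ s'.ireg 51 = a + 2 * K + m * Q ∧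
      s'.ireg 52 = a + m * Q ∧ s'.rreg 17 = 0 ∧
      (∀ i : Fin k, (i : ℕ) < m → ∀ e < Q,
        s'.rmem (a + K + i * Q + e) = fix v (-1) (P i) (tupleSet n d e) ∧
        s'.rmem (a + 2 * K + i * Q + e) = fix v 1 (P i) (tupleSet n d e)) ∧
      ∀ y, y < a + K ∨ a + 3 * K ≤ y → s'.rmem y = s.rmem y)
    (N := k) hc0.r1 hk hc0.r4 (by decide) ?_ ?_ ?_
  · refine ⟨?_, ?_, ?_, ?_, ?_, ?_⟩
    · simp [Instr.run, State.seti, h40, hc.r7, hK, hQ]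
    · simp [Instr.run, State.seti, h40, hc.r7, hK, hQ]; ring
    · simp [Instr.run, State.seti, h40, hc.r3]
    · simp [Instr.run, State.seti]
    · intro i hi; exact absurd hi (Nat.not_lt_zero _)
    · intro y _; simp [Instr.run, State.seti]
  · rintro m s1 hm hf hi ⟨i50, i51, i52, i17, iw, ifr⟩
    have c1 := hc0.frame hf (by decide)
    have f37 : s1.ireg 37 = v + 1 := by rw [hf.ir 37 (by decide)]; simp [Instr.run, hv]
    have fim : s1.imem = s.imem := by rw [hf.im (by decide)]; simp [Instr.run]
    have hmK : m * Q + Q ≤ K := by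
      rw [hK, ← Nat.succ_mul]; exact Nat.mul_le_mul_right _ hm
    refine Run.instr_cons (Run.cons ?_)
    have c1' := c1.run (i := .iadd 54 10 3) (by decide)
    refine Run.forLoop (fun q s' => s'.ireg 50 = a + K + m * Q + q ∧
        s'.ireg 51 = a + 2 * K + m * Q + q ∧ s'.ireg 54 = IB + q * (n + 1) ∧ s'.rreg 17 = 0 ∧
        (∀ i : Fin k, (i : ℕ) < m → ∀ e < Q,
          s'.rmem (a + K + i * Q + e) = fix v (-1) (P i) (tupleSet n d e) ∧
          s'.rmem (a + 2 * K + i * Q + e) = fix v 1 (P i) (tupleSet n d e)) ∧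
        (∀ e < q,
          s'.rmem (a + K + m * Q + e) = fix v (-1) (P ⟨m, hm⟩) (tupleSet n d e) ∧
          s'.rmem (a + 2 * K + m * Q + e) = fix v 1 (P ⟨m, hm⟩) (tupleSet n d e)) ∧
        ∀ y, y < a + K ∨ a + 3 * K ≤ y → s'.rmem y = s.rmem y)
      (N := Q) c1'.r6 hX c1'.r4 (by decide) ?_ ?_ ?_
    · refine ⟨?_, ?_, ?_, ?_, ?_, ?_, ?_⟩
      · simp [Instr.run, State.seti, i50]
      · simp [Instr.run, State.seti, i51]
      · simp [Instr.run, State.seti, c1.r10, c1.r3]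
      · simp [Instr.run, State.seti, i17]
      · simpa [Instr.run, State.seti] using iw
      · intro e he; exact absurd he (Nat.not_lt_zero _)
      · simpa [Instr.run, State.seti] using ifr
    · rintro q s2 hq hf2 hi2 ⟨j50, j51, j54, j17, jw, jw2, jfr⟩
      have c2 := c1'.frame hf2 (by decide)
      have g37 : s2.ireg 37 = v + 1 := by rw [hf2.ir 37 (by decide)]; simp [Instr.run, f37]
      have g52 : s2.ireg 52 = a + m * Q := by rw [hf2.ir 52 (by decide)]; simp [Instr.run, i52]
      have gim : s2.imem = s.imem := by rw [hf2.im (by decide)]; simp [Instr.run, fim]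
      have hsrc : ∀ e < Q, s2.rmem (a + m * Q + e) = P ⟨m, hm⟩ (tupleSet n d e) := by
        intro e he
        rw [jfr _ (by left; omega)]
        exact hT ⟨m, hm⟩ e he
      have t0 : s2.imem (IB + q * (n + 1)) = rep d (tupleSet n d q ∪ nameSet n 0) := by
        rw [gim]; exact hI q hq 0 (Nat.zero_le _)
      have tv : s2.imem (IB + q * (n + 1) + (v + 1))
          = rep d (tupleSet n d q ∪ nameSet n (v + 1)) := by
        rw [gim]; exact hI q hq (v + 1) (by omega)
      refine Run.instr_cons (Run.instr_cons (Run.instr_cons (Run.instr_cons (Run.instr_cons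
        (Run.instr_cons (Run.instr_cons (Run.instr_cons (Run.instr_cons (Run.cons
        (run_fix_aux (hP ⟨m, hm⟩) v q ?_ ?_ ?_ ?_ ?_ ?_ ?_ ?_))))))))))
      · simp [Instr.run, c2.r6]
      · simp [Instr.run, c2.r3]
      · simp [Instr.run, j54, g37, tv]
      · simp [Instr.run, j54, g37, tv, t0]
      · simp [Instr.run, j17]
      · simp [Instr.run, g52, hi2, hsrc q hq]
      · intro e he
        simp [Instr.run, g52, hsrc e he]
      · intro s3 b1 b2 b3 b21 b22 b17
        have e50 : s3.ireg 50 = a + K + m * Q + q := by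
          rw [b1 50 (by norm_num)]; simp [Instr.run, j50]
        have e51 : s3.ireg 51 = a + 2 * K + m * Q + q := by
          rw [b1 51 (by norm_num)]; simp [Instr.run, j51]
        have e54 : s3.ireg 54 = IB + (q + 1) * (n + 1) := by
          rw [b1 54 (by norm_num)]; simp [Instr.run, j54, c2.r5]; ring
        have e4 : s3.ireg 4 = 1 := by
          rw [b1 4 (by norm_num)]; simp [Instr.run, c2.r4]
        have erm : s3.rmem = s2.rmem := by rw [b3]; simp [Instr.run]
        refine Run.instr_cons (Run.instr_cons (Run.instr_cons (Run.instr_cons (Run.nil ?_))))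
        have hmem : ∀ y, y ≠ a + K + m * Q + q → y ≠ a + 2 * K + m * Q + q →
            (((Instr.iadd 51 51 4).run ((Instr.iadd 50 50 4).run ((Instr.rstore 51 22).run
            ((Instr.rstore 50 21).run s3)))).seti 55 (q + 1)).rmem y = s2.rmem y := by
          intro y h1 h2
          simp [Instr.run, State.seti, e50, e51, erm, Function.update_of_ne h1,
            Function.update_of_ne h2]
        refine ⟨?_, ?_, ?_, ?_, ?_, ?_, ?_⟩
        · simp [Instr.run, State.seti, e50, e4]; ring
        · simp [Instr.run, State.seti, e51, e4]; ring
        · simp [Instr.run, State.seti, e54]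
        · simp [Instr.run, State.seti, b17]
        · intro i him e he
          have h1 := block_lt him he
          have h2 : (i : ℕ) * Q + e < K := by omega
          rw [hmem _ (by omega) (by omega), hmem _ (by omega) (by omega)]
          exact jw i him e he
        · intro e he
          rcases Nat.lt_or_ge e q with h | h
          · rw [hmem _ (by omega) (by omega), hmem _ (by omega) (by omega)]
            exact jw2 e h
          · obtain rfl : e = q := by omega
            have hne : a + K + m * Q + e ≠ a + 2 * K + m * Q + e := by omega
            constructor
            · simp [Instr.run, State.seti, e50, e51, Function.update_of_ne hne, b21]
            · simp [Instr.run, State.seti, e50, e51, b22]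
        · intro y hy
          rw [hmem _ (by omega) (by omega)]
          exact jfr y hy
    · rintro s2 hf2 - ⟨j50, j51, -, j17, jw, jw2, jfr⟩
      have c2 := c1'.frame hf2 (by decide)
      have g52 : s2.ireg 52 = a + m * Q := by rw [hf2.ir 52 (by decide)]; simp [Instr.run, i52]
      refine Run.instr_cons (Run.nil ⟨?_, ?_, ?_, ?_, ?_, ?_⟩)
      · simp [Instr.run, State.seti, j50]; ring
      · simp [Instr.run, State.seti, j51]; ring
      · simp [Instr.run, State.seti, g52, c2.r6, ← hQ]; ring
      · simp [Instr.run, State.seti, j17]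
      · intro i him e he
        rcases Nat.lt_or_ge (i : ℕ) m with h | h
        · exact jw i h e he
        · obtain rfl : i = ⟨m, hm⟩ := Fin.ext (show (i : ℕ) = m by omega)
          exact jw2 e he
      · exact jfr
  · rintro s' - - ⟨-, h51, -, -, hw, hfr⟩
    refine Run.nil ⟨?_, ?_, hfr, by rw [h51, hK]; ring⟩
    · rw [stores_tables]
      exact fun i e he => (hw i i.2 e he).1
    · rw [stores_tables]
      exact fun i e he => (hw i i.2 e he).2

end PTFReg

namespace PTFReg

variable {n k : ℕ}

/-! ### Writing the tree in preorder with an explicit stack. -/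

/-- The entries of the list `W` are stored as pairs of numbers. -/
def SchedTable (mem : ℕ → ℕ) (a : ℕ) (W : List (Fin k × ℕ)) : Prop :=
  ∀ (x : ℕ) (h : x < W.length), mem (a + 2 * x) = (W[x].1 : ℕ) ∧ mem (a + 2 * x + 1) = W[x].2

theorem SchedTable.congr {a : ℕ} {W : List (Fin k × ℕ)} {mem mem' : ℕ → ℕ}
    (h : SchedTable mem a W) (hm : ∀ x, a ≤ x → x < a + 2 * W.length → mem' x = mem x) :
    SchedTable mem' a W := by
  intro x hx
  rw [hm _ (by omega) (by omega), hm _ (by omega) (by omega)]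
  exact h x hx

/-- The sizes of the memory areas. -/
structure Layout (n k d IB SB OB RB N : ℕ) : Prop where
  ib : N < IB
  sb : N < SB
  ins : IB + (n + 1) ^ d * (n + 1) ≤ OB
  sch : SB + 2 * N ≤ OB
  rb : (N + 2) * (k * (n + 1) ^ d) ≤ RB

/-- The stack of pending subtrees: for each, the number of steps left and the polynomials. -/
def StackOK (d N : ℕ) (im : ℕ → ℕ) (rm : ℕ → ℝ) : List (ℕ × (Fin k → MPoly n)) → Prop
  | [] => True
  | (r, P) :: l => im l.length = r ∧ Stores rm (l.length * (k * (n + 1) ^ d)) (tables d P) ∧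
      AllDeg d P ∧ l.length + r ≤ N ∧ StackOK d N im rm l

theorem StackOK.congr {d N : ℕ} {im im' : ℕ → ℕ} {rm rm' : ℕ → ℝ}
    {l : List (ℕ × (Fin k → MPoly n))} (h : StackOK d N im rm l)
    (h1 : ∀ x < l.length, im' x = im x)
    (h2 : ∀ y < l.length * (k * (n + 1) ^ d), rm' y = rm y) : StackOK d N im' rm' l := by
  induction l with
  | nil => trivial
  | cons a l ih =>
    obtain ⟨r, P⟩ := a
    obtain ⟨a1, a2, a3, a4, a5⟩ := h
    simp only [List.length_cons] at h1 h2
    rw [add_mul, one_mul] at h2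
    refine ⟨by rw [h1 _ (by omega), a1], a2.congr fun x _ hx => h2 x ?_, a3, a4,
      ih a5 (fun x hx => h1 x (by omega)) (fun y hy => h2 y (by omega))⟩
    rwa [length_tables] at hx

/-- The tree that is still to be written for an entry of the stack. -/
noncomputable def pending (B : ℕ) (W : List (Fin k × ℕ)) (x : ℕ × (Fin k → MPoly n)) :
    DTree n (LeafData n k) := build B (W.take x.1).reverse x.2

/-- A bound for the number of iterations that an entry of the stack requires. -/
def weight (l : List (ℕ × (Fin k → MPoly n))) : ℕ := (l.map fun x => 2 ^ (x.1 + 1) - 1).sum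

/-- The state of the main loop, with stack `l` and output `lN`, `lR`. -/
structure LoopInv (d B IB SB OB RB N : ℕ) (W : List (Fin k × ℕ))
    (l : List (ℕ × (Fin k → MPoly n))) (lN : List ℕ) (lR : List ℝ) (s : State) : Prop where
  ctx : Ctx n k d B IB SB OB RB s
  ins : InsTable n d s.imem IB
  sch : SchedTable s.imem SB W
  stack : StackOK d N s.imem s.rmem l
  outN : Stores s.imem OB lN
  outR : Stores s.rmem RB lR
  r20 : s.ireg 20 = l.length
  r21 : s.ireg 21 = OB + lN.length
  r22 : s.ireg 22 = RB + lR.length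

/-- Progress of the main loop. -/
def Next (d B IB SB OB RB N : ℕ) (W : List (Fin k × ℕ))
    (l : List (ℕ × (Fin k → MPoly n))) (lN : List ℕ) (lR : List ℝ) (s : State) : Prop :=
  ∃ (l' : List (ℕ × (Fin k → MPoly n))) (lN' : List ℕ) (lR' : List ℝ), LoopInv d B IB SB OB RB N W l' lN' lR' s ∧
    lN' ++ l'.flatMap (fun x => natCode (pending B W x))
      = lN ++ l.flatMap (fun x => natCode (pending B W x)) ∧
    lR' ++ l'.flatMap (fun x => realCode d (pending B W x))
      = lR ++ l.flatMap (fun x => realCode d (pending B W x)) ∧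
    weight l' < weight l

/-- Output of a leaf. -/
def leafProg : Prog := seqs [
  .istore 21 3, .iadd 21 21 4, .iadd 21 21 1, .iadd 30 40 3, .iadd 31 22 3, copyProg,
  .iadd 22 22 7, .isub 20 20 4]

theorem run_leaf {X d B IB SB OB RB N : ℕ} [NeZero X] (hX : k * (n + 1) ^ d ≤ X)
    {W : List (Fin k × ℕ)} (hW : W.length = N) (hL : Layout n k d IB SB OB RB N)
    {r : ℕ} {P : Fin k → MPoly n} {l : List (ℕ × (Fin k → MPoly n))} {lN : List ℕ} {lR : List ℝ}
    {s : State} (h : LoopInv d B IB SB OB RB N W ((r, P) :: l) lN lR s)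
    (hlab : Stores s.imem (s.ireg 21 + 1) (List.ofFn fun i => (lab B (P i)).code))
    (h40 : s.ireg 40 = l.length * (k * (n + 1) ^ d))
    (hp : pending B W (r, P) = .leaf (mkLeaf B P)) :
    Run X leafProg s (Next d B IB SB OB RB N W ((r, P) :: l) lN lR) := by
  obtain ⟨hc, hins, hsch, ⟨t1, t2, t3, t4, t5⟩, hoN, hoR, h20, h21, h22⟩ := h
  have hrb := hL.rb
  set K := k * (n + 1) ^ d with hK
  have hsl : (l.length + 2) * K ≤ RB :=
    (Nat.mul_le_mul_right K (by omega : l.length + 2 ≤ N + 2)).trans hrb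
  rw [add_mul] at hsl
  have c1 := ((((hc.run (i := .istore 21 3) (by decide)).run (i := .iadd 21 21 4) (by decide)).run
    (i := .iadd 21 21 1) (by decide)).run (i := .iadd 30 40 3) (by decide)).run
    (i := .iadd 31 22 3) (by decide)
  unfold leafProg
  refine Run.instr_cons (Run.instr_cons (Run.instr_cons (Run.instr_cons (Run.instr_cons
    (Run.cons ((run_copy hX c1.r4 c1.r7 (by
      left; simp [Instr.run, h40, h22, hc.r3]; omega)).mono ?_))))))
  rintro s1 hf ⟨p1, p2⟩
  have d1 := c1.frame hf (by decide)
  have e31 : ((Instr.iadd 31 22 3).run ((Instr.iadd 30 40 3).run ((Instr.iadd 21 21 1).run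
    ((Instr.iadd 21 21 4).run ((Instr.istore 21 3).run s))))).ireg 31 = RB + lR.length := by
    simp [Instr.run, h22, hc.r3]
  have e30 : ((Instr.iadd 31 22 3).run ((Instr.iadd 30 40 3).run ((Instr.iadd 21 21 1).run
    ((Instr.iadd 21 21 4).run ((Instr.istore 21 3).run s))))).ireg 30 = l.length * K := by
    simp [Instr.run, h40, hc.r3]
  rw [e31, e30] at p1
  rw [e31] at p2
  have f20 : s1.ireg 20 = l.length + 1 := by rw [hf.ir 20 (by decide)]; simp [Instr.run, h20]
  have f21 : s1.ireg 21 = OB + lN.length + 1 + k := by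
    rw [hf.ir 21 (by decide)]; simp [Instr.run, h21, hc.r4, hc.r1]
  have f22 : s1.ireg 22 = RB + lR.length := by rw [hf.ir 22 (by decide)]; simp [Instr.run, h22]
  have fim : s1.imem = Function.update s.imem (OB + lN.length) 0 := by
    rw [hf.im (by decide)]; simp [Instr.run, h21, hc.r3]
  have him : ∀ x, x ≠ OB + lN.length → s1.imem x = s.imem x := by
    intro x hx; rw [fim, Function.update_of_ne hx]
  have hrm : ∀ y, y < RB + lR.length → s1.rmem y = s.rmem y := by
    intro y hy
    rw [p2 y (by omega)]
    simp [Instr.run]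
  have i1 := hL.ins
  have i2 := hL.sch
  have i3 := hL.ib
  refine Run.instr_cons (Run.instr_cons (Run.nil
    ⟨l, lN ++ 0 :: List.ofFn (fun i => (lab B (P i)).code), lR ++ tables d P, ?_, ?_, ?_, ?_⟩))
  · refine ⟨(d1.run (by decide)).run (by decide), ?_, ?_, ?_, ?_, ?_, ?_, ?_, ?_⟩
    · exact hins.congr fun x _ hx => him x (by omega)
    · exact hsch.congr fun x _ hx => him x (by omega)
    · refine t5.congr (fun x hx => him x (by omega)) fun y hy => hrm y ?_
      change y < l.length * K at hy
      omega
    · change Stores s1.imem _ _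
      rw [stores_append, stores_cons]
      refine ⟨hoN.congr fun x _ hx => him x (by omega), by rw [fim]; simp, ?_⟩
      rw [h21] at hlab
      exact hlab.congr fun x hx _ => him x (by omega)
    · change Stores s1.rmem _ _
      rw [stores_append]
      refine ⟨hoR.congr fun x _ hx => hrm x (by omega), fun j hj => ?_⟩
      rw [length_tables] at hj
      rw [p1 j hj]
      simp only [Instr.run]
      exact t2 j (by rwa [length_tables])
    · simp [Instr.run, f20, d1.r4]
    · simp [Instr.run, f21]; ring
    · simp [Instr.run, f22, d1.r7, length_tables]; ring
  · rw [List.flatMap_cons, hp]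
    simp [natCode, mkLeaf]
  · rw [List.flatMap_cons, hp]
    simp [realCode, mkLeaf]
  -- The weight 2^(r+1) - 1 is the number of nodes of a complete binary tree of depth r; removing
  -- the entry lowers the sum.
  · have : 1 ≤ 2 ^ r := Nat.one_le_two_pow
    simp [weight, pow_succ]; omega

/-- Output of a node; the two subtrees are put on the stack. -/
def nodeProg : Prog := seqs [
  .istore 21 37, .iadd 21 21 4, .istore 20 41, fixProg, .isub 30 51 7, .iadd 31 40 3, copyProg,
  .iadd 20 20 4]

/-- The two restrictions are computed into the blocks above the top of the stack, and the one for
`1` is then copied down over the parent. The subtree for `-1` thus lies on top and is written first,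
as the preorder demands. The invariant `l.length + r ≤ N` bounds the height of the stack. -/
theorem run_node {X d B IB SB OB RB N : ℕ} [NeZero X] (hX : k * (n + 1) ^ d ≤ X)
    (hX' : (n + 1) ^ d ≤ X) (hk : k ≤ X)
    {W : List (Fin k × ℕ)} (hW : W.length = N) (hL : Layout n k d IB SB OB RB N)
    {r : ℕ} {P : Fin k → MPoly n} {l : List (ℕ × (Fin k → MPoly n))} {lN : List ℕ} {lR : List ℝ}
    {s : State} (hc : Ctx n k d B IB SB OB RB s) (hins : InsTable n d s.imem IB)
    (hsch : SchedTable s.imem SB W) (hst : StackOK d N s.imem s.rmem l)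
    (hT : Stores s.rmem (l.length * (k * (n + 1) ^ d)) (tables d P)) (hdeg : AllDeg d P)
    (hr : l.length + (r + 1) ≤ N) (htop : s.imem l.length = r)
    (hoN : Stores s.imem OB lN) (hoR : Stores s.rmem RB lR)
    (h20 : s.ireg 20 = l.length + 1) (h21 : s.ireg 21 = OB + lN.length)
    (h22 : s.ireg 22 = RB + lR.length) (h41 : s.ireg 41 = r)
    (h40 : s.ireg 40 = l.length * (k * (n + 1) ^ d)) {v : Fin n} (h37 : s.ireg 37 = v + 1)
    (hp : pending B W (r + 1, P)
      = .node v (pending B W (r, fixAll v (-1) P)) (pending B W (r, fixAll v 1 P))) :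
    Run X nodeProg s (Next d B IB SB OB RB N W ((r + 1, P) :: l) lN lR) := by
  have hrb := hL.rb
  have i1 := hL.ins
  have i2 := hL.sch
  have i3 := hL.ib
  have i4 := hL.sb
  unfold nodeProg
  have c1 := ((hc.run (i := .istore 21 37) (by decide)).run (i := .iadd 21 21 4) (by decide)).run
    (i := .istore 20 41) (by decide)
  have him1 : ∀ x, x ≠ OB + lN.length → x ≠ l.length + 1 → ((Instr.istore 20 41).run
      ((Instr.iadd 21 21 4).run ((Instr.istore 21 37).run s))).imem x = s.imem x := by
    intro x h1 h2
    simp [Instr.run, h20, h21, Function.update_of_ne h1, Function.update_of_ne h2]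
  refine Run.instr_cons (Run.instr_cons (Run.instr_cons (Run.cons ((run_fix hX' hk hdeg c1
    (hins.congr fun x _ hx => him1 x (by omega) (by omega)) v (by simp [Instr.run, h37])
    (a := l.length * (k * (n + 1) ^ d)) (by simp [Instr.run, h40])
    (by simpa [Instr.run] using hT)).mono ?_))))
  set K := k * (n + 1) ^ d with hK
  have hsl : (l.length + 3) * K ≤ RB :=
    (Nat.mul_le_mul_right K (by omega : l.length + 3 ≤ N + 2)).trans hrb
  rw [add_mul] at hsl
  rintro s1 hf ⟨p1, p2, p3, p4⟩
  have c2 := (((c1.frame hf (by decide)).run (i := .isub 30 51 7) (by decide))).run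
    (i := .iadd 31 40 3) (by decide)
  have d1 := c1.frame hf (by decide)
  have f40 : s1.ireg 40 = l.length * K := by rw [hf.ir 40 (by decide)]; simp [Instr.run, h40]
  have e31 : ((Instr.iadd 31 40 3).run ((Instr.isub 30 51 7).run s1)).ireg 31 = l.length * K := by
    simp [Instr.run, f40, d1.r3]
  have e30 : ((Instr.iadd 31 40 3).run ((Instr.isub 30 51 7).run s1)).ireg 30
      = l.length * K + 2 * K := by
    simp [Instr.run, p4, d1.r7]; omega
  refine Run.instr_cons (Run.instr_cons (Run.cons ((run_copy hX c2.r4 c2.r7 (by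
    right; rw [e30, e31]; omega)).mono ?_)))
  rintro s2 hf2 ⟨q1, q2⟩
  rw [e31, e30] at q1
  rw [e31] at q2
  have d2 := c2.frame hf2 (by decide)
  have f20 : s2.ireg 20 = l.length + 1 := by
    rw [hf2.ir 20 (by decide)]; simp [Instr.run]; rw [hf.ir 20 (by decide)]; simp [Instr.run, h20]
  have f21 : s2.ireg 21 = OB + lN.length + 1 := by
    rw [hf2.ir 21 (by decide)]; simp [Instr.run]; rw [hf.ir 21 (by decide)]
    simp [Instr.run, h21, hc.r4]
  have f22 : s2.ireg 22 = RB + lR.length := by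
    rw [hf2.ir 22 (by decide)]; simp [Instr.run]; rw [hf.ir 22 (by decide)]; simp [Instr.run, h22]
  have fim : s2.imem = Function.update (Function.update s.imem (OB + lN.length) (v + 1))
      (l.length + 1) r := by
    rw [hf2.im (by decide)]; simp only [Instr.run]; rw [hf.im (by decide)]
    simp [Instr.run, h20, h21, h37, h41]
  have him : ∀ x, x ≠ OB + lN.length → x ≠ l.length + 1 → s2.imem x = s.imem x := by
    intro x h1 h2; rw [fim, Function.update_of_ne h2, Function.update_of_ne h1]
  have hrm : ∀ y, y < l.length * K ∨ l.length * K + 3 * K ≤ y → s2.rmem y = s.rmem y := by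
    intro y hy
    rw [q2 y (by omega)]
    simp only [Instr.run]
    rw [p3 y (by omega)]
    simp [Instr.run]
  refine Run.instr_cons (Run.nil
    ⟨(r, fixAll v (-1) P) :: (r, fixAll v 1 P) :: l, lN ++ [(v : ℕ) + 1], lR, ?_, ?_, ?_, ?_⟩)
  · refine ⟨d2.run (by decide), ?_, ?_, ⟨?_, ?_, hdeg.fixAll v _, ?_, ?_, ?_, hdeg.fixAll v _, ?_, ?_⟩,
      ?_, ?_, ?_, ?_, ?_⟩
    · exact hins.congr fun x _ hx => him x (by omega) (by omega)
    · exact hsch.congr fun x _ hx => him x (by omega) (by omega)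
    · simp only [Instr.run, List.length_cons]; rw [fim]; simp
    · change Stores s2.rmem _ _
      rw [List.length_cons, add_mul, one_mul]
      refine p1.congr fun y h1 h2 => ?_
      rw [q2 y (by omega)]
      simp [Instr.run]
    · simp only [List.length_cons]; omega
    · simp only [Instr.run]; rw [him _ (by omega) (by omega), htop]
    · change Stores s2.rmem _ _
      intro j hj
      have hj' := hj
      rw [length_tables] at hj'
      rw [q1 j hj']
      exact p2 j hj
    · omega
    · exact hst.congr (fun x hx => him x (by omega) (by omega)) fun y hy => hrm y (Or.inl hy)
    · change Stores s2.imem _ _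
      rw [stores_append, stores_cons]
      refine ⟨hoN.congr fun x _ hx => him x (by omega) (by omega), ?_, stores_nil _ _⟩
      rw [fim, Function.update_of_ne (by omega)]; simp
    · change Stores s2.rmem _ _
      exact hoR.congr fun x h1 _ => hrm x (by omega)
    · simp [Instr.run, f20, d2.r4]
    · simp [Instr.run, f21]; ring
    · simp [Instr.run, f22]
  · simp only [List.flatMap_cons, hp, natCode]
    simp
  · simp only [List.flatMap_cons, hp, realCode]
    simp
  -- Two entries of weight 2^(r+1) - 1 replace one of weight 2^(r+2) - 1, a loss of exactly one.
  · have : 1 ≤ 2 ^ r := Nat.one_le_two_pow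
    simp [weight, pow_succ]; omega

/-- One step of the schedule. -/
def stepProg : Prog := seqs [
  .isub 41 41 4, .iadd 46 41 41, .iadd 46 46 12, .iload 47 46, .iadd 46 46 4, .iload 36 46,
  .imul 30 47 6, .iadd 30 30 40, violProg, .istore 45 41, .ite (.ile 37 3) .skip nodeProg]

/-- `W` is the schedule in reverse order, so a process with r + 1 steps left is described by the
number r + 1 alone, and its next step is the entry with index `r`. -/
theorem pending_succ {B : ℕ} {W : List (Fin k × ℕ)} {r : ℕ} (hr : r < W.length)
    {P : Fin k → MPoly n} (hP : ¬ ∀ i, Fine B (P i)) :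
    pending B W (r + 1, P) = match pick W[r].2 (P W[r].1) with
      | none => pending B W (r, P)
      | some v => .node v (pending B W (r, fixAll v (-1) P)) (pending B W (r, fixAll v 1 P)) := by
  unfold pending
  simp only
  rw [List.take_add_one, List.getElem?_eq_getElem hr]
  simp only [Option.toList_some, List.reverse_append, List.reverse_singleton, List.singleton_append]
  cases hpk : pick W[r].2 (P W[r].1) <;> simp only [build, hP, if_false, hpk]

theorem run_step {X d B IB SB OB RB N : ℕ} [NeZero X] (hX : k * (n + 1) ^ d ≤ X)
    (hX' : (n + 1) ^ d ≤ X) (hk : k ≤ X) (hn : n ≤ X)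
    {W : List (Fin k × ℕ)} (hW : W.length = N) (hL : Layout n k d IB SB OB RB N)
    {r : ℕ} {P : Fin k → MPoly n} {l : List (ℕ × (Fin k → MPoly n))} {lN : List ℕ} {lR : List ℝ}
    {s : State} (h : LoopInv d B IB SB OB RB N W ((r + 1, P) :: l) lN lR s)
    (h40 : s.ireg 40 = l.length * (k * (n + 1) ^ d)) (h41 : s.ireg 41 = r + 1)
    (h45 : s.ireg 45 = l.length) (hP : ¬ ∀ i, Fine B (P i)) :
    Run X stepProg s (Next d B IB SB OB RB N W ((r + 1, P) :: l) lN lR) := by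
  obtain ⟨hc, hins, hsch, ⟨t1, t2, t3, t4, t5⟩, hoN, hoR, h20, h21, h22⟩ := h
  have hrW : r < W.length := by omega
  have hpd := pending_succ hrW hP
  obtain ⟨s1, s2⟩ := hsch r hrW
  have i1 := hL.ins
  have i2 := hL.sch
  have i3 := hL.ib
  have i4 := hL.sb
  unfold stepProg
  have c1 := (((((((hc.run (i := .isub 41 41 4) (by decide)).run (i := .iadd 46 41 41)
    (by decide)).run (i := .iadd 46 46 12) (by decide)).run (i := .iload 47 46) (by decide)).run
    (i := .iadd 46 46 4) (by decide)).run (i := .iload 36 46) (by decide)).run (i := .imul 30 47 6)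
    (by decide)).run (i := .iadd 30 30 40) (by decide)
  have m1 : s.imem (r + r + SB) = (W[r].1 : ℕ) := by rw [← s1]; congr 1; ring
  have m2 : s.imem (r + r + SB + 1) = W[r].2 := by rw [← s2]; congr 1; ring
  refine Run.instr_cons (Run.instr_cons (Run.instr_cons (Run.instr_cons (Run.instr_cons
    (Run.instr_cons (Run.instr_cons (Run.instr_cons (Run.cons
    ((run_viol (p := P W[r].1) hX' hn (t3 _) c1.r0 c1.r3 c1.r4 c1.r5 c1.r6
      (by rw [c1.r10]; exact hins) ?_).mono ?_)))))))))
  · rw [stores_table]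
    intro e he
    have := stores_tables.1 t2 W[r].1 e he
    rw [← this]
    simp only [Instr.run]
    simp [h41, hc.r4, hc.r12, h40, hc.r6, m1]
    congr 1; ring
  rintro s' hf ⟨p1, -, -, -⟩
  have e36 : ((Instr.iadd 30 30 40).run ((Instr.imul 30 47 6).run ((Instr.iload 36 46).run
      ((Instr.iadd 46 46 4).run ((Instr.iload 47 46).run ((Instr.iadd 46 46 12).run
      ((Instr.iadd 46 41 41).run ((Instr.isub 41 41 4).run s)))))))).ireg 36 = W[r].2 := by
    simp [Instr.run, h41, hc.r4, hc.r12, m2]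
  rw [e36] at p1
  have d1 := c1.frame hf (by decide)
  have f20 : s'.ireg 20 = l.length + 1 := by rw [hf.ir 20 (by decide)]; simp [Instr.run, h20]
  have f21 : s'.ireg 21 = OB + lN.length := by rw [hf.ir 21 (by decide)]; simp [Instr.run, h21]
  have f22 : s'.ireg 22 = RB + lR.length := by rw [hf.ir 22 (by decide)]; simp [Instr.run, h22]
  have f40 : s'.ireg 40 = l.length * (k * (n + 1) ^ d) := by
    rw [hf.ir 40 (by decide)]; simp [Instr.run, h40]
  have f41 : s'.ireg 41 = r := by rw [hf.ir 41 (by decide)]; simp [Instr.run, h41, hc.r4]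
  have f45 : s'.ireg 45 = l.length := by rw [hf.ir 45 (by decide)]; simp [Instr.run, h45]
  have fim : s'.imem = s.imem := by rw [hf.im (by decide)]; simp [Instr.run]
  have frm : s'.rmem = s.rmem := by rw [hf.rm (by decide)]; simp [Instr.run]
  set s'' := (Instr.istore 45 41).run s' with hs''
  have d2 : Ctx n k d B IB SB OB RB s'' := d1.run (by decide)
  have gim : s''.imem = Function.update s.imem l.length r := by
    simp [hs'', Instr.run, f45, f41, fim]
  have grm : s''.rmem = s.rmem := by simp [hs'', Instr.run, frm]
  have gir : s''.ireg = s'.ireg := by simp [hs'', Instr.run]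
  have him : ∀ x, x ≠ l.length → s''.imem x = s.imem x := by
    intro x h1; rw [gim, Function.update_of_ne h1]
  have a1 : InsTable n d s''.imem IB := hins.congr fun x _ hx => him x (by omega)
  have a2 : SchedTable s''.imem SB W := hsch.congr fun x _ hx => him x (by omega)
  have a3 : StackOK d N s''.imem s''.rmem l :=
    t5.congr (fun x hx => him x (by omega)) fun y hy => by rw [grm]
  have a4 : s''.imem l.length = r := by rw [gim]; simp
  have a5 : Stores s''.imem OB lN := hoN.congr fun x _ hx => him x (by omega)
  have a6 : Stores s''.rmem RB lR := by rw [grm]; exact hoR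
  have a7 : Stores s''.rmem (l.length * (k * (n + 1) ^ d)) (tables d P) := by rw [grm]; exact t2
  refine Run.instr_cons (Run.cons (Run.ite (fun c => Run.skip (Run.nil ?_)) fun c =>
    Run.mono ?_ (fun _ _ hq => Run.nil hq)))
  · have hv : viol W[r].2 (P W[r].1) n = 0 := by
      simpa [Test.Holds, Instr.run, p1, d1.r3] using c
    rw [pick_eq_none_iff.2 (viol_eq_zero_iff.1 hv)] at hpd
    refine ⟨(r, P) :: l, lN, lR, ⟨d2, a1, a2, ⟨a4, a7, t3, by omega, a3⟩, a5, a6,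
      by rw [gir, f20]; rfl, by rw [gir, f21], by rw [gir, f22]⟩, ?_, ?_, ?_⟩
    · simp only [List.flatMap_cons, hpd]
    · simp only [List.flatMap_cons, hpd]
    · have : 1 ≤ 2 ^ r := Nat.one_le_two_pow
      simp [weight, pow_succ]; omega
  · have hv : viol W[r].2 (P W[r].1) n ≠ 0 := by
      simpa [Test.Holds, Instr.run, p1, d1.r3] using c
    cases hpk : pick W[r].2 (P W[r].1) with
    | none => exact absurd (viol_eq_zero_iff.2 (pick_eq_none_iff.1 hpk)) hv
    | some v =>
      rw [hpk] at hpd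
      exact run_node hX hX' hk hW hL d2 a1 a2 a3 a7 t3 t4 a4 a5 a6 (by rw [gir, f20])
        (by rw [gir, f21]) (by rw [gir, f22]) (by rw [gir, f41]) (by rw [gir, f40])
        (by rw [gir, p1]; exact (pick_some hpk).1) hpd

/-- The main loop. -/
def mainLoop : Prog := .while (.ilt 3 20) (seqs [
  .isub 45 20 4, .imul 40 45 7, .iload 41 45, labelProg, .imul 46 41 42,
  .ite (.ile 46 3) leafProg stepProg])

/-- The invariant: the output written so far, followed by the codes of the pending subtrees from the
top of the stack down, is the code of the whole tree. The variant is the total weight of the stack,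
initially 2^(N+1) - 1. -/
theorem run_mainLoop {X d B IB SB OB RB N : ℕ} [NeZero X] (hX : k * (n + 1) ^ d ≤ X)
    (hX' : (n + 1) ^ d ≤ X) (hk : k ≤ X) (hn : n ≤ X) (hNX : 2 ^ (N + 1) ≤ X)
    {W : List (Fin k × ℕ)} (hW : W.length = N) (hL : Layout n k d IB SB OB RB N)
    {P : Fin k → MPoly n} {s : State} (h : LoopInv d B IB SB OB RB N W [(N, P)] [] [] s) :
    Run X mainLoop s (fun s' => s'.ireg 13 = OB ∧ s'.ireg 14 = RB ∧
      Stores s'.imem OB (natCode (build B W.reverse P)) ∧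
      Stores s'.rmem RB (realCode d (build B W.reverse P))) := by
  have hT : pending B W (N, P) = build B W.reverse P := by
    unfold pending; simp [← hW]
  unfold mainLoop
  refine Run.while (fun m s => ∃ (l : List (ℕ × (Fin k → MPoly n))) (lN : List ℕ) (lR : List ℝ), LoopInv d B IB SB OB RB N W l lN lR s ∧
    lN ++ l.flatMap (fun x => natCode (pending B W x)) = natCode (build B W.reverse P) ∧
    lR ++ l.flatMap (fun x => realCode d (pending B W x)) = realCode d (build B W.reverse P) ∧
    weight l = m) (m := weight [(N, P)]) ?_ ⟨_, _, _, h, ?_, ?_, rfl⟩ ?_ ?_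
  · simp [weight]; omega
  · simp [hT]
  · simp [hT]
  · rintro m s1 - ⟨l, lN, lR, hI, hcN, hcR, rfl⟩ hc
    cases l with
    | nil => simp [Test.Holds, hI.r20, hI.ctx.r3] at hc
    | cons a l =>
    obtain ⟨r, P'⟩ := a
    have hI' := hI
    obtain ⟨hctx, hins, hsch, ⟨t1, t2, t3, t4, t5⟩, hoN, hoR, h20, h21, h22⟩ := hI
    have c1 := ((hctx.run (i := .isub 45 20 4) (by decide)).run (i := .imul 40 45 7)
      (by decide)).run (i := .iload 41 45) (by decide)
    have e40 : ((Instr.iload 41 45).run ((Instr.imul 40 45 7).run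
      ((Instr.isub 45 20 4).run s1))).ireg 40 = l.length * (k * (n + 1) ^ d) := by
      simp [Instr.run, h20, hctx.r4, hctx.r7]
    refine Run.instr_cons (Run.instr_cons (Run.instr_cons (Run.cons
      ((run_label (P := P') hX' hn hk t3 c1 hins ?_ ?_).mono ?_))))
    · simp [Instr.run, h21]; have := hL.ins; omega
    · rw [e40]; exact t2
    rintro s2 hf ⟨p1, p2, p3⟩
    have f20 : s2.ireg 20 = l.length + 1 := by rw [hf.ir 20 (by decide)]; simp [Instr.run, h20]
    have f21 : s2.ireg 21 = OB + lN.length := by rw [hf.ir 21 (by decide)]; simp [Instr.run, h21]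
    have f22 : s2.ireg 22 = RB + lR.length := by rw [hf.ir 22 (by decide)]; simp [Instr.run, h22]
    have f40 : s2.ireg 40 = l.length * (k * (n + 1) ^ d) := by rw [hf.ir 40 (by decide), e40]
    have f45 : s2.ireg 45 = l.length := by
      rw [hf.ir 45 (by decide)]; simp [Instr.run, h20, hctx.r4]
    have f41 : s2.ireg 41 = r := by
      rw [hf.ir 41 (by decide)]; simp [Instr.run, h20, hctx.r4, t1]
    have frm : s2.rmem = s1.rmem := by rw [hf.rm (by decide)]; simp [Instr.run]
    have him : ∀ x ≤ OB + lN.length, s2.imem x = s1.imem x := by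
      intro x hx
      rw [p2 x (by simpa [Instr.run, h21] using hx)]; simp [Instr.run]
    have d1 := c1.frame hf (by decide)
    have i1 := hL.ins
    have i2 := hL.sch
    have i3 := hL.ib
    have hI2 : LoopInv d B IB SB OB RB N W ((r, P') :: l) lN lR ((Instr.imul 46 41 42).run s2) := by
      refine ⟨d1.run (by decide), hins.congr fun x _ hx => him x (by omega),
        hsch.congr fun x _ hx => him x (by omega), ?_, hoN.congr fun x _ hx => him x (by omega),
        ?_, ?_, ?_, ?_⟩
      · exact hI'.stack.congr (fun x hx => him x (by simp at hx; omega)) fun y _ => by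
          simp [Instr.run, frm]
      · simpa [Instr.run, frm] using hoR
      · simp [Instr.run, f20]
      · simp [Instr.run, f21]
      · simp [Instr.run, f22]
    have h46 : ((Instr.imul 46 41 42).run s2).ireg 46 = r * s2.ireg 42 := by
      simp [Instr.run, f41]
    have hfin : ∀ s', Next d B IB SB OB RB N W ((r, P') :: l) lN lR s' →
        ∃ m' < weight ((r, P') :: l), ∃ (l : List (ℕ × (Fin k → MPoly n))) (lN : List ℕ)
 (lR : List ℝ), LoopInv d B IB SB OB RB N W l lN lR s' ∧
          lN ++ l.flatMap (fun x => natCode (pending B W x)) = natCode (build B W.reverse P) ∧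
          lR ++ l.flatMap (fun x => realCode d (pending B W x)) = realCode d (build B W.reverse P) ∧
          weight l = m' := by
      rintro s' ⟨l', lN', lR', g1, g2, g3, g4⟩
      exact ⟨weight l', g4, l', lN', lR', g1, g2.trans hcN, g3.trans hcR, rfl⟩
    refine Run.instr_cons (Run.cons (Run.ite (fun c => ?_) fun c => ?_))
    -- The product of the number of remaining steps and the failure flag is zero exactly if the
    -- entry is a leaf.
    · have c' : r = 0 ∨ s2.ireg 42 = 0 := by
        simp only [Test.Holds, h46] at c
        have e3 : ((Instr.imul 46 41 42).run s2).ireg 3 = 0 := (d1.run (by decide)).r3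
        rw [e3] at c
        simpa using c
      refine (run_leaf hX hW hL hI2 ?_ (by simp [Instr.run, f40]) ?_).mono
        fun s' _ hq => Run.nil (hfin s' hq)
      · simpa [Instr.run, f21, h21] using p1
      · rcases c' with rfl | c'
        · simp [pending, build]
        · exact build_of_fine (p3.1 c') _
    · have c' : r ≠ 0 ∧ s2.ireg 42 ≠ 0 := by
        simp only [Test.Holds, h46] at c
        have e3 : ((Instr.imul 46 41 42).run s2).ireg 3 = 0 := (d1.run (by decide)).r3
        rw [e3] at c
        simpa using c
      obtain ⟨r, rfl⟩ := Nat.exists_eq_succ_of_ne_zero c'.1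
      exact (run_step hX hX' hk hn hW hL hI2 (by simp [Instr.run, f40]) (by simp [Instr.run, f41])
        (by simp [Instr.run, f45]) (fun hfine => c'.2 (p3.2 hfine))).mono
        fun s' _ hq => Run.nil (hfin s' hq)
  · rintro m s1 - ⟨l, lN, lR, hI, hcN, hcR, -⟩ hc
    cases l with
    | nil =>
      simp only [List.flatMap_nil, List.append_nil] at hcN hcR
      rw [← hcN, ← hcR]
      exact ⟨hI.ctx.r13, hI.ctx.r14, hI.outN, hI.outR⟩
    | cons a l => simp [Test.Holds, hI.r20, hI.ctx.r3] at hc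

end PTFReg

namespace PTFReg

variable {n k : ℕ}

/-! ### Tables for the codes of tuples -/

/-- The row of the membership table at address `a` for the code `e` is correct. -/
def MemRow (n d : ℕ) (mem : ℕ → ℕ) (a e : ℕ) : Prop :=
  ∀ v : Fin n, mem (a + e * (n + 1) + v + 1) = if v ∈ tupleSet n d e then 1 else 0

/-- Adding a · (n+1)^j puts the digit `a` in position `j` and changes no other digit, since `e` has
digits only below `j`. The membership table is filled by this recursion. -/
theorem mem_tupleSet_add {d j a e : ℕ} (hj : j < d) (ha : a ≤ n) (he : e < (n + 1) ^ j)
    (v : Fin n) : v ∈ tupleSet n d (a * (n + 1) ^ j + e) ↔ v ∈ tupleSet n d e ∨ (v : ℕ) + 1 = a := by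
  have hpos : ∀ i, 0 < (n + 1) ^ i := fun i => by positivity
  have hlow : ∀ i < j, (a * (n + 1) ^ j + e) / (n + 1) ^ i % (n + 1) = e / (n + 1) ^ i % (n + 1) := by
    intro i hi
    obtain ⟨c, rfl⟩ := Nat.exists_eq_add_of_lt hi
    rw [show a * (n + 1) ^ (i + c + 1) + e = e + (n + 1) ^ i * ((n + 1) * (a * (n + 1) ^ c)) by ring,
      Nat.add_mul_div_left _ _ (hpos i), Nat.add_mul_mod_self_left]
  have hmid : (a * (n + 1) ^ j + e) / (n + 1) ^ j % (n + 1) = a := by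
    rw [mul_comm, Nat.mul_add_div (hpos j), Nat.div_eq_of_lt he, add_zero,
      Nat.mod_eq_of_lt (by omega)]
  have hhigh : ∀ i, j < i → (a * (n + 1) ^ j + e) / (n + 1) ^ i % (n + 1) = 0 := by
    intro i hi
    have : a * (n + 1) ^ j + e < (n + 1) ^ i := by
      calc a * (n + 1) ^ j + e < (n + 1) * (n + 1) ^ j := by
            have := Nat.mul_le_mul_right ((n + 1) ^ j) ha
            rw [add_mul n 1]; omega
        _ = (n + 1) ^ (j + 1) := by ring
        _ ≤ (n + 1) ^ i := Nat.pow_le_pow_right (by omega) hi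
    rw [Nat.div_eq_of_lt this, Nat.zero_mod]
  have hhigh' : ∀ i, j ≤ i → e / (n + 1) ^ i % (n + 1) = 0 := by
    intro i hi
    have : e < (n + 1) ^ i := he.trans_le (Nat.pow_le_pow_right (by omega) hi)
    rw [Nat.div_eq_of_lt this, Nat.zero_mod]
  simp only [tupleSet, Finset.mem_filter, Finset.mem_univ, true_and]
  constructor
  · rintro ⟨i, hi⟩
    rcases lt_trichotomy (i : ℕ) j with h | h | h
    · rw [hlow _ h] at hi; exact Or.inl ⟨i, hi⟩
    · rw [h, hmid] at hi; exact Or.inr hi.symm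
    · rw [hhigh _ h] at hi; omega
  · rintro (⟨i, hi⟩ | h)
    · rcases Nat.lt_or_ge (i : ℕ) j with h | h
      · exact ⟨i, by rw [hlow _ h, hi]⟩
      · rw [hhigh' _ h] at hi; omega
    · exact ⟨⟨j, hj⟩, by simp only [hmid, h]⟩

/-- Writes the membership table to the address in register `19`. -/
def memProg : Prog := seqs [
  .iconst 31 1, .iadd 60 19 5,
  forLoop 32 2 (seqs [
    forLoop 33 0 (seqs [
      .iadd 61 19 3,
      forLoop 34 31 (seqs [
        forLoop 35 5 (seqs [.iadd 36 61 35, .iload 37 36, .iadd 36 60 35, .istore 36 37]),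
        .iadd 36 60 33, .iadd 36 36 4, .istore 36 4, .iadd 60 60 5, .iadd 61 61 5])]),
    .imul 31 31 5])]

theorem run_mem {X d : ℕ} [NeZero X] (hX : (n + 1) ^ d ≤ X) (hd : d ≤ X) (hn : n + 1 ≤ X)
    {s : State} {a : ℕ} (h0 : s.ireg 0 = n) (h2 : s.ireg 2 = d) (h3 : s.ireg 3 = 0)
    (h4 : s.ireg 4 = 1) (h5 : s.ireg 5 = n + 1) (h19 : s.ireg 19 = a)
    (him : ∀ x, s.imem x = 0) :
    Run X memProg s (fun s' => ∀ e < (n + 1) ^ d, MemRow n d s'.imem a e) := by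
  unfold memProg
  refine Run.instr_cons (Run.instr_cons (Run.cons ?_))
  refine Run.forLoop (fun j s' => s'.ireg 31 = (n + 1) ^ j ∧
      s'.ireg 60 = a + (n + 1) ^ j * (n + 1) ∧ ∀ e < (n + 1) ^ j, MemRow n d s'.imem a e)
    (N := d) (by simp [Instr.run, h2]) hd (by simp [Instr.run, h4]) (by decide) ?_ ?_ ?_
  · refine ⟨by simp [Instr.run, State.seti], by simp [Instr.run, State.seti, h19, h5], ?_⟩
    intro e he
    -- Code 0 names the empty set, and its row is correct because the memory is initially zero.
    obtain rfl : e = 0 := by simpa using he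
    intro v
    simp [Instr.run, State.seti, him, tupleSet_zero]
  · rintro j s1 hj hf hi ⟨i31, i60, irow⟩
    have g0 : s1.ireg 0 = n := by rw [hf.ir 0 (by decide)]; simp [Instr.run, h0]
    have g3 : s1.ireg 3 = 0 := by rw [hf.ir 3 (by decide)]; simp [Instr.run, h3]
    have g4 : s1.ireg 4 = 1 := by rw [hf.ir 4 (by decide)]; simp [Instr.run, h4]
    have g5 : s1.ireg 5 = n + 1 := by rw [hf.ir 5 (by decide)]; simp [Instr.run, h5]
    have g19 : s1.ireg 19 = a := by rw [hf.ir 19 (by decide)]; simp [Instr.run, h19]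
    have hqX : (n + 1) ^ j ≤ X := (Nat.pow_le_pow_right (by omega) hj.le).trans hX
    refine Run.cons ?_
    refine Run.forLoop (fun m s' => s'.ireg 60 = a + (m + 1) * (n + 1) ^ j * (n + 1) ∧
        ∀ e < (m + 1) * (n + 1) ^ j, MemRow n d s'.imem a e)
      (N := n) g0 (by omega) g4 (by decide) ?_ ?_ ?_
    · exact ⟨by simp [State.seti, i60], by simpa [State.seti] using irow⟩
    · rintro m s2 hm hf2 hi2 ⟨j60, jrow⟩
      have k3 : s2.ireg 3 = 0 := by rw [hf2.ir 3 (by decide), g3]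
      have k4 : s2.ireg 4 = 1 := by rw [hf2.ir 4 (by decide), g4]
      have k5 : s2.ireg 5 = n + 1 := by rw [hf2.ir 5 (by decide), g5]
      have k19 : s2.ireg 19 = a := by rw [hf2.ir 19 (by decide), g19]
      have k31 : s2.ireg 31 = (n + 1) ^ j := by rw [hf2.ir 31 (by decide), i31]
      refine Run.instr_cons (Run.cons ?_)
      refine Run.forLoop (fun q s' => s'.ireg 60 = a + ((m + 1) * (n + 1) ^ j + q) * (n + 1) ∧
          s'.ireg 61 = a + q * (n + 1) ∧
          ∀ e < (m + 1) * (n + 1) ^ j + q, MemRow n d s'.imem a e)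
        (N := (n + 1) ^ j) (by simp [Instr.run, k31]) hqX (by simp [Instr.run, k4]) (by decide)
        ?_ ?_ ?_
      · exact ⟨by simp [Instr.run, State.seti, j60], by simp [Instr.run, State.seti, k19, k3],
          by simpa [Instr.run, State.seti] using jrow⟩
      · rintro q s3 hq hf3 hi3 ⟨l60, l61, lrow⟩
        have o4 : s3.ireg 4 = 1 := by rw [hf3.ir 4 (by decide)]; simp [Instr.run, k4]
        have o5 : s3.ireg 5 = n + 1 := by rw [hf3.ir 5 (by decide)]; simp [Instr.run, k5]
        have o33 : s3.ireg 33 = m := by rw [hf3.ir 33 (by decide)]; simp [Instr.run, hi2]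
        set c := (m + 1) * (n + 1) ^ j + q with hc
        have hqc : q + 1 ≤ c := by
          have : (n + 1) ^ j ≤ (m + 1) * (n + 1) ^ j := Nat.le_mul_of_pos_left _ (by omega)
          omega
        have hqc' : q * (n + 1) + (n + 1) ≤ c * (n + 1) := by
          rw [← Nat.succ_mul]; exact Nat.mul_le_mul_right _ hqc
        refine Run.cons ?_
        -- The new row, for the digit m + 1 in position `j`, is a copy of row `q`, in which the cell
        -- of the variable named m + 1 is set afterwards.
        refine Run.forLoop (fun u s' =>
            (∀ x < u, s'.imem (a + c * (n + 1) + x) = s3.imem (a + q * (n + 1) + x)) ∧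
            ∀ x < a + c * (n + 1), s'.imem x = s3.imem x)
          (N := n + 1) o5 hn o4 (by decide) ?_ ?_ ?_
        · exact ⟨fun x hx => absurd hx (Nat.not_lt_zero _), fun x _ => rfl⟩
        · rintro u s4 hu hf4 hi4 ⟨r1, r2⟩
          have p60 : s4.ireg 60 = a + c * (n + 1) := by rw [hf4.ir 60 (by decide), l60]
          have p61 : s4.ireg 61 = a + q * (n + 1) := by rw [hf4.ir 61 (by decide), l61]
          refine Run.instr_cons (Run.instr_cons (Run.instr_cons (Run.instr_cons (Run.nil ⟨?_, ?_⟩))))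
          · intro x hx
            rcases Nat.lt_or_ge x u with h | h
            · simp [Instr.run, State.seti, p60, p61, hi4, h.ne, r1 x h]
            · obtain rfl : x = u := by omega
              simp [Instr.run, State.seti, p60, p61, hi4]
              rw [r2 _ (by omega)]
          · intro x hx
            have : x ≠ a + c * (n + 1) + u := by omega
            simp [Instr.run, State.seti, p60, p61, hi4, Function.update_of_ne this, r2 x hx]
        · rintro s4 hf4 - ⟨r1, r2⟩
          have p60 : s4.ireg 60 = a + c * (n + 1) := by rw [hf4.ir 60 (by decide), l60]
          have p61 : s4.ireg 61 = a + q * (n + 1) := by rw [hf4.ir 61 (by decide), l61]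
          have p33 : s4.ireg 33 = m := by rw [hf4.ir 33 (by decide), o33]
          have p4 : s4.ireg 4 = 1 := by rw [hf4.ir 4 (by decide), o4]
          have p5 : s4.ireg 5 = n + 1 := by rw [hf4.ir 5 (by decide), o5]
          refine Run.instr_cons (Run.instr_cons (Run.instr_cons (Run.instr_cons (Run.instr_cons
            (Run.nil ⟨?_, ?_, ?_⟩)))))
          · simp [Instr.run, State.seti, p60, p5]; rw [hc]; ring
          · simp [Instr.run, State.seti, p61, p5]; ring
          · have hmem : ∀ x, (((Instr.iadd 61 61 5).run ((Instr.iadd 60 60 5).run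
              ((Instr.istore 36 4).run ((Instr.iadd 36 36 4).run
              ((Instr.iadd 36 60 33).run s4))))).seti 34 (q + 1)).imem x
              = if x = a + c * (n + 1) + m + 1 then 1 else s4.imem x := by
              intro x
              simp [Instr.run, State.seti, p60, p33, p4, Function.update_apply]
            intro e he v
            have hv := v.2
            rw [hmem]
            rcases Nat.lt_or_ge e c with h | h
            · have h1 : e * (n + 1) + (n + 1) ≤ c * (n + 1) := by
                rw [← Nat.succ_mul]; exact Nat.mul_le_mul_right _ h
              rw [if_neg (by omega), r2 _ (by omega)]
              exact lrow e h v
            · obtain rfl : e = c := by omega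
              have h1 := lrow q (by omega) v
              have h2 := r1 (v + 1) (by omega)
              rw [← add_assoc, ← add_assoc, h1] at h2
              have h3 := mem_tupleSet_add hj (show m + 1 ≤ n by omega) hq v
              rw [← hc] at h3
              simp only [h3]
              by_cases hvm : (v : ℕ) = m
              · rw [if_pos (by omega), if_pos (Or.inr (by omega))]
              · rw [if_neg (by omega), h2]
                have : ¬ (v : ℕ) + 1 = m + 1 := by omega
                simp only [this, or_false]
      · rintro s3 - - ⟨l60, -, lrow⟩
        refine Run.nil ⟨?_, ?_⟩
        · simp [State.seti, l60]; ring
        · rw [show (m + 1 + 1) * (n + 1) ^ j = (m + 1) * (n + 1) ^ j + (n + 1) ^ j by ring]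
          exact lrow
    · rintro s2 hf2 - ⟨j60, jrow⟩
      have k5 : s2.ireg 5 = n + 1 := by rw [hf2.ir 5 (by decide), g5]
      have k31 : s2.ireg 31 = (n + 1) ^ j := by rw [hf2.ir 31 (by decide), i31]
      refine Run.instr_cons (Run.nil ⟨?_, ?_, ?_⟩)
      · simp [Instr.run, State.seti, k31, k5, pow_succ]
      · simp [Instr.run, State.seti, j60, pow_succ]; ring
      · rw [pow_succ, mul_comm]; exact jrow
  · rintro s1 - - ⟨-, -, h⟩
    exact Run.nil h

/-- Register `66` becomes `0` if the row at the address in register `61`, with an additional name in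
register `63`, agrees with the row at the address in register `64`. -/
def eqProg : Prog := seqs [
  .iconst 66 0,
  forLoop 67 0 (seqs [
    .iadd 70 61 67, .iadd 70 70 4, .iload 71 70, .iadd 70 67 4,
    .ite (.ile 70 63) (.ite (.ile 63 70) (.iconst 71 1) .skip) .skip,
    .iadd 70 64 67, .iadd 70 70 4, .iload 72 70, .isub 73 71 72, .isub 74 72 71,
    .iadd 66 66 73, .iadd 66 66 74])]

/-- The register accumulates the absolute differences of the two membership rows, so it is zero
exactly if all entries agree. -/
theorem run_eq {X d a e e' w : ℕ} [NeZero X] (hn : n ≤ X) {s : State} (h0 : s.ireg 0 = n)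
    (h4 : s.ireg 4 = 1) (h61 : s.ireg 61 = a + e * (n + 1)) (h64 : s.ireg 64 = a + e' * (n + 1))
    (h63 : s.ireg 63 = w) (he : MemRow n d s.imem a e) (he' : MemRow n d s.imem a e') :
    Run X eqProg s (fun s' =>
      s'.ireg 66 = 0 ↔ tupleSet n d e' = tupleSet n d e ∪ nameSet n w) := by
  unfold eqProg
  refine Run.instr_cons (Run.cons ?_)
  refine Run.forLoop (fun m s' => s'.ireg 66 = 0 ↔
      ∀ v : Fin n, (v : ℕ) < m → (v ∈ tupleSet n d e' ↔ v ∈ tupleSet n d e ∪ nameSet n w))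
    (N := n) (by simp [Instr.run, h0]) hn (by simp [Instr.run, h4]) (by decide) ?_ ?_ ?_
  · simp [Instr.run, State.seti]
  · intro m s1 hm hf hi hI
    have g4 : s1.ireg 4 = 1 := by rw [hf.ir 4 (by decide)]; simp [Instr.run, h4]
    have g61 : s1.ireg 61 = a + e * (n + 1) := by rw [hf.ir 61 (by decide)]; simp [Instr.run, h61]
    have g64 : s1.ireg 64 = a + e' * (n + 1) := by rw [hf.ir 64 (by decide)]; simp [Instr.run, h64]
    have g63 : s1.ireg 63 = w := by rw [hf.ir 63 (by decide)]; simp [Instr.run, h63]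
    have gim : s1.imem = s.imem := by rw [hf.im (by decide)]; simp [Instr.run]
    have t1 : s1.imem (a + e * (n + 1) + m + 1)
        = if (⟨m, hm⟩ : Fin n) ∈ tupleSet n d e then 1 else 0 := by rw [gim]; exact he ⟨m, hm⟩
    have t2 : s1.imem (a + e' * (n + 1) + m + 1)
        = if (⟨m, hm⟩ : Fin n) ∈ tupleSet n d e' then 1 else 0 := by rw [gim]; exact he' ⟨m, hm⟩
    have hstep : (∀ v : Fin n, (v : ℕ) < m + 1 →
        (v ∈ tupleSet n d e' ↔ v ∈ tupleSet n d e ∪ nameSet n w)) ↔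
        ((∀ v : Fin n, (v : ℕ) < m → (v ∈ tupleSet n d e' ↔ v ∈ tupleSet n d e ∪ nameSet n w)) ∧
          ((⟨m, hm⟩ : Fin n) ∈ tupleSet n d e' ↔
            ((⟨m, hm⟩ : Fin n) ∈ tupleSet n d e ∨ m + 1 = w))) := by
      constructor
      · intro h
        refine ⟨fun v hv => h v (by omega), ?_⟩
        simpa [nameSet] using h ⟨m, hm⟩ (by simp)
      · rintro ⟨h1, h2⟩ v hv
        rcases Nat.lt_or_ge (v : ℕ) m with h | h
        · exact h1 v h
        · obtain rfl : v = ⟨m, hm⟩ := Fin.ext (show (v : ℕ) = m by omega)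
          simpa [nameSet] using h2
    have hmain : ∀ s2 : State, (∀ x, x ≠ 71 → s2.ireg x = ((Instr.iadd 70 67 4).run
        ((Instr.iload 71 70).run ((Instr.iadd 70 70 4).run
        ((Instr.iadd 70 61 67).run s1)))).ireg x) → s2.imem = s1.imem →
        s2.ireg 71 = (if (⟨m, hm⟩ : Fin n) ∈ tupleSet n d e ∨ m + 1 = w then 1 else 0) →
        Run X (seqs [.iadd 70 64 67, .iadd 70 70 4, .iload 72 70, .isub 73 71 72, .isub 74 72 71,
          .iadd 66 66 73, .iadd 66 66 74]) s2 (fun s'' => (s''.seti 67 (m + 1)).ireg 66 = 0 ↔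
          ∀ v : Fin n, (v : ℕ) < m + 1 →
            (v ∈ tupleSet n d e' ↔ v ∈ tupleSet n d e ∪ nameSet n w)) := by
      intro s2 b1 b2 b3
      have q64 : s2.ireg 64 = a + e' * (n + 1) := by
        rw [b1 64 (by norm_num)]; simp [Instr.run, g64]
      have q67 : s2.ireg 67 = m := by rw [b1 67 (by norm_num)]; simp [Instr.run, hi]
      have q4 : s2.ireg 4 = 1 := by rw [b1 4 (by norm_num)]; simp [Instr.run, g4]
      have q66 : s2.ireg 66 = s1.ireg 66 := by rw [b1 66 (by norm_num)]; simp [Instr.run]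
      refine Run.instr_cons (Run.instr_cons (Run.instr_cons (Run.instr_cons (Run.instr_cons
        (Run.instr_cons (Run.instr_cons (Run.nil ?_)))))))
      rw [hstep, ← hI]
      simp only [Instr.run, State.seti]
      simp [q64, q67, q4, q66, b2, b3, t2]
      by_cases hA : (⟨m, hm⟩ : Fin n) ∈ tupleSet n d e ∨ m + 1 = w <;>
        by_cases hB : (⟨m, hm⟩ : Fin n) ∈ tupleSet n d e' <;> simp [hA, hB]
    have hw : ((Instr.iadd 70 67 4).run ((Instr.iload 71 70).run ((Instr.iadd 70 70 4).run
        ((Instr.iadd 70 61 67).run s1)))).ireg 71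
        = (if (⟨m, hm⟩ : Fin n) ∈ tupleSet n d e then 1 else 0) := by
      simp [Instr.run, g61, g4, hi, t1]
    refine Run.instr_cons (Run.instr_cons (Run.instr_cons (Run.instr_cons (Run.cons
      (Run.ite (fun c1 => Run.ite (fun c2 => Run.instr ?_) fun c2 => Run.skip ?_)
      fun c1 => Run.skip ?_)))))
    · have e : m + 1 = w := by
        simp [Test.Holds, Instr.run, g63, hi, g4] at c1 c2; omega
      refine hmain _ (fun x hx => ?_) ?_ ?_
      · simp [Instr.run, Function.update_of_ne hx]
      · simp [Instr.run]
      · simp [Instr.run, e]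
    · have e : m + 1 ≠ w := by
        simp [Test.Holds, Instr.run, g63, hi, g4] at c1 c2; omega
      exact hmain _ (fun _ _ => rfl) (by simp [Instr.run]) (by simp [hw, e])
    · have e : m + 1 ≠ w := by
        simp [Test.Holds, Instr.run, g63, hi, g4] at c1; omega
      exact hmain _ (fun _ _ => rfl) (by simp [Instr.run]) (by simp [hw, e])
  · intro s1 _ _ h
    refine Run.nil (h.trans ?_)
    rw [Finset.ext_iff]
    exact ⟨fun h v => h v v.2, fun h v _ => h v⟩

/-- Register `69` becomes the code of the set at the address in register `61`, with an additional
name in register `63`. -/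
def findProg : Prog := seqs [
  .iadd 69 6 3, .iadd 64 19 3,
  forLoop 65 6 (seqs [eqProg, .ite (.ile 66 3) (.iadd 69 65 3) .skip, .iadd 64 64 5])]

theorem run_find {X d a e w : ℕ} [NeZero X] (hX : (n + 1) ^ d ≤ X) (hn : n ≤ X) {s : State}
    (h0 : s.ireg 0 = n) (h3 : s.ireg 3 = 0) (h4 : s.ireg 4 = 1) (h5 : s.ireg 5 = n + 1)
    (h6 : s.ireg 6 = (n + 1) ^ d) (h19 : s.ireg 19 = a) (h61 : s.ireg 61 = a + e * (n + 1))
    (h63 : s.ireg 63 = w) (he : e < (n + 1) ^ d)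
    (hM : ∀ e < (n + 1) ^ d, MemRow n d s.imem a e) :
    Run X findProg s (fun s' => s'.ireg 69 = rep d (tupleSet n d e ∪ nameSet n w)) := by
  unfold findProg
  refine Run.instr_cons (Run.instr_cons (Run.cons ?_))
  refine Run.forLoop (fun m s' => s'.ireg 64 = a + m * (n + 1) ∧
      s'.ireg 69 = repUpTo d (tupleSet n d e ∪ nameSet n w) m)
    (N := (n + 1) ^ d) (by simp [Instr.run, h6]) hX (by simp [Instr.run, h4]) (by decide) ?_ ?_ ?_
  · simp [Instr.run, State.seti, h19, h3, h6, repUpTo]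
  · rintro m s1 hm hf hi ⟨i64, i69⟩
    have g0 : s1.ireg 0 = n := by rw [hf.ir 0 (by decide)]; simp [Instr.run, h0]
    have g3 : s1.ireg 3 = 0 := by rw [hf.ir 3 (by decide)]; simp [Instr.run, h3]
    have g4 : s1.ireg 4 = 1 := by rw [hf.ir 4 (by decide)]; simp [Instr.run, h4]
    have g5 : s1.ireg 5 = n + 1 := by rw [hf.ir 5 (by decide)]; simp [Instr.run, h5]
    have g61 : s1.ireg 61 = a + e * (n + 1) := by rw [hf.ir 61 (by decide)]; simp [Instr.run, h61]
    have g63 : s1.ireg 63 = w := by rw [hf.ir 63 (by decide)]; simp [Instr.run, h63]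
    have gim : s1.imem = s.imem := by rw [hf.im (by decide)]; simp [Instr.run]
    refine Run.cons ((run_eq (e' := m) hn g0 g4 g61 i64 g63 (by rw [gim]; exact hM e he)
      (by rw [gim]; exact hM m hm)).mono fun s2 hf2 hp => ?_)
    have k3 : s2.ireg 3 = 0 := by rw [hf2.ir 3 (by decide), g3]
    have k5 : s2.ireg 5 = n + 1 := by rw [hf2.ir 5 (by decide), g5]
    have k64 : s2.ireg 64 = a + m * (n + 1) := by rw [hf2.ir 64 (by decide), i64]
    have k65 : s2.ireg 65 = m := by rw [hf2.ir 65 (by decide), hi]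
    have k69 : s2.ireg 69 = _ := (hf2.ir 69 (by decide)).trans i69
    refine Run.cons (Run.ite (fun c => Run.instr (Run.instr_cons (Run.nil ?_)))
      fun c => Run.skip (Run.instr_cons (Run.nil ?_)))
    · have c' : tupleSet n d m = tupleSet n d e ∪ nameSet n w :=
        hp.1 (by simpa [Test.Holds, k3] using c)
      simp [Instr.run, State.seti, k64, k5, k65, k3, repUpTo, c']; ring
    · have c' : ¬ tupleSet n d m = tupleSet n d e ∪ nameSet n w := fun h => by
        have := hp.2 h
        simp [Test.Holds, k3, this] at c
      simp [Instr.run, State.seti, k64, k5, k69, repUpTo, c']; ring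
  · rintro s1 - - ⟨-, h⟩
    exact Run.nil h

/-- Writes the insertion table to the address in register `10`. -/
def insProg : Prog := seqs [
  .iadd 60 10 3, .iadd 61 19 3,
  forLoop 62 6 (seqs [
    forLoop 63 5 (seqs [findProg, .istore 60 69, .iadd 60 60 4]), .iadd 61 61 5])]

theorem run_ins {X d a b : ℕ} [NeZero X] (hX : (n + 1) ^ d ≤ X) (hn : n + 1 ≤ X) {s : State}
    (h0 : s.ireg 0 = n) (h3 : s.ireg 3 = 0) (h4 : s.ireg 4 = 1) (h5 : s.ireg 5 = n + 1)
    (h6 : s.ireg 6 = (n + 1) ^ d) (h19 : s.ireg 19 = a) (h10 : s.ireg 10 = b)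
    (hab : b + (n + 1) ^ d * (n + 1) ≤ a) (hM : ∀ e < (n + 1) ^ d, MemRow n d s.imem a e) :
    Run X insProg s (fun s' => InsTable n d s'.imem b) := by
  unfold insProg
  refine Run.instr_cons (Run.instr_cons (Run.cons ?_))
  refine Run.forLoop (fun m s' => s'.ireg 60 = b + m * (n + 1) ∧ s'.ireg 61 = a + m * (n + 1) ∧
      (∀ e < m, ∀ w ≤ n,
        s'.imem (b + e * (n + 1) + w) = rep d (tupleSet n d e ∪ nameSet n w)) ∧
      ∀ x, a ≤ x → s'.imem x = s.imem x)
    (N := (n + 1) ^ d) (by simp [Instr.run, h6]) hX (by simp [Instr.run, h4]) (by decide) ?_ ?_ ?_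
  · refine ⟨by simp [Instr.run, State.seti, h10, h3], by simp [Instr.run, State.seti, h19, h3],
      fun e he => absurd he (Nat.not_lt_zero _), fun x _ => by simp [Instr.run, State.seti]⟩
  · rintro m s1 hm hf hi ⟨i60, i61, itab, ifr⟩
    have g0 : s1.ireg 0 = n := by rw [hf.ir 0 (by decide)]; simp [Instr.run, h0]
    have g3 : s1.ireg 3 = 0 := by rw [hf.ir 3 (by decide)]; simp [Instr.run, h3]
    have g4 : s1.ireg 4 = 1 := by rw [hf.ir 4 (by decide)]; simp [Instr.run, h4]
    have g5 : s1.ireg 5 = n + 1 := by rw [hf.ir 5 (by decide)]; simp [Instr.run, h5]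
    have g6 : s1.ireg 6 = (n + 1) ^ d := by rw [hf.ir 6 (by decide)]; simp [Instr.run, h6]
    have g19 : s1.ireg 19 = a := by rw [hf.ir 19 (by decide)]; simp [Instr.run, h19]
    have hmQ : m * (n + 1) + (n + 1) ≤ (n + 1) ^ d * (n + 1) := by
      rw [← Nat.succ_mul]; exact Nat.mul_le_mul_right _ hm
    refine Run.cons ?_
    refine Run.forLoop (fun q s' => s'.ireg 60 = b + m * (n + 1) + q ∧
        (∀ e < m, ∀ w ≤ n,
          s'.imem (b + e * (n + 1) + w) = rep d (tupleSet n d e ∪ nameSet n w)) ∧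
        (∀ w < q, s'.imem (b + m * (n + 1) + w) = rep d (tupleSet n d m ∪ nameSet n w)) ∧
        ∀ x, a ≤ x → s'.imem x = s.imem x)
      (N := n + 1) g5 hn g4 (by decide) ?_ ?_ ?_
    · exact ⟨by simp [State.seti, i60], by simpa [State.seti] using itab,
        fun w hw => absurd hw (Nat.not_lt_zero _), by simpa [State.seti] using ifr⟩
    · rintro q s2 hq hf2 hi2 ⟨j60, j1, j2, j3⟩
      have k0 : s2.ireg 0 = n := by rw [hf2.ir 0 (by decide), g0]
      have k3 : s2.ireg 3 = 0 := by rw [hf2.ir 3 (by decide), g3]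
      have k4 : s2.ireg 4 = 1 := by rw [hf2.ir 4 (by decide), g4]
      have k5 : s2.ireg 5 = n + 1 := by rw [hf2.ir 5 (by decide), g5]
      have k6 : s2.ireg 6 = (n + 1) ^ d := by rw [hf2.ir 6 (by decide), g6]
      have k19 : s2.ireg 19 = a := by rw [hf2.ir 19 (by decide), g19]
      have k61 : s2.ireg 61 = a + m * (n + 1) := by rw [hf2.ir 61 (by decide), i61]
      refine Run.cons ((run_find (n := n) (d := d) (a := a) (e := m) (w := q) hX (by omega) k0 k3 k4 k5 k6
        k19 k61 hi2 hm fun e he v => ?_).mono fun s3 hf3 h69 => ?_)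
      · rw [j3 _ (by omega)]; exact hM e he v
      have l60 : s3.ireg 60 = b + m * (n + 1) + q := by rw [hf3.ir 60 (by decide), j60]
      have l4 : s3.ireg 4 = 1 := by rw [hf3.ir 4 (by decide), k4]
      have lim : s3.imem = s2.imem := hf3.im (by decide)
      have hmem : ∀ x, (((Instr.iadd 60 60 4).run ((Instr.istore 60 69).run s3)).seti 63
          (q + 1)).imem x = if x = b + m * (n + 1) + q then
          rep d (tupleSet n d m ∪ nameSet n q) else s2.imem x := by
        intro x
        simp [Instr.run, State.seti, l60, h69, lim, Function.update_apply]
      refine Run.instr_cons (Run.instr_cons (Run.nil ⟨?_, ?_, ?_, ?_⟩))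
      · simp [Instr.run, State.seti, l60, l4]; ring
      · intro e he w hw
        have : e * (n + 1) + (n + 1) ≤ m * (n + 1) := by
          rw [← Nat.succ_mul]; exact Nat.mul_le_mul_right _ he
        rw [hmem, if_neg (by omega)]
        exact j1 e he w hw
      · intro w hw
        rw [hmem]
        split_ifs with h
        · obtain rfl : w = q := by omega
          rfl
        · exact j2 w (by omega)
      · intro x hx
        rw [hmem, if_neg (by omega)]
        exact j3 x hx
    · rintro s2 hf2 - ⟨j60, j1, j2, j3⟩
      have k5 : s2.ireg 5 = n + 1 := by rw [hf2.ir 5 (by decide), g5]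
      have k61 : s2.ireg 61 = a + m * (n + 1) := by rw [hf2.ir 61 (by decide), i61]
      refine Run.instr_cons (Run.nil ⟨?_, ?_, ?_, j3⟩)
      · simp [Instr.run, State.seti, j60]; ring
      · simp [Instr.run, State.seti, k61, k5]; ring
      · intro e he w hw
        rcases Nat.lt_or_ge e m with h | h
        · exact j1 e h w hw
        · obtain rfl : e = m := by omega
          exact j2 w (by omega)
  · rintro s1 - - ⟨-, -, h, -⟩
    exact Run.nil h

end PTFReg

namespace PTFReg

variable {n k : ℕ}

/-! ### Parameters of the algorithm -/

/-- Register `32` becomes the number in register `30` to the power in register `31`. -/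
def powProg : Prog := seqs [.iconst 32 1, forLoop 33 31 (.imul 32 32 30)]

theorem run_pow {X a m : ℕ} [NeZero X] {s : State} (h4 : s.ireg 4 = 1) (h30 : s.ireg 30 = a)
    (h31 : s.ireg 31 = m) (hm : m ≤ X) : Run X powProg s (fun s' => s'.ireg 32 = a ^ m) := by
  unfold powProg
  refine Run.instr_cons (Run.cons (Run.forLoop (fun i s' => s'.ireg 32 = a ^ i) (N := m)
    (by simp [Instr.run, h31]) hm (by simp [Instr.run, h4]) (by decide)
    (by simp [Instr.run, State.seti]) ?_ fun _ _ _ h => Run.nil h))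
  intro i s1 _ hf _ hI
  have g30 : s1.ireg 30 = a := by rw [hf.ir 30 (by decide)]; simp [Instr.run, h30]
  refine Run.instr ?_
  simp [Instr.run, State.seti, hI, g30, pow_succ]

/-- Register `16` becomes the least `m` such that `2 ^ m` is at least the inverse of the number in
the real register `7`. -/
def logProg : Prog := seqs [
  .rconst 3 1, .rdiv 4 3 7, .rconst 5 1, .rconst 6 2, .iconst 16 0,
  .while (.rlt 5 4) (seqs [.iadd 16 16 4, .rmul 5 5 6])]

theorem run_log {X m : ℕ} [NeZero X] {x : ℝ} (h1 : 1 / x ≤ 2 ^ m)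
    (h2 : ∀ m' < m, (2:ℝ) ^ m' < 1 / x) (hm : m ≤ X) {s : State} (h4 : s.ireg 4 = 1)
    (h7 : s.rreg 7 = x) : Run X logProg s (fun s' => s'.ireg 16 = m) := by
  unfold logProg
  refine Run.instr_cons (Run.instr_cons (Run.instr_cons (Run.instr_cons (Run.instr_cons
    (Run.cons (Run.while (fun v s' => ∃ q, q + v = m ∧ s'.ireg 16 = q ∧ s'.rreg 5 = 2 ^ q ∧
      s'.rreg 4 = 1 / x ∧ s'.rreg 6 = 2 ∧ s'.ireg 4 = 1) (m := m) hm
      ⟨0, by omega, ?_, ?_, ?_, ?_, ?_⟩ ?_ ?_))))))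
  · simp [Instr.run]
  · simp [Instr.run]
  · simp [Instr.run, h7]
  · simp [Instr.run]
  · simp [Instr.run, h4]
  · rintro v s1 - ⟨q, hq, i16, i5, i4, i6, j4⟩ hc
    have hc' : (2:ℝ) ^ q < 1 / x := by simpa only [Test.Holds, i5, i4] using hc
    have hv : v ≠ 0 := by
      rintro rfl
      obtain rfl : q = m := by omega
      exact absurd h1 (not_le.2 hc')
    refine Run.instr_cons (Run.instr_cons (Run.nil
      ⟨v - 1, by omega, q + 1, by omega, ?_, ?_, ?_, ?_, ?_⟩))
    · simp [Instr.run, i16, j4]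
    · simp [Instr.run, i5, i6, pow_succ]
    · simpa [Instr.run] using i4
    · simp [Instr.run, i6]
    · simp [Instr.run, j4]
  · rintro v s1 - ⟨q, hq, i16, i5, i4, -, -⟩ hc
    have hc' : ¬ (2:ℝ) ^ q < 1 / x := by simpa only [Test.Holds, i5, i4] using hc
    refine Run.nil ?_
    rw [i16]
    by_contra hne
    exact hc' (h2 q (by omega))

/-- Register `15` is increased to at least the inverse of the number in the real register `0`. -/
def ceilProg : Prog := seqs [
  .rconst 3 1, .rdiv 4 3 0, .rofNat 5 15,
  .while (.rlt 5 4) (seqs [.iadd 15 15 4, .radd 5 5 3])]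

/-- Counting up from the approximation for ε already in the register yields the maximum of both
approximations at once, without a rounding instruction. -/
theorem run_ceil {X m : ℕ} [NeZero X] {x : ℝ} (hX : max m ⌈1 / x⌉₊ ≤ X) {s : State}
    (h4 : s.ireg 4 = 1) (h0 : s.rreg 0 = x) (h15 : s.ireg 15 = m) :
    Run X ceilProg s (fun s' => s'.ireg 15 = max m ⌈1 / x⌉₊) := by
  unfold ceilProg
  refine Run.instr_cons (Run.instr_cons (Run.instr_cons
    (Run.cons (Run.while (fun v s' => ∃ q, q + v = max m ⌈1 / x⌉₊ ∧ m ≤ q ∧ s'.ireg 15 = q ∧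
      s'.rreg 5 = q ∧ s'.rreg 4 = 1 / x ∧ s'.rreg 3 = 1 ∧ s'.ireg 4 = 1)
      (m := max m ⌈1 / x⌉₊ - m) (by omega)
      ⟨m, by omega, le_rfl, ?_, ?_, ?_, ?_, ?_⟩ ?_ ?_))))
  · simp [Instr.run, h15]
  · simp [Instr.run, h15]
  · simp [Instr.run, h0]
  · simp [Instr.run]
  · simp [Instr.run, h4]
  · rintro v s1 - ⟨q, hq, hmq, i16, i5, i4, i6, j4⟩ hc
    have hc' : (q:ℝ) < 1 / x := by simpa only [Test.Holds, i5, i4] using hc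
    have := Nat.lt_ceil.2 hc'
    refine Run.instr_cons (Run.instr_cons (Run.nil
      ⟨v - 1, by omega, q + 1, by omega, by omega, ?_, ?_, ?_, ?_, ?_⟩))
    · simp [Instr.run, i16, j4]
    · simp [Instr.run, i5, i6]
    · simpa [Instr.run] using i4
    · simp [Instr.run, i6]
    · simp [Instr.run, j4]
  · rintro v s1 - ⟨q, hq, hmq, i16, i5, i4, -, -⟩ hc
    have hc' : ¬ (q:ℝ) < 1 / x := by simpa only [Test.Holds, i5, i4] using hc
    have := Nat.ceil_le.2 (not_lt.1 hc')
    refine Run.nil ?_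
    rw [i16]
    omega

/-- Register `35` becomes the length of the phases. -/
def sumProg : Prog := seqs [
  .iadd 34 8 3, .iconst 35 0,
  forLoop 36 1 (seqs [
    .imul 37 34 34, .imul 37 37 34, .iadd 35 35 37,
    .imul 34 34 34, .imul 34 34 34, .imul 34 34 34, .imul 34 34 34])]

theorem run_sum {X B : ℕ} [NeZero X] (hk : k ≤ X) {s : State} (h1 : s.ireg 1 = k)
    (h3 : s.ireg 3 = 0) (h4 : s.ireg 4 = 1) (h8 : s.ireg 8 = B) :
    Run X sumProg s (fun s' => s'.ireg 35 = ∑ i ∈ Finset.range k, (B ^ 16 ^ i) ^ 3) := by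
  unfold sumProg
  refine Run.instr_cons (Run.instr_cons (Run.cons (Run.forLoop (fun m s' =>
    s'.ireg 34 = B ^ 16 ^ m ∧ s'.ireg 35 = ∑ i ∈ Finset.range m, (B ^ 16 ^ i) ^ 3) (N := k)
    (by simp [Instr.run, h1]) hk (by simp [Instr.run, h4]) (by decide)
    (by simp [Instr.run, State.seti, h8, h3]) ?_ fun _ _ _ h => Run.nil h.2)))
  rintro m s1 _ hf _ ⟨i1, i2⟩
  refine Run.instr_cons (Run.instr_cons (Run.instr_cons (Run.instr_cons (Run.instr_cons
    (Run.instr_cons (Run.instr_cons (Run.nil ⟨?_, ?_⟩)))))))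
  · simp [Instr.run, State.seti, i1]
    rw [pow_succ, pow_mul]; ring
  · rw [Finset.sum_range_succ]
    simp [Instr.run, State.seti, i1, i2]; ring

theorem length_sched' (B k R : ℕ) :
    (sched B k R).length = R * ∑ i ∈ Finset.range k, (B ^ 16 ^ i) ^ 3 := by
  rw [length_sched, ← Fin.sum_univ_def, Fin.sum_univ_eq_sum_range (fun j => lev B k (j + 1) ^ 3),
    ← Finset.sum_range_reflect]
  congr 1
  refine Finset.sum_congr rfl fun i hi => ?_
  have := Finset.mem_range.1 hi
  unfold lev
  congr 3
  omega

/-- The number of entries of the insertion table. -/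
def insSize (n d : ℕ) : ℕ := (n + 1) ^ d * (n + 1)

/-- Computes the parameters and the addresses of the memory areas. -/
def paramProg : Prog := seqs [
  .iconst 3 0, .iconst 4 1, .iadd 5 0 4, .rconst 8 0,
  .iadd 30 5 3, .iadd 31 2 3, powProg, .iadd 6 32 3, .imul 7 1 6,
  .radd 7 1 8, logProg, .iadd 15 16 3, ceilProg, .radd 7 2 8, logProg,
  .iconst 30 1024, .imul 31 15 1, .imul 31 31 2, .imul 30 31 30, .iadd 31 2 4, powProg,
  .iadd 8 32 3,
  .iadd 30 8 3, .iadd 31 1 3, powProg, .imul 17 32 16,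
  sumProg, .imul 18 17 35,
  .iadd 10 18 4, .imul 30 6 5, .iadd 19 10 30, .iadd 12 19 30, .iadd 13 12 18, .iadd 13 13 18,
  .iadd 30 18 4, .iadd 30 30 4, .imul 14 30 7]

/-- With N the length of the schedule, the memory for naturals holds, in this order, N + 1 cells for
the stack, the insertion table, the membership table, 2N cells for the schedule, and the output. The
real memory has room for N + 2 tuples of tables before its output. -/
theorem run_param {X d L K : ℕ} [NeZero X] {τ ε δ : ℝ} {L₁ : ℕ}
    (hε : 1 / ε ≤ 2 ^ L₁) (hε' : ∀ m' < L₁, (2:ℝ) ^ m' < 1 / ε)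
    (hδ : 1 / δ ≤ 2 ^ K) (hδ' : ∀ m' < K, (2:ℝ) ^ m' < 1 / δ)
    (hL : L = max L₁ ⌈1 / τ⌉₊) (hLX : L ≤ X) (hKX : K ≤ X) (hdX : d + 1 ≤ X) (hkX : k ≤ X)
    {s : State} (h0 : s.ireg 0 = n) (h1 : s.ireg 1 = k) (h2 : s.ireg 2 = d)
    (r0 : s.rreg 0 = τ) (r1 : s.rreg 1 = ε) (r2 : s.rreg 2 = δ) :
    Run X paramProg s (fun s' =>
      Ctx n k d (base L k d) (total L K k d + 1) (total L K k d + 1 + insSize n d + insSize n d)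
        (total L K k d + 1 + insSize n d + insSize n d + total L K k d + total L K k d)
        ((total L K k d + 1 + 1) * (k * (n + 1) ^ d)) s' ∧
      s'.ireg 2 = d ∧ s'.ireg 17 = rounds L K k d ∧ s'.ireg 18 = total L K k d ∧
      s'.ireg 19 = total L K k d + 1 + insSize n d) := by
  unfold paramProg
  refine Run.instr_cons (Run.instr_cons (Run.instr_cons (Run.instr_cons (Run.instr_cons
    (Run.instr_cons (Run.cons ((run_pow (a := n + 1) (m := d) (by simp [Instr.run])
      (by simp [Instr.run, h0]) (by simp [Instr.run, h2]) (by omega)).mono fun s1 f1 p1 => ?_)))))))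
  have a0 : s1.ireg 0 = n := by rw [f1.ir 0 (by decide)]; simp [Instr.run, h0]
  have a1 : s1.ireg 1 = k := by rw [f1.ir 1 (by decide)]; simp [Instr.run, h1]
  have a2 : s1.ireg 2 = d := by rw [f1.ir 2 (by decide)]; simp [Instr.run, h2]
  have a3 : s1.ireg 3 = 0 := by rw [f1.ir 3 (by decide)]; simp [Instr.run]
  have a4 : s1.ireg 4 = 1 := by rw [f1.ir 4 (by decide)]; simp [Instr.run]
  have a5 : s1.ireg 5 = n + 1 := by rw [f1.ir 5 (by decide)]; simp [Instr.run, h0]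
  have q0 : s1.rreg 0 = τ := by rw [f1.rr 0 (by decide)]; simp [Instr.run, r0]
  have q1 : s1.rreg 1 = ε := by rw [f1.rr 1 (by decide)]; simp [Instr.run, r1]
  have q2 : s1.rreg 2 = δ := by rw [f1.rr 2 (by decide)]; simp [Instr.run, r2]
  have q8 : s1.rreg 8 = 0 := by rw [f1.rr 8 (by decide)]; simp [Instr.run]
  refine Run.instr_cons (Run.instr_cons (Run.instr_cons (Run.cons ((run_log hε hε' (by omega)
    (by simp [Instr.run, a4]) (by simp [Instr.run, q1, q8])).mono fun s2 f2 p2 => ?_))))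
  have b0 : s2.ireg 0 = n := by rw [f2.ir 0 (by decide)]; simp [Instr.run, a0]
  have b1 : s2.ireg 1 = k := by rw [f2.ir 1 (by decide)]; simp [Instr.run, a1]
  have b2 : s2.ireg 2 = d := by rw [f2.ir 2 (by decide)]; simp [Instr.run, a2]
  have b3 : s2.ireg 3 = 0 := by rw [f2.ir 3 (by decide)]; simp [Instr.run, a3]
  have b4 : s2.ireg 4 = 1 := by rw [f2.ir 4 (by decide)]; simp [Instr.run, a4]
  have b5 : s2.ireg 5 = n + 1 := by rw [f2.ir 5 (by decide)]; simp [Instr.run, a5]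
  have b6 : s2.ireg 6 = (n + 1) ^ d := by rw [f2.ir 6 (by decide)]; simp [Instr.run, p1, a3]
  have b7 : s2.ireg 7 = k * (n + 1) ^ d := by
    rw [f2.ir 7 (by decide)]; simp [Instr.run, p1, a3, a1]
  have q0 : s2.rreg 0 = τ := by rw [f2.rr 0 (by decide)]; simp [Instr.run, q0]
  have q2 : s2.rreg 2 = δ := by rw [f2.rr 2 (by decide)]; simp [Instr.run, q2]
  have q8 : s2.rreg 8 = 0 := by rw [f2.rr 8 (by decide)]; simp [Instr.run, q8]
  refine Run.instr_cons (Run.cons ((run_ceil (m := L₁) (x := τ) (by omega) (by simp [Instr.run, b4])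
    (by simp [Instr.run, q0]) (by simp [Instr.run, p2, b3])).mono fun s3 f3 p3 => ?_))
  rw [← hL] at p3
  have c1 : s3.ireg 1 = k := by rw [f3.ir 1 (by decide)]; simp [Instr.run, b1]
  have c2 : s3.ireg 2 = d := by rw [f3.ir 2 (by decide)]; simp [Instr.run, b2]
  have c3 : s3.ireg 3 = 0 := by rw [f3.ir 3 (by decide)]; simp [Instr.run, b3]
  have c4 : s3.ireg 4 = 1 := by rw [f3.ir 4 (by decide)]; simp [Instr.run, b4]
  have q2 : s3.rreg 2 = δ := by rw [f3.rr 2 (by decide)]; simp [Instr.run, q2]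
  have q8 : s3.rreg 8 = 0 := by rw [f3.rr 8 (by decide)]; simp [Instr.run, q8]
  refine Run.instr_cons (Run.cons ((run_log hδ hδ' hKX
    (by simp [Instr.run, c4]) (by simp [Instr.run, q2, q8])).mono fun s4 f4 p4 => ?_))
  have d1 : s4.ireg 1 = k := by rw [f4.ir 1 (by decide)]; simp [Instr.run, c1]
  have d2 : s4.ireg 2 = d := by rw [f4.ir 2 (by decide)]; simp [Instr.run, c2]
  have d3 : s4.ireg 3 = 0 := by rw [f4.ir 3 (by decide)]; simp [Instr.run, c3]
  have d4 : s4.ireg 4 = 1 := by rw [f4.ir 4 (by decide)]; simp [Instr.run, c4]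
  have d15 : s4.ireg 15 = L := by rw [f4.ir 15 (by decide)]; simp [Instr.run, p3]
  refine Run.instr_cons (Run.instr_cons (Run.instr_cons (Run.instr_cons (Run.instr_cons
    (Run.cons ((run_pow (a := L * k * d * 1024) (m := d + 1) (by simp [Instr.run, d4])
      (by simp [Instr.run, d15, d1, d2]) (by simp [Instr.run, d2, d4]) hdX).mono
      fun s5 f5 p5 => ?_))))))
  change s5.ireg 32 = base L k d at p5
  have e1 : s5.ireg 1 = k := by rw [f5.ir 1 (by decide)]; simp [Instr.run, d1]
  have e3 : s5.ireg 3 = 0 := by rw [f5.ir 3 (by decide)]; simp [Instr.run, d3]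
  have e4 : s5.ireg 4 = 1 := by rw [f5.ir 4 (by decide)]; simp [Instr.run, d4]
  have e16 : s5.ireg 16 = K := by rw [f5.ir 16 (by decide)]; simp [Instr.run, p4]
  refine Run.instr_cons (Run.instr_cons (Run.instr_cons (Run.cons ((run_pow (a := base L k d)
    (m := k) (by simp [Instr.run, e4]) (by simp [Instr.run, p5, e3]) (by simp [Instr.run, e1, e3])
    hkX).mono fun s6 f6 p6 => ?_))))
  have g1 : s6.ireg 1 = k := by rw [f6.ir 1 (by decide)]; simp [Instr.run, e1]
  have g3 : s6.ireg 3 = 0 := by rw [f6.ir 3 (by decide)]; simp [Instr.run, e3]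
  have g4 : s6.ireg 4 = 1 := by rw [f6.ir 4 (by decide)]; simp [Instr.run, e4]
  have g8 : s6.ireg 8 = base L k d := by rw [f6.ir 8 (by decide)]; simp [Instr.run, p5, e3]
  have g16 : s6.ireg 16 = K := by rw [f6.ir 16 (by decide)]; simp [Instr.run, e16]
  refine Run.instr_cons (Run.cons ((run_sum (k := k) (B := base L k d) hkX (by simp [Instr.run, g1])
    (by simp [Instr.run, g3]) (by simp [Instr.run, g4]) (by simp [Instr.run, g8])).mono
    fun s7 f7 p7 => ?_))
  have f47 : ∀ x, powProg.wi x = false → sumProg.wi x = false → logProg.wi x = false →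
      x ≠ 8 → x ≠ 17 → x ≠ 30 → x ≠ 31 → s7.ireg x = s3.ireg x := by
    intro x u1 u2 u3 u4 u5 u6 u7
    rw [f7.ir x u2]; simp only [Instr.run]; rw [Function.update_of_ne u5, f6.ir x u1]
    simp only [Instr.run]
    rw [Function.update_of_ne u7, Function.update_of_ne u6, Function.update_of_ne u4, f5.ir x u1]
    simp only [Instr.run]
    rw [Function.update_of_ne u7, Function.update_of_ne u6, Function.update_of_ne u7,
      Function.update_of_ne u7, Function.update_of_ne u6, f4.ir x u3]
    simp only [Instr.run]
  have t0 : s7.ireg 0 = n := by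
    rw [f47 0 (by decide) (by decide) (by decide) (by decide) (by decide) (by decide) (by decide),
      f3.ir 0 (by decide)]; simp [Instr.run, b0]
  have t1 : s7.ireg 1 = k := by rw [f7.ir 1 (by decide)]; simp [Instr.run, g1]
  have t2 : s7.ireg 2 = d := by
    rw [f47 2 (by decide) (by decide) (by decide) (by decide) (by decide) (by decide) (by decide),
      c2]
  have t3 : s7.ireg 3 = 0 := by rw [f7.ir 3 (by decide)]; simp [Instr.run, g3]
  have t4 : s7.ireg 4 = 1 := by rw [f7.ir 4 (by decide)]; simp [Instr.run, g4]
  have t5 : s7.ireg 5 = n + 1 := by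
    rw [f47 5 (by decide) (by decide) (by decide) (by decide) (by decide) (by decide) (by decide),
      f3.ir 5 (by decide)]; simp [Instr.run, b5]
  have t6 : s7.ireg 6 = (n + 1) ^ d := by
    rw [f47 6 (by decide) (by decide) (by decide) (by decide) (by decide) (by decide) (by decide),
      f3.ir 6 (by decide)]; simp [Instr.run, b6]
  have t7 : s7.ireg 7 = k * (n + 1) ^ d := by
    rw [f47 7 (by decide) (by decide) (by decide) (by decide) (by decide) (by decide) (by decide),
      f3.ir 7 (by decide)]; simp [Instr.run, b7]
  have t8 : s7.ireg 8 = base L k d := by rw [f7.ir 8 (by decide)]; simp [Instr.run, g8]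
  have t17 : s7.ireg 17 = rounds L K k d := by
    rw [f7.ir 17 (by decide)]; simp [Instr.run, p6, g16, rounds]
  have hN : rounds L K k d * s7.ireg 35 = total L K k d := by
    rw [p7, total, length_sched']
  set N := total L K k d with hN'
  refine Run.instr_cons (Run.instr_cons (Run.instr_cons (Run.instr_cons (Run.instr_cons
    (Run.instr_cons (Run.instr_cons (Run.instr_cons (Run.instr_cons (Run.instr_cons
    (Run.nil ⟨⟨?_, ?_, ?_, ?_, ?_, ?_, ?_, ?_, ?_, ?_, ?_, ?_⟩, ?_, ?_, ?_, ?_⟩))))))))))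
  all_goals simp [Instr.run, t0, t1, t2, t3, t4, t5, t6, t7, t8, t17, hN, insSize]

/-! ### The schedule -/

/-- The pairs in the schedule as a list of numbers. -/
def enc (W : List (Fin k × ℕ)) : List ℕ := W.flatMap fun x => [(x.1 : ℕ), x.2]

theorem enc_append (W₁ W₂ : List (Fin k × ℕ)) : enc (W₁ ++ W₂) = enc W₁ ++ enc W₂ := by
  simp [enc]

theorem schedTable_of_stores {mem : ℕ → ℕ} {a : ℕ} {W : List (Fin k × ℕ)}
    (h : Stores mem a (enc W)) : SchedTable mem a W := by
  induction W generalizing a with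
  | nil => intro x hx; simp at hx
  | cons y W ih =>
    rw [show enc (y :: W) = (y.1 : ℕ) :: y.2 :: enc W from rfl, stores_cons, stores_cons] at h
    intro x hx
    cases x with
    | zero => exact ⟨h.1, h.2.1⟩
    | succ x =>
      have := ih h.2.2 x (by simpa using hx)
      rw [show a + 2 * (x + 1) = a + 1 + 1 + 2 * x by ring]
      exact this

/-- The list `L` has been written to the address `a`; register `60` is the address for the next
number. -/
structure Wrote (a : ℕ) (im : ℕ → ℕ) (L : List ℕ) (s : State) : Prop where
  ptr : s.ireg 60 = a + L.length
  out : Stores s.imem a L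
  old : ∀ x < a, s.imem x = im x

theorem Wrote.congr {a : ℕ} {im : ℕ → ℕ} {L : List ℕ} {s s' : State} (h : Wrote a im L s)
    (h1 : s'.ireg 60 = s.ireg 60) (h2 : s'.imem = s.imem) : Wrote a im L s' :=
  ⟨h1.trans h.ptr, by rw [h2]; exact h.out, by rw [h2]; exact h.old⟩

theorem Wrote.store {a : ℕ} {im : ℕ → ℕ} {L : List ℕ} {s : State} (h : Wrote a im L s)
    (h4 : s.ireg 4 = 1) (r : ℕ) :
    Wrote a im (L ++ [s.ireg r]) ((Instr.iadd 60 60 4).run ((Instr.istore 60 r).run s)) := by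
  have hm : ∀ x, x ≠ a + L.length →
      ((Instr.iadd 60 60 4).run ((Instr.istore 60 r).run s)).imem x = s.imem x := by
    intro x hx
    simp [Instr.run, h.ptr, Function.update_of_ne hx]
  refine ⟨?_, ?_, ?_⟩
  · simp [Instr.run, h.ptr, h4]; ring
  · rw [stores_append, stores_cons]
    refine ⟨h.out.congr fun x _ hx => hm x (by omega), ?_, stores_nil _ _⟩
    simp [Instr.run, h.ptr]
  · intro x hx
    rw [hm x (by omega), h.old x hx]

/-- The phases in the order in which they are written. -/
def revPhases (B k m : ℕ) : List (Fin k × ℕ) :=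
  ((List.finRange k).take m).flatMap fun i : Fin k =>
    List.replicate ((B ^ 16 ^ (i : ℕ)) ^ 3) (i.rev, B ^ 16 ^ (i : ℕ))

theorem revPhases_succ {B m : ℕ} (h : m < k) : revPhases B k (m + 1)
    = revPhases B k m ++ List.replicate ((B ^ 16 ^ m) ^ 3) (Fin.rev ⟨m, h⟩, B ^ 16 ^ m) := by
  unfold revPhases
  rw [List.take_add_one, List.getElem?_eq_getElem (by simpa using h)]
  simp

/-- In reverse order the levels increase from B by repeated 16th powers, which four squarings
compute, and the main loop reads the steps from the end. -/
theorem reverse_phases (B k : ℕ) : (phases B k k).reverse = revPhases B k k := by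
  unfold phases revPhases
  rw [List.take_of_length_le (by simp), List.reverse_flatMap, List.finRange_reverse,
    List.flatMap_map]
  refine List.flatMap_congr fun i _ => ?_
  have : k - ((Fin.rev i : ℕ) + 1) = i := by rw [Fin.val_rev]; omega
  have h : lev B k ((Fin.rev i : ℕ) + 1) = B ^ 16 ^ (i : ℕ) := by unfold lev; rw [this]
  simp only [Function.comp, phase, h, List.reverse_replicate]

theorem reverse_sched (B k R : ℕ) :
    (sched B k R).reverse = (List.replicate R (revPhases B k k)).flatten := by
  unfold sched
  rw [List.reverse_flatten, List.map_replicate, List.reverse_replicate, reverse_phases]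

/-- Writes the schedule, in reverse order, to the address in register `12`. -/
def schedProg : Prog := seqs [
  .iadd 60 12 3,
  forLoop 61 17 (seqs [
    .iadd 34 8 3, .iadd 62 1 3,
    forLoop 63 1 (seqs [
      .isub 62 62 4, .imul 37 34 34, .imul 37 37 34,
      forLoop 64 37 (seqs [.istore 60 62, .iadd 60 60 4, .istore 60 34, .iadd 60 60 4]),
      .imul 34 34 34, .imul 34 34 34, .imul 34 34 34, .imul 34 34 34])])]

theorem run_sched {X B R a : ℕ} [NeZero X] (hk : k ≤ X) (hR : R ≤ X)
    (hB : ∀ i < k, (B ^ 16 ^ i) ^ 3 ≤ X) {s : State} (h1 : s.ireg 1 = k)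
    (h3 : s.ireg 3 = 0) (h4 : s.ireg 4 = 1) (h8 : s.ireg 8 = B) (h12 : s.ireg 12 = a)
    (h17 : s.ireg 17 = R) :
    Run X schedProg s (fun s' => SchedTable s'.imem a (sched B k R).reverse ∧
      ∀ x < a, s'.imem x = s.imem x) := by
  unfold schedProg
  refine Run.instr_cons (Run.cons (Run.forLoop (fun m s' => Wrote a s.imem
    (enc (List.replicate m (revPhases B k k)).flatten) s') (N := R)
    (by simp [Instr.run, h17]) hR (by simp [Instr.run, h4]) (by decide) ?_ ?_ ?_))
  · exact ⟨by simp [Instr.run, State.seti, h12, h3, enc], stores_nil _ _,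
      fun x _ => by simp [Instr.run, State.seti]⟩
  · intro m s1 hm hf hi hI
    have g1 : s1.ireg 1 = k := by rw [hf.ir 1 (by decide)]; simp [Instr.run, h1]
    have g3 : s1.ireg 3 = 0 := by rw [hf.ir 3 (by decide)]; simp [Instr.run, h3]
    have g4 : s1.ireg 4 = 1 := by rw [hf.ir 4 (by decide)]; simp [Instr.run, h4]
    have g8 : s1.ireg 8 = B := by rw [hf.ir 8 (by decide)]; simp [Instr.run, h8]
    set L := enc (List.replicate m (revPhases B k k)).flatten with hL
    refine Run.instr_cons (Run.instr_cons (Run.cons (Run.forLoop (fun j s' =>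
      s'.ireg 34 = B ^ 16 ^ j ∧ s'.ireg 62 = k - j ∧
      Wrote a s.imem (L ++ enc (revPhases B k j)) s') (N := k)
      (by simp [Instr.run, g1]) hk (by simp [Instr.run, g4]) (by decide) ?_ ?_ ?_)))
    · refine ⟨by simp [Instr.run, State.seti, g8, g3], by simp [Instr.run, State.seti, g1, g3], ?_⟩
      rw [show enc (revPhases B k 0) = [] by simp [revPhases, enc], List.append_nil]
      exact hI.congr (by simp [Instr.run, State.seti]) (by simp [Instr.run, State.seti])
    · rintro j s2 hj hf2 hi2 ⟨i34, i62, iw⟩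
      have k4 : s2.ireg 4 = 1 := by rw [hf2.ir 4 (by decide)]; simp [Instr.run, g4]
      refine Run.instr_cons (Run.instr_cons (Run.instr_cons (Run.cons (Run.forLoop (fun q s' =>
        Wrote a s.imem (L ++ enc (revPhases B k j) ++
          enc (List.replicate q ((Fin.rev ⟨j, hj⟩ : Fin k), B ^ 16 ^ j))) s')
        (N := (B ^ 16 ^ j) ^ 3) ?_ (hB j hj) (by simp [Instr.run, k4]) (by decide) ?_ ?_ ?_))))
      · simp [Instr.run, i34]; ring
      · refine Wrote.congr (s := s2) ?_ (by simp [Instr.run, State.seti])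
          (by simp [Instr.run, State.seti])
        simpa [enc] using iw
      · intro q s3 hq hf3 hi3 jw
        have l4 : s3.ireg 4 = 1 := by rw [hf3.ir 4 (by decide)]; simp [Instr.run, k4]
        have l34 : s3.ireg 34 = B ^ 16 ^ j := by
          rw [hf3.ir 34 (by decide)]; simp [Instr.run, i34]
        have l62 : s3.ireg 62 = (Fin.rev ⟨j, hj⟩ : Fin k) := by
          rw [hf3.ir 62 (by decide), Fin.val_rev]; simp [Instr.run, i62, k4]; omega
        refine Run.instr_cons (Run.instr_cons (Run.instr_cons (Run.instr_cons (Run.nil ?_))))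
        have w1 := (jw.store l4 62)
        have w2 := w1.store (by simp [Instr.run, l4]) 34
        rw [l62, show ((Instr.iadd 60 60 4).run ((Instr.istore 60 62).run s3)).ireg 34 = B ^ 16 ^ j by
          simp [Instr.run, l34]] at w2
        refine Wrote.congr (s := (Instr.iadd 60 60 4).run ((Instr.istore 60 34).run
          ((Instr.iadd 60 60 4).run ((Instr.istore 60 62).run s3)))) ?_
          (by simp [State.seti]) (by simp [State.seti])
        rw [List.replicate_succ', enc_append]
        simpa [enc] using w2
      · rintro s3 hf3 - jw
        have l34 : s3.ireg 34 = B ^ 16 ^ j := by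
          rw [hf3.ir 34 (by decide)]; simp [Instr.run, i34]
        have l62 : s3.ireg 62 = k - j - 1 := by
          rw [hf3.ir 62 (by decide)]; simp [Instr.run, i62, k4]
        refine Run.instr_cons (Run.instr_cons (Run.instr_cons (Run.instr_cons (Run.nil ⟨?_, ?_, ?_⟩))))
        · simp [Instr.run, State.seti, l34]
          rw [pow_succ, pow_mul]; ring
        · simp [Instr.run, State.seti, l62]; omega
        · rw [revPhases_succ hj, enc_append, ← List.append_assoc]
          exact jw.congr (by simp [Instr.run, State.seti]) (by simp [Instr.run, State.seti])
    · rintro s2 - - ⟨-, -, iw⟩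
      refine Run.nil ?_
      rw [List.replicate_succ', List.flatten_append, enc_append, List.flatten_singleton]
      exact iw.congr (by simp [State.seti]) (by simp [State.seti])
  · intro s1 _ _ hI
    rw [reverse_sched]
    exact Run.nil ⟨schedTable_of_stores hI.out, hI.old⟩

end PTFReg

namespace PTFReg

variable {n k : ℕ}

/-! ### The algorithm -/

/-- The algorithm. -/
def constructTree : Prog := seqs [
  paramProg, memProg, insProg, schedProg,
  .istore 3 18, .iadd 20 4 3, .iadd 21 13 3, .iadd 22 14 3,
  mainLoop, .iadd 0 13 3, .iadd 1 14 3]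

theorem run_constructTree {X d L K : ℕ} [NeZero X] {τ ε δ : ℝ} {L₁ : ℕ}
    (hε : 1 / ε ≤ 2 ^ L₁) (hε' : ∀ m' < L₁, (2:ℝ) ^ m' < 1 / ε)
    (hδ : 1 / δ ≤ 2 ^ K) (hδ' : ∀ m' < K, (2:ℝ) ^ m' < 1 / δ)
    (hL : L = max L₁ ⌈1 / τ⌉₊) (hL1 : 1 ≤ L) (hK1 : 1 ≤ K) (hk : 1 ≤ k) (hd : 1 ≤ d)
    (hX : X = (n + 1) ^ d * 2 ^ (total L K k d + 1))
    {p : Fin k → MPoly n} (hp : AllDeg d p) :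
    Run X constructTree (inputState d p τ ε δ) (fun s' => Outputs d s' (theTree d L K p)) := by
  have hB := base_le_total hL1 hK1 hk hd
  have hKN := K_le_total (K := K) hL1 hk hd
  have hlen : (sched (base L k d) k (rounds L K k d)).length = total L K k d := rfl
  have hbase := le_base L k d
  have hB1 := (large_base hL1 hk hd).b512
  have hR1 : 1 ≤ rounds L K k d := Nat.mul_pos (pow_pos (by omega) _) hK1
  have hRN := total_ge (K := K) hL1 hk hd
  have hterm : ∀ i < k, (base L k d ^ 16 ^ i) ^ 3 ≤ total L K k d := by
    intro i hi
    rw [total, length_sched']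
    exact (Finset.single_le_sum (f := fun i => (base L k d ^ 16 ^ i) ^ 3)
      (fun _ _ => Nat.zero_le _) (Finset.mem_range.2 hi)).trans (Nat.le_mul_of_pos_left _ hR1)
  set N := total L K k d with hN
  have hQ1 : 1 ≤ (n + 1) ^ d := Nat.one_le_pow _ _ (by omega)
  have h2N : N + 1 < 2 ^ (N + 1) := Nat.lt_two_pow_self
  have h2X : 2 ^ (N + 1) ≤ X := hX ▸ Nat.le_mul_of_pos_left _ hQ1
  have hLk : 1 ≤ L * k := Nat.mul_pos hL1 hk
  have hLkd : 1 ≤ L * k * d := Nat.mul_pos hLk hd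
  have hdN : d ≤ L * k * d := Nat.le_mul_of_pos_left _ hLk
  have hkN : L * k ≤ L * k * d := Nat.le_mul_of_pos_right _ hd
  have hkN' : k ≤ L * k := Nat.le_mul_of_pos_left _ hL1
  have hLN : L ≤ L * k := Nat.le_mul_of_pos_right _ hk
  have hQX : (n + 1) ^ d ≤ X := hX ▸ Nat.le_mul_of_pos_right _ (by positivity)
  have hnX : n + 1 ≤ X := (Nat.le_self_pow (by omega) _).trans hQX
  have hKX : k * (n + 1) ^ d ≤ X := by
    rw [hX, mul_comm]; exact Nat.mul_le_mul_left _ (by omega)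
  unfold constructTree
  refine Run.cons ((run_param (n := n) (k := k) (d := d) (K := K) hε hε' hδ hδ' hL (by omega)
    (by omega) (by omega) (by omega) (by simp [inputState]) (by simp [inputState])
    (by simp [inputState]) (by simp [inputState]) (by simp [inputState])
    (by simp [inputState])).mono ?_)
  rintro s1 f1 ⟨c1, a2, a17, a18, a19⟩
  rw [← hN] at c1 a18 a19
  have m1 : s1.imem = fun _ => 0 := f1.im (by decide)
  have w1 : s1.rmem = fun j => (tables d p).getD j 0 := f1.rm (by decide)
  refine Run.cons ((run_mem hQX (by omega) hnX c1.r0 a2 c1.r3 c1.r4 c1.r5 a19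
    (fun x => by rw [m1])).mono fun s2 f2 p2 => ?_)
  have c2 := c1.frame f2 (by decide)
  have b17 : s2.ireg 17 = rounds L K k d := by rw [f2.ir 17 (by decide), a17]
  have b18 : s2.ireg 18 = N := by rw [f2.ir 18 (by decide), a18]
  have b19 : s2.ireg 19 = N + 1 + insSize n d := by rw [f2.ir 19 (by decide), a19]
  refine Run.cons ((run_ins (d := d) hQX hnX c2.r0 c2.r3 c2.r4 c2.r5 c2.r6 b19 c2.r10 le_rfl
    p2).mono fun s3 f3 p3 => ?_)
  have c3 := c2.frame f3 (by decide)
  have d17 : s3.ireg 17 = rounds L K k d := by rw [f3.ir 17 (by decide), b17]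
  have d18 : s3.ireg 18 = N := by rw [f3.ir 18 (by decide), b18]
  refine Run.cons ((run_sched (k := k) (by omega) (by omega) (fun i hi => (hterm i hi).trans
    (by omega)) c3.r1 c3.r3 c3.r4 c3.r8 c3.r12 d17).mono ?_)
  rintro s4 f4 ⟨p4, p5⟩
  have c4 := c3.frame f4 (by decide)
  have e18 : s4.ireg 18 = N := by rw [f4.ir 18 (by decide), d18]
  have w4 : s4.rmem = fun j => (tables d p).getD j 0 := by
    rw [f4.rm (by decide), f3.rm (by decide), f2.rm (by decide), w1]
  have him : ∀ x, x ≠ 0 → ((Instr.istore 3 18).run s4).imem x = s4.imem x := by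
    intro x hx
    simp [Instr.run, c4.r3, Function.update_of_ne hx]
  have c5 := (((c4.run (i := .istore 3 18) (by decide)).run (i := .iadd 20 4 3) (by decide)).run
    (i := .iadd 21 13 3) (by decide)).run (i := .iadd 22 14 3) (by decide)
  have hlay : Layout n k d (N + 1) (N + 1 + insSize n d + insSize n d)
      (N + 1 + insSize n d + insSize n d + N + N) ((N + 1 + 1) * (k * (n + 1) ^ d)) N := by
    refine ⟨by omega, by omega, ?_, by omega, le_rfl⟩
    change N + 1 + insSize n d ≤ _
    omega
  refine Run.instr_cons (Run.instr_cons (Run.instr_cons (Run.instr_cons (Run.cons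
    ((run_mainLoop (P := p) hKX hQX (by omega) (by omega) h2X
      ((List.length_reverse).trans hlen) hlay (W := (sched (base L k d) k (rounds L K k d)).reverse)
      ⟨c5, ?_, ?_, ⟨?_, ?_, hp, ?_, trivial⟩, stores_nil _ _, stores_nil _ _, ?_, ?_, ?_⟩).mono
      ?_)))))
  · change InsTable n d ((Instr.istore 3 18).run s4).imem _
    refine p3.congr fun x hx hx' => ?_
    rw [him x (by omega), p5 x (by change _ < N + 1 + insSize n d at hx'; omega)]
  · change SchedTable ((Instr.istore 3 18).run s4).imem _ _
    exact p4.congr fun x hx _ => him x (by omega)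
  · simp [Instr.run, c4.r3, e18]
  · intro j hj
    simp [Instr.run, w4, List.getElem?_eq_getElem hj]
  · simp
  · simp [Instr.run, c4.r4, c4.r3]
  · simp [Instr.run, c4.r13, c4.r3]
  · simp [Instr.run, c4.r14, c4.r3]
  rintro s6 f6 ⟨q13, q14, qN, qR⟩
  rw [List.reverse_reverse] at qN qR
  have g3 : s6.ireg 3 = 0 := (c5.frame f6 (by decide)).r3
  refine Run.instr_cons (Run.instr_cons (Run.nil ⟨?_, ?_⟩))
  · simpa [Instr.run, q13, g3, theTree] using qN
  · simpa [Instr.run, q14, g3, theTree] using qR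

/-! ### Running time, labels and the final assembly. -/

/-- Approximations of the parameters exist. -/
theorem exists_approx {τ ε δ : ℝ} (hτ : 0 < τ) (hε : 0 < ε) (hε' : ε < 1 / 4) (hδ : 0 < δ)
    (hδ' : δ < 1 / 4) : ∃ L₁ K : ℕ, 1 / ε ≤ 2 ^ L₁ ∧ (∀ m' < L₁, (2:ℝ) ^ m' < 1 / ε) ∧
      1 / δ ≤ 2 ^ K ∧ (∀ m' < K, (2:ℝ) ^ m' < 1 / δ) ∧ Approx τ ε δ (max L₁ ⌈1 / τ⌉₊) K := by
  obtain ⟨L₁, a1, a2, a3⟩ := exists_log_approx hε hε'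
  obtain ⟨K, b1, b2, b3⟩ := exists_log_approx hδ hδ'
  refine ⟨L₁, K, a1, a2, b1, b2, ⟨?_, ?_, ?_, b1, b3⟩⟩
  · exact (Nat.le_ceil _).trans (by exact_mod_cast le_max_right _ _)
  · exact a1.trans (pow_le_pow_right₀ (by norm_num) (le_max_left _ _))
  · have h1 := (Nat.ceil_lt_add_one (show 0 ≤ 1 / τ by positivity)).le
    have h2 := (quarter_facts hε hε').2
    have h3 : 0 < 1 / τ := by positivity
    rw [Nat.cast_max, max_le_iff]
    constructor <;> linarith

/-- `P` and `l` stand for the length of the program and the nesting depth of its loops. The factor b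
+ 1 ≥ 1 only weakens the bound. -/
theorem time_le {n d b N c t P l : ℕ} {D : ℝ} (hN : ((N + 1 : ℕ) : ℝ) ≤ D) (hP : P ≤ c)
    (hl : l ≤ c) (ht : t ≤ P * ((n + 1) ^ d * 2 ^ (N + 1)) ^ l) :
    (t : ℝ) ≤ c * (((n : ℝ) + 1) ^ d * ((b : ℝ) + 1) * (2 : ℝ) ^ D) ^ c := by
  have h1 : (2:ℝ) ^ (N + 1) ≤ 2 ^ D := by
    rw [← Real.rpow_natCast]; exact Real.rpow_le_rpow_of_exponent_le (by norm_num) hN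
  have hn : (1:ℝ) ≤ ((n : ℝ) + 1) ^ d := one_le_pow₀ (by linarith [n.cast_nonneg (α := ℝ)])
  have hb : (1:ℝ) ≤ (b : ℝ) + 1 := by linarith [b.cast_nonneg (α := ℝ)]
  have h2 : (1:ℝ) ≤ 2 ^ (N + 1) := one_le_pow₀ (by norm_num)
  have h3 : ((n : ℝ) + 1) ^ d * 2 ^ (N + 1) ≤ ((n : ℝ) + 1) ^ d * ((b : ℝ) + 1) * (2 : ℝ) ^ D := by
    refine mul_le_mul ?_ h1 (by positivity) (by positivity)
    exact le_mul_of_one_le_right (by positivity) hb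
  have h4 : (1:ℝ) ≤ ((n : ℝ) + 1) ^ d * 2 ^ (N + 1) := one_le_mul_of_one_le_of_one_le hn h2
  calc (t : ℝ) ≤ P * (((n : ℝ) + 1) ^ d * 2 ^ (N + 1)) ^ l := by exact_mod_cast ht
    _ ≤ c * (((n : ℝ) + 1) ^ d * 2 ^ (N + 1)) ^ c := by
      gcongr
    _ ≤ _ := by gcongr

theorem label_const {τ ε δ : ℝ} {L K d : ℕ} (h : Approx τ ε δ L K) (hL : 1 ≤ L) (hk : 1 ≤ k)
    (hd : 1 ≤ d) (hε : 0 < ε) (hε' : ε < 1 / 4) {p : MPoly n} (hp : HasDegree d p) {σ : ℤˣ}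
    (hσ : lab (base L k d) p = .const σ) :
    IsSkewed 12 d ε p ∧ cubeProb (fun x => sgn (eval p x) ≠ σ) ≤ ε := by
  unfold lab at hσ
  split_ifs at hσ with h1 h2
  have hs := skew_isSkewed h hL hk hd hε hε' h2
  injection hσ with hσ
  exact ⟨hs, hσ ▸ sgn_of_isSkewed hd hε hε' hp hs⟩

theorem label_regular {τ ε δ : ℝ} {L K d : ℕ} (h : Approx τ ε δ L K) (hk : 1 ≤ k)
    (hd : 1 ≤ d) (hτ : 0 < τ) {p : MPoly n} (hp : lab (base L k d) p = .regular) :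
    IsRegular τ p := by
  unfold lab at hp
  split_ifs at hp with h1 h2
  exact reg_isRegular h hk hd hτ h1

theorem hasDegree_restrict {d : ℕ} {p : MPoly n} (hp : HasDegree d p) (ρ : Restriction n) :
    HasDegree d (restrict p ρ) := by
  intro U hU
  unfold restrict
  refine Finset.sum_eq_zero fun S hS => ?_
  have h1 := (Finset.mem_filter.1 hS).2
  have h2 := Finset.card_filter_le S (fun i => ρ i = none)
  rw [h1] at h2
  rw [hp S (by omega), zero_mul]

end PTFReg

theorem mainTheorem6 :
    ∃ (C : ℝ) (A c : ℕ) (ConstructTree : PTFReg.Prog), 0 < C ∧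
      -- the sign of a skewed polynomial is close to a constant
      (∀ (n d : ℕ) (ε : ℝ) (p : PTFReg.MPoly n),
        1 ≤ d → 0 < ε → ε < 1 / 4 → PTFReg.HasDegree d p → PTFReg.IsSkewed C d ε p →
        PTFReg.cubeProb (fun x => PTFReg.sgn (PTFReg.eval p x) ≠ PTFReg.sgn (p ∅)) ≤ ε) ∧
      -- existence of the tree, for real coefficients
      (∀ (n k d : ℕ) (τ ε δ : ℝ) (p : Fin k → PTFReg.MPoly n),
        1 ≤ k → 1 ≤ d → 0 < τ → τ < 1 / 4 → 0 < ε → ε < 1 / 4 → 0 < δ → δ < 1 / 4 →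
        (∀ i, PTFReg.HasDegree d (p i)) →
        ∃ T : PTFReg.DTree n Unit,
          T.ReadOnce ∧
          (T.depth : ℝ) ≤ PTFReg.depthBound A d k τ ε δ ∧
          1 - δ ≤ T.leafProb (fun ρ _ =>
            ∀ i, PTFReg.IsGood C d τ ε (PTFReg.restrict (p i) ρ))) ∧
      -- deterministic construction, for integer coefficients of `b` bits
      (∀ (n k d b : ℕ) (τ ε δ : ℝ) (p : Fin k → Finset (Fin n) → ℤ),
        1 ≤ k → 1 ≤ d → 0 < τ → τ < 1 / 4 → 0 < ε → ε < 1 / 4 → 0 < δ → δ < 1 / 4 →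
        (∀ i, PTFReg.HasDegree d (fun S => (p i S : ℝ))) →
        (∀ i S, |p i S| < 2 ^ b) →
        ∃ (t : ℕ) (s : PTFReg.State) (T : PTFReg.DTree n (PTFReg.LeafData n k)),
          PTFReg.Exec ConstructTree
            (PTFReg.inputState d (fun i S => (p i S : ℝ)) τ ε δ) s t ∧
          (t : ℝ) ≤ c * (((n : ℝ) + 1) ^ d * ((b : ℝ) + 1) *
            (2 : ℝ) ^ PTFReg.depthBound A d k τ ε δ) ^ c ∧
          PTFReg.Outputs d s T ∧
          T.ReadOnce ∧
          (T.depth : ℝ) ≤ PTFReg.depthBound A d k τ ε δ ∧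
          T.ForallLeaves (fun ρ a => ∀ i,
            a.poly i = PTFReg.restrict (fun S => (p i S : ℝ)) ρ ∧
            (∀ σ : ℤˣ, a.label i = PTFReg.Label.const σ →
              PTFReg.IsSkewed C d ε (a.poly i) ∧
              PTFReg.cubeProb (fun x => PTFReg.sgn (PTFReg.eval (a.poly i) x) ≠ σ) ≤ ε) ∧
            (a.label i = PTFReg.Label.regular → PTFReg.IsRegular τ (a.poly i))) ∧
          1 - δ ≤ T.leafProb (fun _ a => ∀ i, a.label i ≠ PTFReg.Label.fail)) := by
  -- The time is at most size · X^loops, so the larger of these two numbers serves both as factor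
  -- and as exponent.
  refine ⟨12, 11, max PTFReg.constructTree.size PTFReg.constructTree.loops, PTFReg.constructTree,
    by norm_num, ?_, ?_, ?_⟩
  · intro n d ε p hd h0 h1 hp hs
    exact PTFReg.sgn_of_isSkewed hd h0 h1 hp hs
  · intro n k d τ ε δ p hk hd hτ hτ' hε hε' hδ hδ' hp
    obtain ⟨L₁, K, -, -, -, -, h⟩ := PTFReg.exists_approx hτ hε hε' hδ hδ'
    exact PTFReg.exists_tree h hk hd hτ hτ' hε hε' hδ hδ' p hp
  · intro n k d b τ ε δ p hk hd hτ hτ' hε hε' hδ hδ' hp _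
    obtain ⟨L₁, K, a1, a2, a3, a4, h⟩ := PTFReg.exists_approx hτ hε hε' hδ hδ'
    have hL := h.one_le_left hτ hτ'
    have hK := h.one_le_right hδ hδ'
    have hN := PTFReg.total_le_depthBound h hk hd hτ hτ' hε hε' hδ hδ'
    set L := max L₁ ⌈1 / τ⌉₊ with hLdef
    have hX : NeZero ((n + 1) ^ d * 2 ^ (PTFReg.total L K k d + 1)) := ⟨by positivity⟩
    obtain ⟨s, t, e1, e2, e3⟩ := PTFReg.run_constructTree a1 a2 a3 a4 hLdef hL hK hk hd rfl
      (n := n) (p := fun i S => (p i S : ℝ)) hp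
    refine ⟨t, s, PTFReg.theTree d L K _, e1,
      PTFReg.time_le hN (le_max_left _ _) (le_max_right _ _) e2, e3,
      PTFReg.readOnce_build _ _ _, ?_, ?_, PTFReg.leafProb_theTree h hL hk hd hδ hp⟩
    · refine le_trans ?_ hN
      exact_mod_cast (PTFReg.depth_build _ _ _).trans (Nat.le_succ _)
    · refine (PTFReg.forallLeaves_build _ _ _).imp fun ρ a ha i => ?_
      subst ha
      exact ⟨rfl, fun σ hσ => PTFReg.label_const h hL hk hd hε hε'
          (PTFReg.hasDegree_restrict (hp i) ρ) hσ,
        fun hr => PTFReg.label_regular h hk hd hτ hr⟩
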